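/- **Setting.** Let $M\ge 1$ be odd, $n\ge 2$ even with $n\ge M-1$, $N=2(2n+M)+3$, and $\mathcal E>0$. Qubits are labelled $A=1,\dots,M$. Put $o_A=1$ for $A$ even and $o_A=3$ for $A$ odd; $f_A=N$ for $A$ odd with $A<M$, and $f_A=N-2$ otherwise. Qubit $A$ is a single particle occupying one of the orbitals $(i,b)$ with $o_A-1\le i\le f_A$ (time step) and $b\in\{0,1\}$ (bit value). Let $c^\dagger_{A,i,b}$ be the creation operators, $C^\dagger_{A,i}=[c^\dagger_{A,i,0}\ c^\dagger_{A,i,1}]$; the Hilbert space is spanned by the states with exactly one particle per qubit, and all operators act on it as operators on the tensor product of the one-particle spaces of the qubits. *Circuit (one-dimensional configuration).* For $1\le j\le 2n+M-1$, at time step $i=2j+2$ there is a 2-qubit gate $U_{A,i;A+1,i}\in\mathbf U(4)$ on each pair $(A,A+1)$ with $A+1\le M$ and $j+A$ odd. At every other time step $i\in[o_A,f_A]$ at which qubit $A$ is not part of a 2-qubit gate there is a 1-qubit gate $U_{A,i}\in\mathbf U(2)$. The first gate on each qubit, all 1-qubit gates at even time steps, and all gates at time steps $i>2n+3$ are identities.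 *Hamiltonian.* Put $$h^i_A(U)=\mathcal E[C^\dagger_{A,i}-C^\dagger_{A,i-1}U^\dagger][C_{A,i}-UC_{A,i-1}],\qquad h^i_A(\mathrm{INIT})=\mathcal E\,c^\dagger_{A,i,1}c_{A,i,1},$$ $$h^{i,i}_{A,B}(U)=\mathcal E[C^\dagger_{A,i}\otimes C^\dagger_{B,i}-C^\dagger_{A,i-1}\otimes C^\dagger_{B,i-1}U^\dagger][C_{A,i}\otimes C_{B,i}-U\,C_{A,i-1}\otimes C_{B,i-1}],$$ $$h^{i,i}_{A,B}(\mathrm P)=\mathcal E\sum_{k<i,\ l\ge i}\bigl(C^\dagger_{A,k}C_{A,k}\otimes C^\dagger_{B,l}C_{B,l}+C^\dagger_{A,l}C_{A,l}\otimes C^\dagger_{B,k}C_{B,k}\bigr).$$ Let $F(x)=0$ for $x\le 0$, $F(x)=10x^3-15x^4+6x^5$ for $0\le x\le1$, $F(x)=1$ for $x\ge1$, and $\lambda_A=\lambda_A(\lambda)=F(M\lambda-A+1)$. For $\lambda\in[0,1]$, $$H(\lambda)=\sum_{A=2}^M\mathcal E(1-\lambda_{A-1}^3)\sum_{i=o_A}^{f_A}C^\dagger_{A,i}C_{A,i}+\sum_{A=1}^M\bigl(h_A^{o_A-1}(\mathrm{INIT})+h_A^{o_A}(\lambda_A\mathcal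 I)\bigr)+\sum_{\substack{U_{A,i}\\ i\ne o_A}}h_A^i(U_{A,i})+\sum_{U_{A,i;B,i}}\bigl(h^{i,i}_{A,B}(U_{A,i;B,i})+h^{i,i}_{A,B}(\mathrm P)\bigr),$$ the last two sums being over the 1-qubit and the 2-qubit gates of the circuit. Let $H'(\lambda)$ be the Hamiltonian obtained by replacing every gate by an identity gate. **Theorem (Gap of $H(\lambda)$).** For $\lambda\in[0,1]$ let $|\psi_0(\lambda)\rangle$ be a normalized ground state of $H'(\lambda)$, let $A=A(\lambda)=\lfloor M\lambda\rfloor+1$ if $\lambda<1$ and $A=M$ if $\lambda=1$, and let $e_1(\lambda)$ be the lowest nonzero eigenvalue of $H'(\lambda)-h_A^{o_A}(\lambda_A\mathcal I)$ in the sub-block in which all bits have value zero (this exists). Then for every $\lambda\in[0,1]$ the ground state of $H(\lambda)$ is nondegenerate, and the gap $g(\lambda)$ between its ground state energy and its next eigenvalue satisfies $$g(\lambda)\ \ge\ g_{\min}=\inf_{\lambda'\in[0,1]}\tfrac14\,e_1(\lambda')\,\langle\psi_0(\lambda')|c^\dagger_{A,o_A-1,0}c_{A,o_A-1,0}|\psi_0(\lambda')\rangle,\qquad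 A=A(\lambda').$$ In particular this holds for $H'(\lambda)$ itself. -/

import Mathlib

open scoped Matrix

namespace GSQC

/- Conventions. There are `M` qubits, indexed by `A : Fin M`; the qubit called `1, …, M` in the usual
numbering is `A.val + 1`. The circuit comes from an algorithm of depth `n`. -/

/-- The usual (one-based) label of a qubit. -/
def label {M : ℕ} (A : Fin M) : ℕ := A.val + 1

/-- `o_A`: the time step of the first gate on qubit `A` (`1` for even labels, `3` for odd labels). -/
def firstStep {M : ℕ} (A : Fin M) : ℕ := if Even (label A) then 1 else 3

/-- `f_A`: the time step of the last gate on qubit `A`. -/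
def lastStep (n : ℕ) {M : ℕ} (A : Fin M) : ℕ :=
  if Odd (label A) ∧ label A < M then 2 * (2 * n + M) + 3 else 2 * (2 * n + M) + 1

/-- The net depth `N` of the circuit. -/
def depth (M n : ℕ) : ℕ := 2 * (2 * n + M) + 3

/-- A two-qubit gate acts at time step `i` on the neighbours `A` and `B = A + 1`: this happens at the
times `i = 2 j + 2`, `1 ≤ j ≤ 2 n + M - 1`, on the pairs `(2,3), (4,5), …` for odd `j` and on the
pairs `(1,2), (3,4), …` for even `j`. -/
def IsTwoQubitGate (n : ℕ) {M : ℕ} (A B : Fin M) (i : ℕ) : Prop :=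
  B.val = A.val + 1 ∧ ∃ j ∈ Finset.Icc 1 (2 * n + M - 1), i = 2 * j + 2 ∧ Odd (j + label A)

instance (n : ℕ) {M : ℕ} (A B : Fin M) (i : ℕ) : Decidable (IsTwoQubitGate n A B i) := by
  unfold IsTwoQubitGate; infer_instance

/-- A one-qubit gate acts on `A` at time step `i`: at every time step between `o_A` and `f_A`
at which `A` does not take part in a two-qubit gate. These are all the odd time steps, the even
time steps at which an end qubit has no partner, and the extra steps at the start and the end. -/
def IsOneQubitGate (n : ℕ) {M : ℕ} (A : Fin M) (i : ℕ) : Prop :=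
  firstStep A ≤ i ∧ i ≤ lastStep n A ∧
    ∀ B : Fin M, ¬ IsTwoQubitGate n A B i ∧ ¬ IsTwoQubitGate n B A i

instance (n : ℕ) {M : ℕ} (A : Fin M) (i : ℕ) : Decidable (IsOneQubitGate n A i) := by
  unfold IsOneQubitGate; infer_instance

/-- A circuit in the one-dimensional configuration. `gate1 A i` is the gate `U_{A,i}`, used when
`IsOneQubitGate n A i`; `gate2 A i` is the gate `U_{A,i;A+1,i}` acting on the pair of bits
of `A` and `A + 1`, used when `IsTwoQubitGate n A (A + 1) i`. The first gate on every qubit, the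
one-qubit gates at even time steps, and all gates in the final `2 n + 2 M` time steps (that is,
at the steps `i > 2 n + 3`) are identities. -/
structure OneDimCircuit (M n : ℕ) where
  gate1 : Fin M → ℕ → Matrix.unitaryGroup (Fin 2) ℂ
  gate2 : Fin M → ℕ → Matrix.unitaryGroup (Fin 2 × Fin 2) ℂ
  gate1_first : ∀ A, gate1 A (firstStep A) = 1
  gate1_even : ∀ A i, Even i → gate1 A i = 1
  gate1_final : ∀ A i, 2 * n + 3 < i → gate1 A i = 1
  gate2_final : ∀ A i, 2 * n + 3 < i → gate2 A i = 1

/-- The circuit in which every gate is replaced by an identity gate. -/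
def identityCircuit (M n : ℕ) : OneDimCircuit M n where
  gate1 _ _ := 1
  gate2 _ _ := 1
  gate1_first _ := rfl
  gate1_even _ _ _ := rfl
  gate1_final _ _ _ := rfl
  gate2_final _ _ _ := rfl

/-- The one-particle orbitals of qubit `A`: a time step in `[o_A - 1, f_A]` and a bit value. -/
abbrev Site (n : ℕ) {M : ℕ} (A : Fin M) : Type :=
  Finset.Icc (firstStep A - 1) (lastStep n A) × Fin 2

/-- The occupation basis: exactly one particle in the orbitals of each qubit. The Hilbert space is
`Conf M n → ℂ` with the inner product `star φ ⬝ᵥ ψ`. -/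
abbrev Conf (M n : ℕ) : Type := (A : Fin M) → Site n A

/-- Operators on the Hilbert space. -/
abbrev Op (M n : ℕ) : Type := Matrix (Conf M n) (Conf M n) ℂ

/-- `C†_{A,i} X C_{A,j} = ∑_{b,b'} X_{b,b'} c†_{A,i,b} c_{A,j,b'}`. -/
def bilin {M n : ℕ} (A : Fin M) (i j : ℕ) (X : Matrix (Fin 2) (Fin 2) ℂ) : Op M n :=
  Matrix.of fun c d =>
    if (∀ B, B ≠ A → c B = d B) ∧ ((c A).1 : ℕ) = i ∧ ((d A).1 : ℕ) = j
    then X (c A).2 (d A).2 else 0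

/-- `(C†_{A,i} ⊗ C†_{B,j}) X (C_{A,k} ⊗ C_{B,l})` for two distinct qubits. -/
def bilin2 {M n : ℕ} (A B : Fin M) (i j k l : ℕ)
    (X : Matrix (Fin 2 × Fin 2) (Fin 2 × Fin 2) ℂ) : Op M n :=
  Matrix.of fun c d =>
    if (∀ D, D ≠ A → D ≠ B → c D = d D) ∧
      ((c A).1 : ℕ) = i ∧ ((c B).1 : ℕ) = j ∧ ((d A).1 : ℕ) = k ∧ ((d B).1 : ℕ) = l
    then X ((c A).2, (c B).2) ((d A).2, (d B).2) else 0

/-- The number operator `C†_{A,i} C_{A,i}`. -/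
def num {M n : ℕ} (A : Fin M) (i : ℕ) : Op M n := bilin A i i 1

/-- The number operator `c†_{A,i,b} c_{A,i,b}`. -/
def numBit {M n : ℕ} (A : Fin M) (i : ℕ) (b : Fin 2) : Op M n :=
  bilin A i i (Matrix.single b b 1)

/-- `h^i_A(U) = ℰ [C†_{A,i} - C†_{A,i-1} U†] [C_{A,i} - U C_{A,i-1}]`, multiplied out
(`U` need not be unitary). -/
noncomputable def hOne {M n : ℕ} (ℰ : ℝ) (A : Fin M) (i : ℕ) (U : Matrix (Fin 2) (Fin 2) ℂ) :
    Op M n :=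
  (ℰ : ℂ) • (bilin A i i 1 - bilin A i (i - 1) U - bilin A (i - 1) i Uᴴ
    + bilin A (i - 1) (i - 1) (Uᴴ * U))

/-- `h^i_A(INIT) = ℰ c†_{A,i,1} c_{A,i,1}`. -/
noncomputable def hInit {M n : ℕ} (ℰ : ℝ) (A : Fin M) (i : ℕ) : Op M n :=
  (ℰ : ℂ) • numBit A i 1

/-- `h^{i,i}_{A,B}(U) = ℰ [C†_{A,i} ⊗ C†_{B,i} - C†_{A,i-1} ⊗ C†_{B,i-1} U†]
[C_{A,i} ⊗ C_{B,i} - U C_{A,i-1} ⊗ C_{B,i-1}]`, multiplied out. -/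
noncomputable def hTwo {M n : ℕ} (ℰ : ℝ) (A B : Fin M) (i : ℕ)
    (U : Matrix (Fin 2 × Fin 2) (Fin 2 × Fin 2) ℂ) : Op M n :=
  (ℰ : ℂ) • (bilin2 A B i i i i 1 - bilin2 A B i i (i - 1) (i - 1) U
    - bilin2 A B (i - 1) (i - 1) i i Uᴴ
    + bilin2 A B (i - 1) (i - 1) (i - 1) (i - 1) (Uᴴ * U))

/-- The penalty `h^{i,i}_{A,B}(P)`: energy `ℰ` when exactly one of the two particles has
passed the gate at time step `i`. -/
noncomputable def hPenalty {M n : ℕ} (ℰ : ℝ) (A B : Fin M) (i : ℕ) : Op M n :=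
  (ℰ : ℂ) • ∑ k ∈ Finset.range i, ∑ l ∈ Finset.Icc i (depth M n),
    (num A k * num B l + num A l * num B k)

/-- The GSQC Hamiltonian with independent parameters `lam A`. -/
noncomputable def Hindependent {M n : ℕ} (U : OneDimCircuit M n) (ℰ : ℝ) (lam : Fin M → ℝ) :
    Op M n :=
  (∑ B : Fin M, ∑ A : Fin M, if A.val = B.val + 1 then
      ((ℰ * (1 - lam B ^ 3) : ℝ) : ℂ) • ∑ i ∈ Finset.Icc (firstStep A) (lastStep n A), num A i
    else 0)
  + ∑ A : Fin M, (hInit ℰ A (firstStep A - 1) + hOne ℰ A (firstStep A) ((lam A : ℂ) • 1))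
  + ∑ i ∈ Finset.Icc 1 (depth M n),
    ((∑ A : Fin M, if IsOneQubitGate n A i ∧ i ≠ firstStep A then
        hOne ℰ A i (U.gate1 A i : Matrix (Fin 2) (Fin 2) ℂ) else 0)
    + ∑ A : Fin M, ∑ B : Fin M, if IsTwoQubitGate n A B i then
        hTwo ℰ A B i (U.gate2 A i : Matrix (Fin 2 × Fin 2) (Fin 2 × Fin 2) ℂ)
          + hPenalty ℰ A B i else 0)

/-- The ramp `F`, equal to `0` for `x ≤ 0`, to `1` for `x ≥ 1`, and to
`10 x³ - 15 x⁴ + 6 x⁵` in between. -/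
noncomputable def ramp (x : ℝ) : ℝ :=
  if x ≤ 0 then 0 else if 1 ≤ x then 1 else 10 * x ^ 3 - 15 * x ^ 4 + 6 * x ^ 5

/-- `λ_A(λ) = F(M λ - (label A - 1))`, which rises from `0` to `1` while
`(label A - 1) / M ≤ λ ≤ label A / M`. -/
noncomputable def lam {M : ℕ} (l : ℝ) (A : Fin M) : ℝ := ramp (M * l - (label A - 1))

/-- The Hamiltonian `H(λ)`. -/
noncomputable def H {M n : ℕ} (U : OneDimCircuit M n) (ℰ l : ℝ) : Op M n :=
  Hindependent U ℰ (lam l)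

/-- The qubit with label `⌊M λ⌋ + 1` if `0 ≤ λ < 1`, and the last qubit (label `M`) if `λ = 1`. -/
noncomputable def activeQubit (M : ℕ) [NeZero M] (l : ℝ) : Fin M :=
  ⟨min ⌊M * l⌋₊ (M - 1), lt_of_le_of_lt (min_le_right _ _) (Nat.sub_one_lt (NeZero.ne M))⟩

/-- The (real) eigenvalues of an operator. -/
def energies {M n : ℕ} (K : Op M n) : Set ℝ :=
  {μ | Module.End.HasEigenvalue (Matrix.toLin' K) (μ : ℂ)}

/-- `ψ` is a normalized ground state of `K`: an eigenvector for the lowest eigenvalue. -/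
def IsGroundState {M n : ℕ} (K : Op M n) (ψ : Conf M n → ℂ) : Prop :=
  star ψ ⬝ᵥ ψ = 1 ∧ ∃ E₀ : ℝ, IsLeast (energies K) E₀ ∧ K *ᵥ ψ = (E₀ : ℂ) • ψ

/-- `K` has a nondegenerate ground state, and the first excited energy lies above the ground
state energy by exactly `g`. -/
def IsGap {M n : ℕ} (K : Op M n) (g : ℝ) : Prop :=
  ∃ E₀ E₁ : ℝ, IsLeast (energies K) E₀ ∧
    Module.finrank ℂ (Module.End.eigenspace (Matrix.toLin' K) (E₀ : ℂ)) = 1 ∧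
    IsLeast {μ ∈ energies K | μ ≠ E₀} E₁ ∧ g = E₁ - E₀

/-- The expectation value `⟨ψ|K|ψ⟩`. -/
noncomputable def expectation {M n : ℕ} (K : Op M n) (ψ : Conf M n → ℂ) : ℝ :=
  (star ψ ⬝ᵥ (K *ᵥ ψ)).re

/-- The eigenvalues of `K` in the sub-block in which all bits have value zero, that is, with
an eigenvector supported on the basis states all of whose bits are `0`. -/
def zeroBitEnergies {M n : ℕ} (K : Op M n) : Set ℝ :=
  {μ | ∃ v : Conf M n → ℂ, v ≠ 0 ∧ (∀ c, (∃ A, (c A).2 ≠ 0) → v c = 0) ∧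
    K *ᵥ v = (μ : ℂ) • v}

/-- `H(λ) - h_A^{o_A}(λ_A 𝓘)` for the identity circuit, where `A` is the active qubit at `λ`. -/
noncomputable def reducedH (M n : ℕ) [NeZero M] (ℰ l : ℝ) : Op M n :=
  H (identityCircuit M n) ℰ l -
    hOne ℰ (activeQubit M l) (firstStep (activeQubit M l))
      ((lam l (activeQubit M l) : ℂ) • 1)

/-- The nonzero eigenvalues of `H(λ) - h_A^{o_A}(λ_A 𝓘)` in the sub-block with all bits zero. -/
def nonzeroReducedEnergies (M n : ℕ) [NeZero M] (ℰ l : ℝ) : Set ℝ :=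
  {μ ∈ zeroBitEnergies (reducedH M n ℰ l) | μ ≠ 0}

/-- `e₁(λ)`: the lowest nonzero eigenvalue of `H(λ) - h_A^{o_A}(λ_A 𝓘)` in the sub-block with all
bits zero. -/
noncomputable def e₁ (M n : ℕ) [NeZero M] (ℰ l : ℝ) : ℝ := sInf (nonzeroReducedEnergies M n ℰ l)

/-- `⟨ψ|c†_{A,o_A-1,0} c_{A,o_A-1,0}|ψ⟩`, where `A` is the active qubit at `λ`. -/
noncomputable def startOccupation {M n : ℕ} [NeZero M] (l : ℝ) (ψ : Conf M n → ℂ) : ℝ :=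
  expectation (numBit (activeQubit M l) (firstStep (activeQubit M l) - 1) 0) ψ

end GSQC

/-! Write x for the time steps of all qubits and b for their bits. Conjugation by the unitary ∑ₓ
|x⟩⟨x| ⊗ (product of the gates already passed at x), called `gauge`, turns every gate into an
identity. The INIT terms survive because a qubit at its start has passed no gate, and the
λ-dependent terms survive because first gates are identities (`H_eq_gauge_conj`). What remains is
block diagonal in b. In units of ℰ each block is a real matrix `posH` on time steps plus the number
of qubits at their start with bit one.

Block b = 0. Let A be the active qubit and a = λ_A. Without the first gate on A one has a
nonnegative matrix `posR`, whose kernel is exactly two-dimensional. It is spanned by the indicators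
of the legal positions with all later qubits at the start and A itself at the start (s of them) or
moved (m of them) (`IsStage.posR_mulVec_ind`, `IsStage.eq_of_posR_mulVec`). Let e be the lowest
nonzero eigenvalue of `posR`. The first gate on A singles out one line in this kernel, the ground
state with amplitudes 1 and a and energy zero. A bound on the sum of two forms in terms of an angle
(`two_form_bound`) gives the gap e (s + a² m) / ((e + 1 + a²) m) in this block
(`IsStage.posH_form_ge`).

Comparison. The quantity under the infimum at λ' is ¼ e₁(λ') s / (s + a'² m). It need not lie below
the gap at λ' itself, so other parameters are used. If e ≤ 1, a later parameter of the same stage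
with a'² ≥ ½ works, because e decreases while a qubit is switched on (`IsStage.antitone`). If e ≥ 1,
the parameter λ' = 1 works: there a linear trial function in the time step of the last qubit gives
e₁ ≤ 12 / (ℓ (ℓ + 1)) in units of ℰ, with ℓ = 4n + 2M - 1 (`IsStage.eigenvalue_le`).

Blocks b ≠ 0. If the bit of B is one, the block has a killing term wherever B is at its start or the
position is illegal. Distinct gates commute as moves, so the bottom of the undamped problem has
positive increasing supersolutions, and damping first gates by factors in [0, 1] can only raise the
energy (`CommutingMoves.damped_form_ge`). This reduces everything to λ = 1, where `two_form_bound`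
is used again. It needs the fraction of legal positions with B at its start, which is bounded below
by a transfer-matrix count (`le_card_legalStart`). The result is at least the value under the
infimum at λ' = 1 (`gapValue_le_blockForm`). -/

namespace GSQC

/-! ### Linear algebra: sums of two forms and symmetric matrices -/

/-- If `X ≥ a ‖w‖²` on the complement of a vector `u` and `Y` dominates `b` times the projection
on `ξ`, then `X + Y` is bounded below in terms of the overlap of `ξ` and `u`. -/
theorem two_form_bound {ι : Type*} [Fintype ι] (u ξ f w : ι → ℝ) (α a b X Y : ℝ)
    (ha : 0 < a) (hb : 0 < b) (hf : f = α • u + w) (huw : u ⬝ᵥ w = 0)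
    (hX : a * (w ⬝ᵥ w) ≤ X) (hY : b * (ξ ⬝ᵥ f) ^ 2 ≤ Y * (ξ ⬝ᵥ ξ)) :
    a * b * (ξ ⬝ᵥ u) ^ 2 * (f ⬝ᵥ f) ≤ (X + Y) * (a + b) * (ξ ⬝ᵥ ξ) * (u ⬝ᵥ u) := by
  have hself : ∀ v : ι → ℝ, 0 ≤ v ⬝ᵥ v := fun v =>
    Finset.sum_nonneg fun i _ => mul_self_nonneg (v i)
  have hff : f ⬝ᵥ f = α ^ 2 * (u ⬝ᵥ u) + w ⬝ᵥ w := by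
    rw [hf]
    simp only [add_dotProduct, dotProduct_add, smul_dotProduct, dotProduct_smul, smul_eq_mul,
      huw, dotProduct_comm w u]
    ring
  have hξf : ξ ⬝ᵥ f = α * (ξ ⬝ᵥ u) + ξ ⬝ᵥ w := by
    rw [hf]
    simp only [dotProduct_add, dotProduct_smul, smul_eq_mul]
  -- Cauchy–Schwarz for w against the component of ξ orthogonal to u, multiplied through by u·u to
  -- avoid a division.
  have hcs : ((u ⬝ᵥ u) * (ξ ⬝ᵥ w)) ^ 2 ≤
      ((u ⬝ᵥ u) ^ 2 * (ξ ⬝ᵥ ξ) - (u ⬝ᵥ u) * (ξ ⬝ᵥ u) ^ 2) * (w ⬝ᵥ w) := by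
    have h := Finset.sum_mul_sq_le_sq_mul_sq Finset.univ
      ((u ⬝ᵥ u) • ξ - (ξ ⬝ᵥ u) • u) w
    have h1 : ∑ i, ((u ⬝ᵥ u) • ξ - (ξ ⬝ᵥ u) • u) i * w i = (u ⬝ᵥ u) * (ξ ⬝ᵥ w) := by
      change ((u ⬝ᵥ u) • ξ - (ξ ⬝ᵥ u) • u) ⬝ᵥ w = _
      simp only [sub_dotProduct, smul_dotProduct, huw, smul_eq_mul]
      ring
    have h2 : ∑ i, ((u ⬝ᵥ u) • ξ - (ξ ⬝ᵥ u) • u) i ^ 2 =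
        (u ⬝ᵥ u) ^ 2 * (ξ ⬝ᵥ ξ) - (u ⬝ᵥ u) * (ξ ⬝ᵥ u) ^ 2 := by
      simp only [pow_two]
      change ((u ⬝ᵥ u) • ξ - (ξ ⬝ᵥ u) • u) ⬝ᵥ ((u ⬝ᵥ u) • ξ - (ξ ⬝ᵥ u) • u) = _
      simp only [sub_dotProduct, dotProduct_sub, smul_dotProduct, dotProduct_smul, smul_eq_mul,
        dotProduct_comm u ξ]
      ring
    have h3 : ∑ i, w i ^ 2 = w ⬝ᵥ w := by simp only [pow_two]; rfl
    rwa [h1, h2, h3] at h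
  set U := u ⬝ᵥ u with hU
  set Z := ξ ⬝ᵥ ξ with hZ
  set W := w ⬝ᵥ w with hW
  set r := ξ ⬝ᵥ u
  set σ := ξ ⬝ᵥ w
  have hU0 : 0 ≤ U := hself u
  have hZ0 : 0 ≤ Z := hself ξ
  have hW0 : 0 ≤ W := hself w
  rw [hff]
  rw [hξf] at hY
  rcases hU0.eq_or_lt with hU1 | hU1
  · have hu : u = 0 := by
      have : u ⬝ᵥ u = 0 := by rw [← hU, ← hU1]
      exact dotProduct_self_eq_zero.1 this
    have hr : r = 0 := by simp [r, hu]
    rw [← hU1, hr]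
    simp
  have hcs' : U * σ ^ 2 ≤ (U * Z - r ^ 2) * W := by
    have : U * (U * σ ^ 2) ≤ U * ((U * Z - r ^ 2) * W) := by nlinarith [hcs]
    exact le_of_mul_le_mul_left this hU1
  -- The difference of the two sides is exactly the sum of the four nonnegative terms below. The
  -- square in `e1` comes from minimizing over the mixing of α and σ.
  have key : a * b * r ^ 2 * (α ^ 2 * U + W) ≤
      (a + b) * U * (a * W * Z + b * (α * r + σ) ^ 2) := by
    have e1 : 0 ≤ U * ((a + b) * σ + b * (α * r)) ^ 2 := by positivity
    have e2 : 0 ≤ a ^ 2 * ((U * Z - r ^ 2) * W - U * σ ^ 2) :=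
      mul_nonneg (sq_nonneg _) (by linarith)
    have e3 : 0 ≤ a * b * ((U * Z - r ^ 2) * W - U * σ ^ 2) :=
      mul_nonneg (by positivity) (by linarith)
    have e4 : 0 ≤ a ^ 2 * (r ^ 2 * W) := by positivity
    nlinarith [e1, e2, e3, e4]
  have h5 : a * W * Z + b * (α * r + σ) ^ 2 ≤ (X + Y) * Z := by
    nlinarith [mul_le_mul_of_nonneg_right hX hZ0]
  calc _ ≤ (a + b) * U * (a * W * Z + b * (α * r + σ) ^ 2) := key
    _ ≤ (a + b) * U * ((X + Y) * Z) := mul_le_mul_of_nonneg_left h5 (by positivity)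
    _ = _ := by ring

/-- The quadratic form of a real symmetric matrix whose nonzero eigenvalues are at least `e` is
bounded below on the orthogonal complement of the kernel. -/
theorem form_ge_of_orthogonal_ker {ι : Type*} [Fintype ι] [DecidableEq ι] (A : Matrix ι ι ℝ)
    (hA : A.IsHermitian) (e : ℝ)
    (he : ∀ (μ : ℝ) (u : ι → ℝ), u ≠ 0 → A *ᵥ u = μ • u → μ ≠ 0 → e ≤ μ) (w : ι → ℝ)
    (hw : ∀ u : ι → ℝ, A *ᵥ u = 0 → u ⬝ᵥ w = 0) :
    e * (w ⬝ᵥ w) ≤ w ⬝ᵥ (A *ᵥ w) := by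
  classical
  set B := hA.eigenvectorBasis
  have hinner : ∀ x y : ι → ℝ, inner ℝ (WithLp.toLp 2 x) (WithLp.toLp 2 y) = x ⬝ᵥ y := by
    intro x y
    rw [EuclideanSpace.inner_toLp_toLp, dotProduct_comm]
    simp
  have hexp : ∀ x y : ι → ℝ, x ⬝ᵥ y = ∑ i, ((B i).ofLp ⬝ᵥ x) * ((B i).ofLp ⬝ᵥ y) := by
    intro x y
    rw [← hinner, ← B.sum_inner_mul_inner]
    refine Finset.sum_congr rfl fun i _ => ?_
    rw [← hinner, ← hinner, real_inner_comm]
  have hsym : ∀ x y : ι → ℝ, x ⬝ᵥ (A *ᵥ y) = (A *ᵥ x) ⬝ᵥ y := by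
    intro x y
    have hT : Aᵀ = A := by rw [← Matrix.conjTranspose_eq_transpose_of_trivial]; exact hA
    rw [Matrix.dotProduct_mulVec, ← Matrix.mulVec_transpose, hT]
  have heig : ∀ i, A *ᵥ (B i).ofLp = hA.eigenvalues i • (B i).ofLp := hA.mulVec_eigenvectorBasis
  rw [hexp w w, hexp w (A *ᵥ w), Finset.mul_sum]
  refine Finset.sum_le_sum fun i _ => ?_
  rw [hsym, heig, smul_dotProduct, smul_eq_mul]
  by_cases h0 : hA.eigenvalues i = 0
  · have : (B i).ofLp ⬝ᵥ w = 0 := hw _ (by rw [heig, h0, zero_smul])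
    rw [this]; simp
  · have hne : (B i).ofLp ≠ 0 := by
      intro h
      have h1 := B.orthonormal.1 i
      rw [← WithLp.toLp_ofLp 2 (B i), h] at h1
      simp at h1
    have := he _ _ hne (heig i) h0
    nlinarith [mul_le_mul_of_nonneg_right this (sq_nonneg ((B i).ofLp ⬝ᵥ w))]

/-- A nonzero real symmetric matrix has a nonzero eigenvalue. -/
theorem exists_ne_zero_eigenvalue {ι : Type*} [Fintype ι] [DecidableEq ι] (A : Matrix ι ι ℝ)
    (hA : A.IsHermitian) (h0 : A ≠ 0) :
    ∃ (μ : ℝ) (u : ι → ℝ), u ≠ 0 ∧ A *ᵥ u = μ • u ∧ μ ≠ 0 := by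
  obtain ⟨v, t, ht, hv, h⟩ := hA.exists_eigenvector_of_ne_zero h0
  exact ⟨t, v, hv, h, ht⟩

/-! ### Spectra of operators and a criterion for the gap -/

theorem mem_energies_iff {M n : ℕ} (K : Op M n) (μ : ℝ) :
    μ ∈ energies K ↔ ∃ v : Conf M n → ℂ, v ≠ 0 ∧ K *ᵥ v = (μ : ℂ) • v := by
  constructor
  · intro h
    obtain ⟨v, hv⟩ := h.exists_hasEigenvector
    exact ⟨v, hv.2, by simpa using hv.apply_eq_smul⟩
  · rintro ⟨v, hv, h⟩
    exact Module.End.hasEigenvalue_of_hasEigenvector (x := v)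
      ⟨Module.End.mem_eigenspace_iff.2 (by simpa using h), hv⟩

theorem energies_finite {M n : ℕ} (K : Op M n) : (energies K).Finite := by
  have h : {z : ℂ | Module.End.HasEigenvalue (Matrix.toLin' K) z}.Finite :=
    Module.End.finite_hasEigenvalue _
  exact h.preimage (f := fun x : ℝ => (x : ℂ)) (Complex.ofReal_injective.injOn)

theorem star_dotProduct_self_pos {ι : Type*} [Fintype ι] {v : ι → ℂ} (hv : v ≠ 0) :
    0 < (star v ⬝ᵥ v).re := by
  obtain ⟨i, hi⟩ := Function.ne_iff.1 hv
  have h1 : star v ⬝ᵥ v = ((∑ i, Complex.normSq (v i) : ℝ) : ℂ) := by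
    simp only [dotProduct, Pi.star_apply, RCLike.star_def, ← Complex.normSq_eq_conj_mul_self,
      Complex.ofReal_sum]
  rw [h1, Complex.ofReal_re]
  exact Finset.sum_pos' (fun i _ => Complex.normSq_nonneg _)
    ⟨i, Finset.mem_univ i, Complex.normSq_pos.2 hi⟩

/-- A positive semidefinite operator with a null vector `ψ`, bounded below by `γ > 0` on the
orthogonal complement of `ψ`, has a nondegenerate ground state and a gap of at least `γ`. -/
theorem exists_isGap {M n : ℕ} (K : Op M n) (hK : K.IsHermitian)
    (hpos : ∀ v : Conf M n → ℂ, 0 ≤ (star v ⬝ᵥ (K *ᵥ v)).re)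
    (ψ : Conf M n → ℂ) (hψ : ψ ≠ 0) (hKψ : K *ᵥ ψ = 0) (γ : ℝ) (hγ : 0 < γ)
    (hgap : ∀ v : Conf M n → ℂ, star ψ ⬝ᵥ v = 0 →
      γ * (star v ⬝ᵥ v).re ≤ (star v ⬝ᵥ (K *ᵥ v)).re)
    (hcard : ∃ v : Conf M n → ℂ, v ≠ 0 ∧ star ψ ⬝ᵥ v = 0) :
    ∃ g, IsGap K g ∧ γ ≤ g := by
  classical
  have hψψ := star_dotProduct_self_pos hψ
  have hψψ0 : star ψ ⬝ᵥ ψ ≠ 0 := fun h => by rw [h] at hψψ; simp at hψψ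
  have hEpos : ∀ μ ∈ energies K, 0 ≤ μ := by
    intro μ hμ
    obtain ⟨v, hv, h⟩ := (mem_energies_iff K μ).1 hμ
    have h1 := hpos v
    rw [h, dotProduct_smul, smul_eq_mul, Complex.re_ofReal_mul] at h1
    exact nonneg_of_mul_nonneg_left h1 (star_dotProduct_self_pos hv)
  have h0 : (0 : ℝ) ∈ energies K := (mem_energies_iff K 0).2 ⟨ψ, hψ, by simp [hKψ]⟩
  have hker : ∀ v, K *ᵥ v = 0 → ∃ c : ℂ, c • ψ = v := by
    intro v hv
    set c := (star ψ ⬝ᵥ v) / (star ψ ⬝ᵥ ψ)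
    refine ⟨c, ?_⟩
    by_contra hne
    have hw : v - c • ψ ≠ 0 := fun h => hne (sub_eq_zero.1 h).symm
    have horth : star ψ ⬝ᵥ (v - c • ψ) = 0 := by
      rw [dotProduct_sub, dotProduct_smul, smul_eq_mul, div_mul_cancel₀ _ hψψ0, sub_self]
    have := hgap _ horth
    rw [Matrix.mulVec_sub, Matrix.mulVec_smul, hv, hKψ] at this
    simp only [smul_zero, sub_zero, dotProduct_zero, Complex.zero_re] at this
    have h2 := star_dotProduct_self_pos hw
    nlinarith
  have hsym : ∀ v, star ψ ⬝ᵥ (K *ᵥ v) = 0 := by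
    intro v
    have h : star ψ ᵥ* K = 0 := by
      rw [← hK.eq, ← Matrix.star_mulVec, hKψ, star_zero]
    rw [Matrix.dotProduct_mulVec, h, zero_dotProduct]
  have hge : ∀ μ ∈ energies K, μ ≠ 0 → γ ≤ μ := by
    intro μ hμ hne
    obtain ⟨v, hv, h⟩ := (mem_energies_iff K μ).1 hμ
    have horth : star ψ ⬝ᵥ v = 0 := by
      have h1 := hsym v
      rw [h, dotProduct_smul, smul_eq_mul] at h1
      rcases mul_eq_zero.1 h1 with h2 | h2
      · exact absurd (Complex.ofReal_eq_zero.1 h2) hne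
      · exact h2
    have h1 := hgap v horth
    rw [h, dotProduct_smul, smul_eq_mul, Complex.re_ofReal_mul] at h1
    exact le_of_mul_le_mul_right h1 (star_dotProduct_self_pos hv)
  have hfin : {μ ∈ energies K | μ ≠ 0}.Finite := (energies_finite K).subset fun _ h => h.1
  -- A nonzero vector orthogonal to ψ has positive energy, so K ≠ 0 and a second eigenvalue exists
  -- at all.
  have hne : {μ ∈ energies K | μ ≠ 0}.Nonempty := by
    obtain ⟨v, hv, hvo⟩ := hcard
    have hK0 : K ≠ 0 := by
      rintro rfl
      have := hgap v hvo
      have h2 := star_dotProduct_self_pos hv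
      simp only [Matrix.zero_mulVec, dotProduct_zero, Complex.zero_re] at this
      nlinarith
    obtain ⟨u, t, ht, hu, h⟩ := hK.exists_eigenvector_of_ne_zero hK0
    refine ⟨t, (mem_energies_iff K t).2 ⟨u, hu, ?_⟩, ht⟩
    rw [h]; ext i; simp
  obtain ⟨E₁, hE₁⟩ := hfin.exists_minimal hne |>.imp fun x hx => (show IsLeast _ x from
    ⟨hx.1, fun y hy => by
      rcases le_total x y with h | h
      · exact h
      · exact hx.2 hy h⟩)
  refine ⟨E₁ - 0, ⟨0, E₁, ⟨h0, fun μ hμ => hEpos μ hμ⟩, ?_, hE₁, rfl⟩, ?_⟩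
  · refine finrank_eq_one_iff'.2 ⟨⟨ψ, Module.End.mem_eigenspace_iff.2 (by simp [hKψ])⟩, ?_, ?_⟩
    · intro h; exact hψ (congrArg Subtype.val h)
    · rintro ⟨v, hv⟩
      obtain ⟨c, hc⟩ := hker v (by simpa using Module.End.mem_eigenspace_iff.1 hv)
      exact ⟨c, Subtype.ext hc⟩
  · rw [sub_zero]; exact hge _ hE₁.1.1 hE₁.1.2

/-! ### Graphs with commuting moves: damping does not lower the energy -/

section MonotoneComparison

variable {X L : Type*} [Fintype X] [Fintype L]

open Classical in
/-- The Laplacian of the labelled directed graph `E` plus the potential `V`. -/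
noncomputable def graphOp (E : L → X → X → Prop) (V : X → ℝ) : (X → ℝ) →ₗ[ℝ] (X → ℝ) where
  toFun f x := ∑ l, ((∑ y, if E l x y then f x - f y else 0)
    + ∑ y, if E l y x then f x - f y else 0) + V x * f x
  map_add' f g := by
    ext x
    simp only [Pi.add_apply]
    have h : ∀ l, ((∑ y, if E l x y then f x + g x - (f y + g y) else 0)
        + ∑ y, if E l y x then f x + g x - (f y + g y) else 0) =
        ((∑ y, if E l x y then f x - f y else 0) + ∑ y, if E l y x then f x - f y else 0) +
        ((∑ y, if E l x y then g x - g y else 0) + ∑ y, if E l y x then g x - g y else 0) := by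
      intro l
      simp only [← Finset.sum_add_distrib]
      refine Finset.sum_congr rfl fun y _ => ?_
      split_ifs <;> ring
    simp only [h, Finset.sum_add_distrib]
    ring
  map_smul' a f := by
    ext x
    simp only [Pi.smul_apply, smul_eq_mul, RingHom.id_apply, mul_add, Finset.mul_sum]
    congr 1
    · refine Finset.sum_congr rfl fun l _ => ?_
      congr 1 <;>
      · refine Finset.sum_congr rfl fun y _ => ?_
        split_ifs <;> ring
    · ring

theorem sum_ite_of_unique {R : X → Prop} [DecidablePred R] (hR : ∀ y y', R y → R y' → y = y') (F : X → ℝ)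
    {y : X} (hy : R y) : (∑ z, if R z then F z else 0) = F y := by
  rw [Finset.sum_eq_single y, if_pos hy]
  · intro z _ hz
    rw [if_neg fun h => hz (hR _ _ h hy)]
  · simp

theorem sum_ite_of_none {R : X → Prop} [DecidablePred R] (hR : ∀ y, ¬ R y) (F : X → ℝ) :
    (∑ z, if R z then F z else 0) = 0 :=
  Finset.sum_eq_zero fun z _ => if_neg (hR z)

open Classical in
theorem dotProduct_graphOp (E : L → X → X → Prop) (V : X → ℝ) (f g : X → ℝ) :
    f ⬝ᵥ graphOp E V g = (∑ l, ∑ x, ∑ y, if E l x y then (f y - f x) * (g y - g x) else 0)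
      + ∑ x, V x * (f x * g x) := by
  have h1 : ∀ x, f x * graphOp E V g x = (∑ l, ((∑ y, if E l x y then f x * (g x - g y) else 0)
      + ∑ y, if E l y x then f x * (g x - g y) else 0)) + V x * (f x * g x) := by
    intro x
    change f x * (_ + V x * g x) = _
    rw [mul_add, Finset.mul_sum]
    congr 1
    · refine Finset.sum_congr rfl fun l _ => ?_
      rw [mul_add, Finset.mul_sum, Finset.mul_sum]
      congr 1 <;>
      · refine Finset.sum_congr rfl fun y _ => ?_
        split_ifs <;> ring
    · ring
  change ∑ x, f x * graphOp E V g x = _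
  simp only [h1, Finset.sum_add_distrib]
  congr 1
  rw [Finset.sum_comm, Finset.sum_comm (s := Finset.univ (α := X)) (t := Finset.univ (α := L)),
    ← Finset.sum_add_distrib]
  refine Finset.sum_congr rfl fun l _ => ?_
  rw [Finset.sum_comm (f := fun x y => if E l y x then f x * (g x - g y) else 0),
    ← Finset.sum_add_distrib]
  refine Finset.sum_congr rfl fun x _ => ?_
  rw [← Finset.sum_add_distrib]
  refine Finset.sum_congr rfl fun y _ => ?_
  split_ifs <;> ring

theorem dotProduct_graphOp_comm (E : L → X → X → Prop) (V : X → ℝ) (f g : X → ℝ) :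
    f ⬝ᵥ graphOp E V g = graphOp E V f ⬝ᵥ g := by
  classical
  rw [dotProduct_comm (graphOp E V f), dotProduct_graphOp, dotProduct_graphOp]
  congr 1
  · refine Finset.sum_congr rfl fun l _ => Finset.sum_congr rfl fun x _ =>
      Finset.sum_congr rfl fun y _ => ?_
    split_ifs <;> ring
  · exact Finset.sum_congr rfl fun x _ => by ring

/-- A symmetric operator whose form lies between `0` and `ρ` has norm at most `ρ`. -/
theorem dotProduct_apply_self_le (T : (X → ℝ) →ₗ[ℝ] (X → ℝ)) (ρ : ℝ) (hρ : 0 < ρ)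
    (hsym : ∀ f g, f ⬝ᵥ T g = T f ⬝ᵥ g) (h0 : ∀ f, 0 ≤ f ⬝ᵥ T f)
    (h1 : ∀ f, f ⬝ᵥ T f ≤ ρ * (f ⬝ᵥ f)) (f : X → ℝ) :
    T f ⬝ᵥ T f ≤ ρ ^ 2 * (f ⬝ᵥ f) := by
  have h := h0 (ρ • f - T f)
  have h2 := h1 (T f)
  have h3 := h1 f
  have h4 : (ρ • f - T f) ⬝ᵥ T (ρ • f - T f)
      = ρ ^ 2 * (f ⬝ᵥ T f) - 2 * ρ * (T f ⬝ᵥ T f) + T f ⬝ᵥ T (T f) := by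
    simp only [map_sub, map_smul, sub_dotProduct, dotProduct_sub, smul_dotProduct,
      dotProduct_smul, smul_eq_mul, hsym f (T f)]
    ring
  rw [h4] at h
  have h5 : ρ * (T f ⬝ᵥ T f) ≤ ρ * (ρ ^ 2 * (f ⬝ᵥ f)) := by nlinarith [mul_le_mul_of_nonneg_left h3 (sq_nonneg ρ)]
  exact le_of_mul_le_mul_left h5 hρ

/-- Data for a graph whose moves commute, as for the order ideals of a finite poset. -/
structure CommutingMoves (E : L → X → X → Prop) : Prop where
  target : ∀ {l x y y'}, E l x y → E l x y' → y = y'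
  source : ∀ {l x x' y}, E l x y → E l x' y → x = x'
  up : ∀ {l k x y x'}, E l x y → E k x x' → l ≠ k → ∃ y', E k y y' ∧ E l x' y'
  down : ∀ {l k x y y'}, E l x y → E k y' y → l ≠ k → ∃ x', E k x' x ∧ E l x' y'

/-- Monotone functions along a labelled graph. -/
def IncreasingAlong (E : L → X → X → Prop) (f : X → ℝ) : Prop :=
  ∀ l x y, E l x y → f x ≤ f y

variable {E : L → X → X → Prop} {V : X → ℝ}

-- The commuting squares give the bound. If x has a k-successor x', then y has one y' with an l-edge
-- from x' to y', so f x' ≤ f y' bounds the change of the outgoing terms by f y - f x; if x has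
-- none, the outgoing term at y is nonpositive. Predecessors are dual, which gives the factor 2.
open Classical in
theorem CommutingMoves.label_diff (hE : CommutingMoves E) {f : X → ℝ}
    (hf : IncreasingAlong E f) {l : L} {x y : X} (hxy : E l x y) (k : L) :
    ((∑ z, if E k y z then f y - f z else 0) + ∑ z, if E k z y then f y - f z else 0)
      - ((∑ z, if E k x z then f x - f z else 0) + ∑ z, if E k z x then f x - f z else 0)
      ≤ 2 * (f y - f x) := by
  have hxy' := hf _ _ _ hxy
  have hnonpos : ∀ u, (∑ z, if E k u z then f u - f z else 0) ≤ 0 := fun u =>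
    Finset.sum_nonpos fun z _ => by
      split_ifs with h
      · linarith [hf _ _ _ h]
      · rfl
  have hnonneg : ∀ u, 0 ≤ ∑ z, if E k z u then f u - f z else 0 := fun u =>
    Finset.sum_nonneg fun z _ => by
      split_ifs with h
      · linarith [hf _ _ _ h]
      · rfl
  have hup : (∑ z, if E k y z then f y - f z else 0) - (∑ z, if E k x z then f x - f z else 0)
      ≤ f y - f x := by
    by_cases h : ∃ x', E k x x'
    · obtain ⟨x', hx'⟩ := h
      rw [sum_ite_of_unique (fun _ _ h h' => hE.target h h') _ hx']
      by_cases hlk : l = k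
      · subst hlk
        rw [hE.target hx' hxy]
        linarith [hnonpos y]
      · obtain ⟨y', hy', hxy2⟩ := hE.up hxy hx' hlk
        rw [sum_ite_of_unique (fun _ _ h h' => hE.target h h') _ hy']
        linarith [hf _ _ _ hxy2]
    · rw [sum_ite_of_none (fun z hz => h ⟨z, hz⟩) (fun z => f x - f z)]
      linarith [hnonpos y]
  have hdown : (∑ z, if E k z y then f y - f z else 0) - (∑ z, if E k z x then f x - f z else 0)
      ≤ f y - f x := by
    by_cases h : ∃ y', E k y' y
    · obtain ⟨y', hy'⟩ := h
      rw [sum_ite_of_unique (fun _ _ h h' => hE.source h h') _ hy']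
      by_cases hlk : l = k
      · subst hlk
        rw [hE.source hy' hxy]
        linarith [hnonneg x]
      · obtain ⟨x', hx', hxy2⟩ := hE.down hxy hy' hlk
        rw [sum_ite_of_unique (fun _ _ h h' => hE.source h h') _ hx']
        linarith [hf _ _ _ hxy2]
    · rw [sum_ite_of_none (fun z hz => h ⟨z, hz⟩) (fun z => f y - f z)]
      linarith [hnonneg x]
  linarith

/-- Shifting the graph operator by a large constant gives an operator preserving the cone of
nonnegative increasing functions. -/
theorem CommutingMoves.shift_preserves (hE : CommutingMoves E)
    (hV1 : ∀ x, V x ≤ 1) (hV : ∀ l x y, E l x y → V y ≤ V x) {c : ℝ}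
    (hc : 4 * (Fintype.card L : ℝ) + 4 ≤ c) {f : X → ℝ} (hf0 : ∀ x, 0 ≤ f x)
    (hf : IncreasingAlong E f) :
    (∀ x, 0 ≤ c * f x - graphOp E V f x) ∧
      IncreasingAlong E fun x => c * f x - graphOp E V f x := by
  classical
  have hcard : (0 : ℝ) ≤ Fintype.card L := Nat.cast_nonneg _
  constructor
  · intro x
    have h1 : ∀ l, ((∑ y, if E l x y then f x - f y else 0)
        + ∑ y, if E l y x then f x - f y else 0) ≤ f x := by
      intro l
      have hn : (∑ y, if E l x y then f x - f y else 0) ≤ 0 :=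
        Finset.sum_nonpos fun z _ => by
          split_ifs with h
          · linarith [hf _ _ _ h]
          · rfl
      by_cases h : ∃ y, E l y x
      · obtain ⟨y, hy⟩ := h
        rw [sum_ite_of_unique (fun _ _ h h' => hE.source h h') _ hy]
        linarith [hf0 y]
      · rw [sum_ite_of_none (fun z hz => h ⟨z, hz⟩) (fun z => f x - f z)]
        linarith [hf0 x]
    have h2 : graphOp E V f x ≤ Fintype.card L * f x + V x * f x := by
      change _ + V x * f x ≤ _
      refine add_le_add ((Finset.sum_le_sum fun l _ => h1 l).trans ?_) le_rfl
      simp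
    have h3 := mul_le_mul_of_nonneg_right (hV1 x) (hf0 x)
    have h4 := mul_le_mul_of_nonneg_right hc (hf0 x)
    nlinarith [mul_nonneg hcard (hf0 x), hf0 x]
  · intro l x y hxy
    have hd := hf _ _ _ hxy
    have h1 : graphOp E V f y - graphOp E V f x ≤ Fintype.card L * (2 * (f y - f x))
        + (V y * f y - V x * f x) := by
      change (_ + V y * f y) - (_ + V x * f x) ≤ _
      rw [add_sub_add_comm, ← Finset.sum_sub_distrib]
      refine add_le_add ((Finset.sum_le_sum fun k _ => hE.label_diff hf hxy k).trans ?_) le_rfl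
      simp
    have h2 : V y * f y - V x * f x ≤ f y - f x := by
      have := mul_le_mul_of_nonneg_right (hV l x y hxy) (hf0 x)
      have := mul_le_mul_of_nonneg_right (hV1 y) (sub_nonneg.2 hd)
      nlinarith
    have h4 := mul_le_mul_of_nonneg_right hc (sub_nonneg.2 hd)
    change c * f x - graphOp E V f x ≤ c * f y - graphOp E V f y
    nlinarith [mul_nonneg hcard (sub_nonneg.2 hd)]

/-- Each label contributes at most one incoming and one outgoing edge per vertex, so (u - v)² ≤ 2u²
+ 2v² costs at most four times the squared norm per label. -/
theorem CommutingMoves.form_le (hE : CommutingMoves E) (hV1 : ∀ x, V x ≤ 1) (f : X → ℝ) :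
    f ⬝ᵥ graphOp E V f ≤ (4 * (Fintype.card L : ℝ) + 4) * (f ⬝ᵥ f) := by
  classical
  have hff : f ⬝ᵥ f = ∑ x, f x ^ 2 := by simp only [dotProduct, pow_two]
  rw [dotProduct_graphOp, hff]
  have h0 : 0 ≤ ∑ x, f x ^ 2 := Finset.sum_nonneg fun x _ => sq_nonneg _
  have h1 : ∀ l, (∑ x, ∑ y, if E l x y then (f y - f x) * (f y - f x) else 0)
      ≤ 4 * ∑ x, f x ^ 2 := by
    intro l
    have ha : (∑ x, ∑ y, if E l x y then (f x) ^ 2 else 0) ≤ ∑ x, f x ^ 2 := by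
      refine Finset.sum_le_sum fun x _ => ?_
      by_cases h : ∃ y, E l x y
      · obtain ⟨y, hy⟩ := h
        rw [sum_ite_of_unique (fun _ _ h h' => hE.target h h') _ hy]
      · rw [sum_ite_of_none (fun z hz => h ⟨z, hz⟩) (fun z => f x ^ 2)]
        positivity
    have hb : (∑ x, ∑ y, if E l x y then (f y) ^ 2 else 0) ≤ ∑ x, f x ^ 2 := by
      rw [Finset.sum_comm]
      refine Finset.sum_le_sum fun y _ => ?_
      by_cases h : ∃ x, E l x y
      · obtain ⟨x, hx⟩ := h
        rw [sum_ite_of_unique (fun _ _ h h' => hE.source h h') (fun _ => f y ^ 2) hx]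
      · rw [sum_ite_of_none (fun z hz => h ⟨z, hz⟩) (fun z => f y ^ 2)]
        positivity
    have hc : (∑ x, ∑ y, if E l x y then (f y - f x) * (f y - f x) else 0)
        ≤ (∑ x, ∑ y, if E l x y then 2 * (f x) ^ 2 else 0)
          + ∑ x, ∑ y, if E l x y then 2 * (f y) ^ 2 else 0 := by
      simp only [← Finset.sum_add_distrib]
      refine Finset.sum_le_sum fun x _ => Finset.sum_le_sum fun y _ => ?_
      split_ifs
      · nlinarith [sq_nonneg (f y + f x)]
      · simp
    have hd : ∀ g : X → X → ℝ, (∑ x, ∑ y, if E l x y then 2 * g x y else 0)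
        = 2 * ∑ x, ∑ y, if E l x y then g x y else 0 := by
      intro g
      simp only [Finset.mul_sum, mul_ite, mul_zero]
    rw [hd fun x y => f x ^ 2, hd fun x y => f y ^ 2] at hc
    linarith
  have h2 : (∑ x, V x * (f x * f x)) ≤ ∑ x, f x ^ 2 := by
    refine Finset.sum_le_sum fun x _ => ?_
    nlinarith [mul_le_mul_of_nonneg_right (hV1 x) (mul_self_nonneg (f x))]
  have h3 := Finset.sum_le_sum fun l (_ : l ∈ Finset.univ) => h1 l
  simp only [Finset.sum_const, Finset.card_univ, nsmul_eq_mul] at h3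
  linarith

/-- The graph operator has a positive increasing supersolution at any level below the bottom of
its spectrum. -/
theorem CommutingMoves.exists_supersolution (hE : CommutingMoves E)
    (hV1 : ∀ x, V x ≤ 1) (hV : ∀ l x y, E l x y → V y ≤ V x) {μ μ' : ℝ}
    (hμ : ∀ f : X → ℝ, μ * (f ⬝ᵥ f) ≤ f ⬝ᵥ graphOp E V f) (hμ' : μ' < μ) (hne : Nonempty X) :
    ∃ φ : X → ℝ, (∀ x, 0 < φ x) ∧ IncreasingAlong E φ ∧ ∀ x, μ' * φ x ≤ graphOp E V φ x := by
  set c : ℝ := 4 * (Fintype.card L : ℝ) + 4 with hc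
  set T : (X → ℝ) →ₗ[ℝ] (X → ℝ) := c • LinearMap.id - graphOp E V with hT
  have hTf : ∀ f, T f = c • f - graphOp E V f := fun f => rfl
  have h0 : ∀ f, 0 ≤ f ⬝ᵥ T f := by
    intro f
    rw [hTf, dotProduct_sub, dotProduct_smul, smul_eq_mul]
    linarith [hE.form_le hV1 f]
  have hsym : ∀ f g, f ⬝ᵥ T g = T f ⬝ᵥ g := by
    intro f g
    rw [hTf, hTf, dotProduct_sub, sub_dotProduct, dotProduct_smul, smul_dotProduct,
      dotProduct_graphOp_comm]
  -- The form of T is at most c - μ, which may vanish. The midpoint of μ and μ' gives a bound that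
  -- is strictly positive and still strictly below r.
  set ρ := c - (μ + μ') / 2 with hρ
  set r := c - μ' with hr
  have hself : ∀ f : X → ℝ, 0 ≤ f ⬝ᵥ f := fun f => Finset.sum_nonneg fun x _ => mul_self_nonneg _
  have h1 : ∀ f, f ⬝ᵥ T f ≤ ρ * (f ⬝ᵥ f) := by
    intro f
    rw [hTf, dotProduct_sub, dotProduct_smul, smul_eq_mul]
    nlinarith [hμ f, hself f, mul_nonneg (sub_nonneg.2 hμ'.le) (hself f)]
  have hone : (0 : ℝ) < (1 : X → ℝ) ⬝ᵥ 1 := by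
    simp [Fintype.card_pos]
  have hcμ : μ ≤ c := by
    have h2 := hμ 1
    have h3 := hE.form_le hV1 (1 : X → ℝ)
    exact le_of_mul_le_mul_right (h2.trans h3) hone
  have hρ0 : 0 < ρ := by rw [hρ]; linarith
  have hρr : ρ < r := by rw [hρ, hr]; linarith
  have hr0 : 0 < r := hρ0.trans hρr
  -- Power iteration from the constant 1 stays in the cone of nonnegative increasing functions, and
  -- it grows at most like ρ^j.
  set u : ℕ → X → ℝ := fun j => (T ^ j) 1 with hu
  have hsucc : ∀ j, u (j + 1) = T (u j) := fun j => by
    simp only [hu, pow_succ', Module.End.mul_apply]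
  have hpres : ∀ j, (∀ x, 0 ≤ u j x) ∧ IncreasingAlong E (u j) := by
    intro j
    induction j with
    | zero =>
      refine ⟨fun x => ?_, fun l x y _ => ?_⟩ <;> simp [hu]
    | succ j ih =>
      rw [hsucc]
      exact hE.shift_preserves hV1 hV hc.ge ih.1 ih.2
  have hnorm : ∀ j, u j ⬝ᵥ u j ≤ (ρ ^ j) ^ 2 * ((1 : X → ℝ) ⬝ᵥ 1) := by
    intro j
    induction j with
    | zero => simp [hu]
    | succ j ih =>
      rw [hsucc]
      refine (dotProduct_apply_self_le T ρ hρ0 hsym h0 h1 (u j)).trans ?_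
      calc _ ≤ ρ ^ 2 * ((ρ ^ j) ^ 2 * ((1 : X → ℝ) ⬝ᵥ 1)) :=
            mul_le_mul_of_nonneg_left ih (sq_nonneg _)
        _ = _ := by ring
  obtain ⟨k, hk⟩ : ∃ k : ℕ, ((ρ / r) ^ 2) ^ k * ((1 : X → ℝ) ⬝ᵥ 1) < 1 := by
    have hq0 : 0 ≤ (ρ / r) ^ 2 := sq_nonneg _
    have hq1 : (ρ / r) ^ 2 < 1 := by
      have : ρ / r < 1 := (div_lt_one hr0).2 hρr
      have h' : 0 ≤ ρ / r := by positivity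
      nlinarith
    obtain ⟨k, hk⟩ := exists_pow_lt_of_lt_one (show 0 < 1 / ((1 : X → ℝ) ⬝ᵥ 1) by positivity) hq1
    exact ⟨k, (lt_div_iff₀ hone).1 hk⟩
  obtain ⟨m, rfl⟩ : ∃ m, k = m + 1 := by
    refine Nat.exists_eq_succ_of_ne_zero ?_
    rintro rfl
    have : (1 : ℝ) ≤ (1 : X → ℝ) ⬝ᵥ 1 := by
      simp only [dotProduct_one, Pi.one_apply, Finset.sum_const, nsmul_eq_mul, mul_one]
      exact_mod_cast Finset.card_pos.2 Finset.univ_nonempty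
    linarith
  have hbound : ∀ x, u (m + 1) x ≤ r ^ (m + 1) := by
    set k := m + 1
    intro x
    have h2 : u k x ^ 2 ≤ u k ⬝ᵥ u k := by
      rw [pow_two]
      exact Finset.single_le_sum (f := fun x => u k x * u k x)
        (fun y _ => mul_self_nonneg _) (Finset.mem_univ x)
    have h3 : u k x ^ 2 ≤ (r ^ k) ^ 2 := by
      refine (h2.trans (hnorm k)).trans ?_
      have h4 : ((ρ / r) ^ 2) ^ k = (ρ ^ k) ^ 2 / (r ^ k) ^ 2 := by
        rw [← pow_mul, mul_comm 2 k, pow_mul, div_pow, div_pow]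
      rw [h4, div_mul_eq_mul_div, div_lt_one (by positivity)] at hk
      exact hk.le
    exact (abs_le_of_sq_le_sq' h3 (by positivity)).2
  -- A truncated Neumann series for r (r - T)⁻¹ 1. It is cut where Tᵐ⁺¹ 1 has fallen below rᵐ⁺¹
  -- pointwise, which is possible because ρ < r.
  set φ : X → ℝ := ∑ j ∈ Finset.range (m + 1), (r ^ j)⁻¹ • u j with hφ
  have hφx : ∀ x, φ x = ∑ j ∈ Finset.range (m + 1), (r ^ j)⁻¹ * u j x := fun x => by
    rw [hφ, Finset.sum_apply]; rfl
  have hφ1 : ∀ x, 1 ≤ φ x := by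
    intro x
    rw [hφx, Finset.sum_range_succ']
    have h2 : (r ^ 0)⁻¹ * u 0 x = 1 := by simp [hu]
    rw [h2]
    have : 0 ≤ ∑ j ∈ Finset.range m, (r ^ (j + 1))⁻¹ * u (j + 1) x :=
      Finset.sum_nonneg fun j _ => mul_nonneg (by positivity) ((hpres _).1 x)
    linarith
  refine ⟨φ, fun x => one_pos.trans_le (hφ1 x), ?_, ?_⟩
  · intro l x y hxy
    rw [hφx, hφx]
    exact Finset.sum_le_sum fun j _ =>
      mul_le_mul_of_nonneg_left ((hpres j).2 l x y hxy) (by positivity)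
  · intro x
    -- Applying T shifts the series. Compared with r φ it loses the zeroth term, which gave r, and
    -- gains the last term, which is at most r by `hbound`.
    have hTφ : T φ x ≤ r * φ x := by
      have h2 : T φ x = ∑ j ∈ Finset.range (m + 1), (r ^ j)⁻¹ * u (j + 1) x := by
        rw [hφ, map_sum, Finset.sum_apply]
        refine Finset.sum_congr rfl fun j _ => ?_
        rw [map_smul, ← hsucc]; rfl
      rw [h2, hφx, Finset.mul_sum, Finset.sum_range_succ, Finset.sum_range_succ' _ m]
      have h3 : ∀ j, r * ((r ^ (j + 1))⁻¹ * u (j + 1) x) = (r ^ j)⁻¹ * u (j + 1) x := by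
        intro j
        rw [pow_succ]
        field_simp
      simp only [h3]
      have h4 : r * ((r ^ 0)⁻¹ * u 0 x) = r := by simp [hu]
      rw [h4]
      have h5 : (r ^ m)⁻¹ * u (m + 1) x ≤ r := by
        rw [inv_mul_le_iff₀ (by positivity), ← pow_succ]
        exact hbound x
      linarith
    have h6 : T φ x = c * φ x - graphOp E V φ x := rfl
    rw [h6, hr] at hTφ
    linarith

open Classical in
/-- The energy of the graph operator can only increase when the moves are damped. -/
theorem CommutingMoves.damped_form_ge (hE : CommutingMoves E)
    (hV1 : ∀ x, V x ≤ 1) (hV : ∀ l x y, E l x y → V y ≤ V x) {μ : ℝ}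
    (hμ : ∀ f : X → ℝ, μ * (∑ x, f x ^ 2) ≤
      (∑ l, ∑ x, ∑ y, if E l x y then (f y - f x) ^ 2 else 0) + ∑ x, V x * f x ^ 2)
    (a : L → ℝ) (ha0 : ∀ l, 0 ≤ a l) (ha1 : ∀ l, a l ≤ 1) (f : X → ℝ) :
    μ * (∑ x, f x ^ 2) ≤
      (∑ l, ∑ x, ∑ y, if E l x y then (f y - a l * f x) ^ 2 else 0) + ∑ x, V x * f x ^ 2 := by
  rcases isEmpty_or_nonempty X with hX | hX
  · simp
  have hform : ∀ f : X → ℝ, μ * (f ⬝ᵥ f) ≤ f ⬝ᵥ graphOp E V f := by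
    intro f
    rw [dotProduct_graphOp]
    simpa only [dotProduct, pow_two] using hμ f
  have hS : 0 ≤ ∑ x, f x ^ 2 := Finset.sum_nonneg fun x _ => sq_nonneg _
  have key : ∀ μ' < μ, μ' * (∑ x, f x ^ 2) ≤
      (∑ l, ∑ x, ∑ y, if E l x y then (f y - a l * f x) ^ 2 else 0) + ∑ x, V x * f x ^ 2 := by
    intro μ' hμ'
    obtain ⟨φ, hφ0, hφ, hsup⟩ := hE.exists_supersolution hV1 hV hform hμ' hX
    -- Ground-state substitution: pairing the supersolution inequality with f² / φ reproduces μ' f²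
    -- on the left.
    set g : X → ℝ := fun x => f x ^ 2 / φ x with hg
    have h1 : μ' * (∑ x, f x ^ 2) ≤ g ⬝ᵥ graphOp E V φ := by
      rw [Finset.mul_sum]
      refine Finset.sum_le_sum fun x _ => ?_
      have h2 := mul_le_mul_of_nonneg_left (hsup x) (show 0 ≤ g x from
        div_nonneg (sq_nonneg _) (hφ0 x).le)
      refine le_trans (le_of_eq ?_) h2
      have := (hφ0 x).ne'
      simp only [hg]
      field_simp
    refine h1.trans ?_
    rw [dotProduct_graphOp]
    refine add_le_add (Finset.sum_le_sum fun l _ => Finset.sum_le_sum fun x _ =>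
      Finset.sum_le_sum fun y _ => ?_) (le_of_eq (Finset.sum_congr rfl fun x _ => ?_))
    · split_ifs with h
      · have hp := hφ0 x
        have hq := hφ0 y
        have hpq := hφ _ _ _ h
        -- Picone's identity with damping. The extra term is nonnegative because φ increases along
        -- moves and a ≤ 1; this is where monotonicity of φ is essential.
        have h3 : (f y - a l * f x) ^ 2 - (g y - g x) * (φ y - φ x) =
            ((f y * φ x - a l * f x * φ y) ^ 2
              + f x ^ 2 * φ y * (φ y - φ x) * (1 - a l ^ 2)) / (φ x * φ y) := by
          simp only [hg]
          field_simp
          ring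
        have h4 : 0 ≤ 1 - a l ^ 2 := by nlinarith [ha0 l, ha1 l]
        have h5 : 0 ≤ φ y - φ x := by linarith
        have h6 : 0 ≤ (f y - a l * f x) ^ 2 - (g y - g x) * (φ y - φ x) := by
          rw [h3]; positivity
        linarith
      · exact le_rfl
    · have := (hφ0 x).ne'
      simp only [hg]
      field_simp
  by_contra! hlt
  set R := (∑ l, ∑ x, ∑ y, if E l x y then (f y - a l * f x) ^ 2 else 0) + ∑ x, V x * f x ^ 2
  have hS' : 0 < ∑ x, f x ^ 2 := by
    refine lt_of_le_of_ne hS fun h0 => ?_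
    have h2 := key (μ - 1) (by linarith)
    rw [← h0] at h2 hlt
    simp only [mul_zero] at h2 hlt
    linarith
  -- If the claim failed, the Rayleigh quotient R / ‖f‖² would lie below μ. The midpoint between the
  -- two is an admissible μ' that contradicts it.
  have h2 := key ((μ + R / ∑ x, f x ^ 2) / 2) (by
    have : R / ∑ x, f x ^ 2 < μ := (div_lt_iff₀ hS').2 hlt
    linarith)
  have h3 : (μ + R / ∑ x, f x ^ 2) / 2 * ∑ x, f x ^ 2 = (μ * (∑ x, f x ^ 2) + R) / 2 := by
    field_simp
  linarith

end MonotoneComparison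

/-! ### Gates -/

/-- A gate of the circuit: a one-qubit gate (`A = B`) or a two-qubit gate. -/
def IsGate (n : ℕ) {M : ℕ} (A B : Fin M) (i : ℕ) : Prop :=
  (A = B ∧ IsOneQubitGate n A i) ∨ IsTwoQubitGate n A B i

theorem IsTwoQubitGate.even {n M : ℕ} {A B : Fin M} {i : ℕ} (h : IsTwoQubitGate n A B i) :
    Even i := by
  obtain ⟨_, j, _, rfl, _⟩ := h
  exact ⟨j + 1, by ring⟩

theorem IsTwoQubitGate.four_le {n M : ℕ} {A B : Fin M} {i : ℕ} (h : IsTwoQubitGate n A B i) :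
    4 ≤ i := by
  obtain ⟨_, j, hj, rfl, _⟩ := h
  have := (Finset.mem_Icc.1 hj).1
  omega

theorem IsTwoQubitGate.ne {n M : ℕ} {A B : Fin M} {i : ℕ} (h : IsTwoQubitGate n A B i) :
    A ≠ B := by
  rintro rfl
  have := h.1
  omega

theorem IsTwoQubitGate.le_depth {n M : ℕ} {A B : Fin M} {i : ℕ} (h : IsTwoQubitGate n A B i) :
    i ≤ depth M n := by
  obtain ⟨_, j, hj, rfl, _⟩ := h
  have := (Finset.mem_Icc.1 hj).2
  unfold depth
  omega

theorem firstStep_le_three {M : ℕ} (A : Fin M) : firstStep A ≤ 3 := by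
  unfold firstStep; split_ifs <;> omega

theorem firstStep_pos {M : ℕ} (A : Fin M) : 1 ≤ firstStep A := by
  unfold firstStep; split_ifs <;> omega

theorem firstStep_odd {M : ℕ} (A : Fin M) : Odd (firstStep A) := by
  unfold firstStep; split_ifs <;> decide

theorem lastStep_le_depth {M : ℕ} (n : ℕ) (A : Fin M) : lastStep n A ≤ depth M n := by
  unfold lastStep depth; split_ifs <;> omega

theorem firstStep_lt_lastStep {M : ℕ} (n : ℕ) (A : Fin M) : firstStep A ≤ lastStep n A := by
  have := firstStep_le_three A
  have := A.pos
  unfold lastStep; split_ifs <;> omega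

theorem isOneQubitGate_firstStep {M : ℕ} (n : ℕ) (A : Fin M) :
    IsOneQubitGate n A (firstStep A) := by
  refine ⟨le_rfl, firstStep_lt_lastStep n A, fun B => ⟨fun h => ?_, fun h => ?_⟩⟩ <;>
  · have := h.even
    exact (Nat.not_even_iff_odd.2 (firstStep_odd A)) this

theorem IsGate.firstStep_le {n M : ℕ} {A B D : Fin M} {i : ℕ} (h : IsGate n A B i)
    (hD : D = A ∨ D = B) : firstStep D ≤ i := by
  rcases h with ⟨rfl, h⟩ | h
  · rcases hD with rfl | rfl <;> exact h.1
  · have := h.four_le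
    have := firstStep_le_three D
    omega

theorem IsGate.le_depth {n M : ℕ} {A B : Fin M} {i : ℕ} (h : IsGate n A B i) :
    i ≤ depth M n := by
  rcases h with ⟨rfl, h⟩ | h
  · exact h.2.1.trans (lastStep_le_depth n A)
  · exact h.le_depth

/-- Every qubit takes part in at most one gate at each time step. -/
theorem IsGate.unique {n M : ℕ} {A B A' B' D : Fin M} {i : ℕ} (h : IsGate n A B i)
    (h' : IsGate n A' B' i) (hD : D = A ∨ D = B) (hD' : D = A' ∨ D = B') : A = A' ∧ B = B' := by
  rcases h with ⟨rfl, h⟩ | h <;> rcases h' with ⟨rfl, h'⟩ | h'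
  · rcases hD with rfl | rfl <;> rcases hD' with rfl | rfl <;> simp
  · rcases hD with rfl | rfl <;> rcases hD' with rfl | rfl
    · exact absurd h' (h.2.2 _).1
    · exact absurd h' (h.2.2 _).2
    · exact absurd h' (h.2.2 _).1
    · exact absurd h' (h.2.2 _).2
  · rcases hD with rfl | rfl <;> rcases hD' with rfl | rfl
    · exact absurd h (h'.2.2 _).1
    · exact absurd h (h'.2.2 _).1
    · exact absurd h (h'.2.2 _).2
    · exact absurd h (h'.2.2 _).2
  · obtain ⟨hB, j, _, rfl, hj⟩ := h
    obtain ⟨hB', j', _, hjj, hj'⟩ := h'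
    have hj2 : j = j' := by omega
    subst hj2
    rw [Nat.odd_iff] at hj hj'
    unfold label at hj hj'
    have : A.val = A'.val := by
      rcases hD with rfl | rfl <;> rcases hD' with hD' | hD' <;>
        [(rw [hD']); (have := congrArg Fin.val hD'; omega); (have := congrArg Fin.val hD'; omega);
          (have := congrArg Fin.val hD'; omega)]
    exact ⟨Fin.ext this, Fin.ext (by omega)⟩

/-! ### Positions and bits -/

/-- The time steps of all qubits. -/
abbrev Pos (M n : ℕ) : Type :=
  (A : Fin M) → Finset.Icc (firstStep A - 1) (lastStep n A)

/-- The bit values of all qubits. -/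
abbrev Bits (M : ℕ) : Type := Fin M → Fin 2

/-- The time steps of a configuration. -/
def pos {M n : ℕ} (c : Conf M n) : Pos M n := fun A => (c A).1

/-- The bit values of a configuration. -/
def bits {M n : ℕ} (c : Conf M n) : Bits M := fun A => (c A).2

/-- The configuration with given time steps and bit values. -/
def conf {M n : ℕ} (x : Pos M n) (b : Bits M) : Conf M n := fun A => (x A, b A)

@[simp] theorem pos_conf {M n : ℕ} (x : Pos M n) (b : Bits M) : pos (conf x b) = x := rfl
@[simp] theorem bits_conf {M n : ℕ} (x : Pos M n) (b : Bits M) : bits (conf x b) = b := rfl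
@[simp] theorem conf_pos_bits {M n : ℕ} (c : Conf M n) : conf (pos c) (bits c) = c := rfl

/-- Configurations are pairs of positions and bit strings. -/
def confEquiv (M n : ℕ) : Pos M n × Bits M ≃ Conf M n where
  toFun p := conf p.1 p.2
  invFun c := (pos c, bits c)
  left_inv _ := rfl
  right_inv _ := rfl

theorem sum_conf {M n : ℕ} {R : Type*} [AddCommMonoid R] (F : Conf M n → R) :
    ∑ c, F c = ∑ x, ∑ b, F (conf x b) := by
  rw [← (confEquiv M n).sum_comp, Fintype.sum_prod_type]
  rfl

/-- An operator on positions times an operator on bits. -/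
def tens {M n : ℕ} (P : Matrix (Pos M n) (Pos M n) ℂ) (T : Matrix (Bits M) (Bits M) ℂ) :
    Op M n :=
  Matrix.of fun c d => P (pos c) (pos d) * T (bits c) (bits d)

/-- The matrix moving the qubits `A` and `B` together from time step `k` to time step `i`. -/
def hop (n : ℕ) {M : ℕ} (A B : Fin M) (i k : ℕ) (x y : Pos M n) : Prop :=
  (∀ D, D ≠ A → D ≠ B → x D = y D) ∧
    (x A : ℕ) = i ∧ (x B : ℕ) = i ∧ (y A : ℕ) = k ∧ (y B : ℕ) = k

instance (n : ℕ) {M : ℕ} (A B : Fin M) (i k : ℕ) (x y : Pos M n) :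
    Decidable (hop n A B i k x y) := by unfold hop; infer_instance

theorem hop.symm {n M : ℕ} {A B : Fin M} {i k : ℕ} {x y : Pos M n} (h : hop n A B i k x y) :
    hop n A B k i y x :=
  ⟨fun D hA hB => (h.1 D hA hB).symm, h.2.2.2.1, h.2.2.2.2, h.2.1, h.2.2.1⟩

theorem hop.eq_of_same {n M : ℕ} {A B : Fin M} {i : ℕ} {x y : Pos M n}
    (h : hop n A B i i x y) : x = y := by
  funext D
  by_cases hA : D = A
  · subst hA; exact Subtype.ext (h.2.1.trans h.2.2.2.1.symm)
  by_cases hB : D = B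
  · subst hB; exact Subtype.ext (h.2.2.1.trans h.2.2.2.2.symm)
  exact h.1 D hA hB

/-- The matrix of `hop`. -/
def hopMatrix (n : ℕ) {M : ℕ} (R : Type*) [Zero R] [One R] (A B : Fin M) (i k : ℕ) :
    Matrix (Pos M n) (Pos M n) R :=
  Matrix.of fun x y => if hop n A B i k x y then 1 else 0

/-- A one-bit matrix acting on all bits. -/
def embed {M : ℕ} (A : Fin M) (X : Matrix (Fin 2) (Fin 2) ℂ) : Matrix (Bits M) (Bits M) ℂ :=
  Matrix.of fun b c => if ∀ D, D ≠ A → b D = c D then X (b A) (c A) else 0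

/-- A two-bit matrix acting on all bits. -/
def embed2 {M : ℕ} (A B : Fin M) (X : Matrix (Fin 2 × Fin 2) (Fin 2 × Fin 2) ℂ) :
    Matrix (Bits M) (Bits M) ℂ :=
  Matrix.of fun b c => if ∀ D, D ≠ A → D ≠ B → b D = c D then X (b A, b B) (c A, c B) else 0

theorem bilin_eq_tens {M n : ℕ} (A : Fin M) (i k : ℕ) (X : Matrix (Fin 2) (Fin 2) ℂ) :
    (bilin A i k X : Op M n) = tens (hopMatrix n ℂ A A i k) (embed A X) := by
  ext c d
  have hiff : ((∀ B, B ≠ A → c B = d B) ∧ ((c A).1 : ℕ) = i ∧ ((d A).1 : ℕ) = k) ↔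
      hop n A A i k (pos c) (pos d) ∧ ∀ D, D ≠ A → bits c D = bits d D := by
    constructor
    · rintro ⟨h, h1, h2⟩
      exact ⟨⟨fun D hD _ => congrArg Prod.fst (h D hD), h1, h1, h2, h2⟩,
        fun D hD => congrArg Prod.snd (h D hD)⟩
    · rintro ⟨⟨h, h1, -, h2, -⟩, h3⟩
      exact ⟨fun D hD => Prod.ext (h D hD hD) (h3 D hD), h1, h2⟩
  have hl : (bilin A i k X : Op M n) c d = if (hop n A A i k (pos c) (pos d) ∧
      ∀ D, D ≠ A → bits c D = bits d D) then X (bits c A) (bits d A) else 0 :=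
    if_congr hiff rfl rfl
  rw [hl]
  simp only [tens, hopMatrix, embed, Matrix.of_apply]
  rw [ite_zero_mul_ite_zero, one_mul]

theorem bilin2_eq_tens {M n : ℕ} (A B : Fin M) (i k : ℕ)
    (X : Matrix (Fin 2 × Fin 2) (Fin 2 × Fin 2) ℂ) :
    (bilin2 A B i i k k X : Op M n) = tens (hopMatrix n ℂ A B i k) (embed2 A B X) := by
  ext c d
  have hiff : ((∀ D, D ≠ A → D ≠ B → c D = d D) ∧ ((c A).1 : ℕ) = i ∧ ((c B).1 : ℕ) = i ∧
      ((d A).1 : ℕ) = k ∧ ((d B).1 : ℕ) = k) ↔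
      hop n A B i k (pos c) (pos d) ∧ ∀ D, D ≠ A → D ≠ B → bits c D = bits d D := by
    constructor
    · rintro ⟨h, h1⟩
      exact ⟨⟨fun D hA hB => congrArg Prod.fst (h D hA hB), h1⟩,
        fun D hA hB => congrArg Prod.snd (h D hA hB)⟩
    · rintro ⟨⟨h, h1⟩, h3⟩
      exact ⟨fun D hA hB => Prod.ext (h D hA hB) (h3 D hA hB), h1⟩
  have hl : (bilin2 A B i i k k X : Op M n) c d = if (hop n A B i k (pos c) (pos d) ∧
      ∀ D, D ≠ A → D ≠ B → bits c D = bits d D)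
      then X (bits c A, bits c B) (bits d A, bits d B) else 0 :=
    if_congr hiff rfl rfl
  rw [hl]
  simp only [tens, hopMatrix, embed2, Matrix.of_apply]
  rw [ite_zero_mul_ite_zero, one_mul]

/-- A matrix on the bits acting only on the bits in `S`. -/
structure LocalOn {M : ℕ} (S : Finset (Fin M)) (T : Matrix (Bits M) (Bits M) ℂ) : Prop where
  off : ∀ b c, (∃ D, D ∉ S ∧ b D ≠ c D) → T b c = 0
  dep : ∀ b c b' c', (∀ D ∈ S, b D = b' D ∧ c D = c' D) → (∀ D, D ∉ S → b D = c D) →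
    (∀ D, D ∉ S → b' D = c' D) → T b c = T b' c'

theorem localOn_embed {M : ℕ} (A : Fin M) (X : Matrix (Fin 2) (Fin 2) ℂ) :
    LocalOn {A} (embed A X) where
  off b c := by
    rintro ⟨D, hD, h⟩
    simp only [embed, Matrix.of_apply]
    exact if_neg fun h' => h (h' D (by simpa using hD))
  dep b c b' c' h h1 h2 := by
    simp only [embed, Matrix.of_apply]
    rw [if_pos fun D hD => h1 D (by simpa using hD), if_pos fun D hD => h2 D (by simpa using hD),
      (h A (by simp)).1, (h A (by simp)).2]

theorem localOn_embed2 {M : ℕ} (A B : Fin M) (X : Matrix (Fin 2 × Fin 2) (Fin 2 × Fin 2) ℂ) :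
    LocalOn {A, B} (embed2 A B X) where
  off b c := by
    rintro ⟨D, hD, h⟩
    simp only [Finset.mem_insert, Finset.mem_singleton, not_or] at hD
    simp only [embed2, Matrix.of_apply]
    exact if_neg fun h' => h (h' D hD.1 hD.2)
  dep b c b' c' h h1 h2 := by
    simp only [embed2, Matrix.of_apply]
    rw [if_pos fun D hA hB => h1 D (by simp [hA, hB]),
      if_pos fun D hA hB => h2 D (by simp [hA, hB]),
      (h A (by simp)).1, (h A (by simp)).2, (h B (by simp)).1, (h B (by simp)).2]

-- Only one intermediate bit string contributes: T leaves the bits outside S unchanged and T' leaves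
-- those outside S' unchanged, so it must agree with c on S and with b elsewhere.
open Classical in
theorem LocalOn.mul_apply {M : ℕ} {S S' : Finset (Fin M)} {T T' : Matrix (Bits M) (Bits M) ℂ}
    (h : LocalOn S T) (h' : LocalOn S' T') (hS : Disjoint S S') (b c : Bits M) :
    (T * T') b c = T b (fun D => if D ∈ S then c D else b D) *
      T' (fun D => if D ∈ S then c D else b D) c := by
  rw [Matrix.mul_apply]
  refine Finset.sum_eq_single _ (fun d _ hd => ?_) (by simp)
  by_contra hne
  have h1 : ∀ D, D ∉ S → b D = d D := by
    by_contra! h1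
    obtain ⟨D, hD⟩ := h1
    exact hne (by rw [h.off b d ⟨D, hD⟩, zero_mul])
  have h2 : ∀ D, D ∉ S' → d D = c D := by
    by_contra! h1
    obtain ⟨D, hD⟩ := h1
    exact hne (by rw [h'.off d c ⟨D, hD⟩, mul_zero])
  apply hd
  funext D
  split_ifs with hD
  · exact h2 D (Finset.disjoint_left.1 hS hD)
  · exact (h1 D hD).symm

theorem LocalOn.commute {M : ℕ} {S S' : Finset (Fin M)} {T T' : Matrix (Bits M) (Bits M) ℂ}
    (h : LocalOn S T) (h' : LocalOn S' T') (hS : Disjoint S S') : T * T' = T' * T := by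
  classical
  ext b c
  rw [h.mul_apply h' hS, h'.mul_apply h hS.symm]
  by_cases hbc : ∀ D, D ∉ S → D ∉ S' → b D = c D
  · rw [mul_comm (T' b _)]
    congr 1
    · refine h.dep _ _ _ _ (fun D hD => ?_) (fun D hD => ?_) (fun D hD => ?_)
      · simp [hD, Finset.disjoint_left.1 hS hD]
      · simp [hD]
      · by_cases hD' : D ∈ S'
        · simp [hD']
        · simp [hD', hbc D hD hD']
    · refine h'.dep _ _ _ _ (fun D hD => ?_) (fun D hD => ?_) (fun D hD => ?_)
      · simp [hD, Finset.disjoint_right.1 hS hD]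
      · by_cases hD' : D ∈ S
        · simp [hD']
        · simp [hD', hbc D hD' hD]
      · simp [hD]
  · push Not at hbc
    obtain ⟨D, hD, hD', hne⟩ := hbc
    rw [h'.off _ c ⟨D, hD', by simpa [hD] using hne⟩, h.off _ c ⟨D, hD, by simpa [hD'] using hne⟩]
    simp

theorem embed_one {M : ℕ} (A : Fin M) : embed A 1 = 1 := by
  ext b c
  simp only [embed, Matrix.of_apply, Matrix.one_apply]
  by_cases h : b = c
  · simp [h]
  · rw [if_neg h]
    refine ite_eq_right_iff.2 fun h1 => if_neg fun h2 => h (funext fun D => ?_)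
    by_cases hD : D = A
    · rw [hD, h2]
    · exact h1 D hD

theorem embed2_one {M : ℕ} (A B : Fin M) : embed2 A B 1 = 1 := by
  ext b c
  simp only [embed2, Matrix.of_apply, Matrix.one_apply]
  by_cases h : b = c
  · simp [h]
  · rw [if_neg h]
    refine ite_eq_right_iff.2 fun h1 => if_neg fun h2 => h (funext fun D => ?_)
    rw [Prod.mk.injEq] at h2
    by_cases hD : D = A
    · rw [hD, h2.1]
    by_cases hD' : D = B
    · rw [hD', h2.2]
    · exact h1 D hD hD'

theorem embed_smul {M : ℕ} (A : Fin M) (z : ℂ) (X : Matrix (Fin 2) (Fin 2) ℂ) :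
    embed A (z • X) = z • embed A X := by
  ext b c
  simp only [embed, Matrix.of_apply, Matrix.smul_apply, smul_eq_mul]
  split_ifs <;> simp

theorem embed_conjTranspose {M : ℕ} (A : Fin M) (X : Matrix (Fin 2) (Fin 2) ℂ) :
    embed A Xᴴ = (embed A X)ᴴ := by
  ext b c
  simp only [embed, Matrix.of_apply, Matrix.conjTranspose_apply, eq_comm (a := b _)]
  split_ifs <;> simp

theorem embed2_conjTranspose {M : ℕ} (A B : Fin M)
    (X : Matrix (Fin 2 × Fin 2) (Fin 2 × Fin 2) ℂ) :
    embed2 A B Xᴴ = (embed2 A B X)ᴴ := by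
  ext b c
  simp only [embed2, Matrix.of_apply, Matrix.conjTranspose_apply, eq_comm (a := b _)]
  split_ifs <;> simp

theorem embed_mul {M : ℕ} (A : Fin M) (X Y : Matrix (Fin 2) (Fin 2) ℂ) :
    embed A X * embed A Y = embed A (X * Y) := by
  ext b c
  rw [Matrix.mul_apply]
  by_cases h : ∀ D, D ≠ A → b D = c D
  · have hr : embed A (X * Y) b c = ∑ k, X (b A) k * Y k (c A) := by
      simp only [embed, Matrix.of_apply, if_pos h, Matrix.mul_apply]
    rw [hr, ← Finset.sum_subset (Finset.subset_univ
      (Finset.univ.image fun k : Fin 2 => Function.update b A k))]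
    · rw [Finset.sum_image fun k _ l _ hkl => by simpa using congrFun hkl A]
      refine Finset.sum_congr rfl fun k _ => ?_
      simp only [embed, Matrix.of_apply]
      rw [if_pos fun D hD => by simp [hD], if_pos fun D hD => by simpa [hD] using h D hD]
      simp
    · intro d _ hd
      simp only [embed, Matrix.of_apply]
      rw [if_neg, zero_mul]
      intro hbd
      refine hd (Finset.mem_image.2 ⟨d A, Finset.mem_univ _, ?_⟩)
      funext D
      by_cases hD : D = A
      · subst hD; simp
      · simp [hD, hbd D hD]
  · have hr : embed A (X * Y) b c = 0 := by
      simp only [embed, Matrix.of_apply, if_neg h]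
    rw [hr]
    refine Finset.sum_eq_zero fun d _ => ?_
    simp only [embed, Matrix.of_apply]
    by_cases h1 : ∀ D, D ≠ A → b D = d D
    · rw [if_neg (fun h2 : ∀ D, D ≠ A → d D = c D => h fun D hD => (h1 D hD).trans (h2 D hD)),
        mul_zero]
    · rw [if_neg h1, zero_mul]

theorem embed2_mul {M : ℕ} {A B : Fin M} (hAB : A ≠ B)
    (X Y : Matrix (Fin 2 × Fin 2) (Fin 2 × Fin 2) ℂ) :
    embed2 A B X * embed2 A B Y = embed2 A B (X * Y) := by
  ext b c
  rw [Matrix.mul_apply]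
  by_cases h : ∀ D, D ≠ A → D ≠ B → b D = c D
  · have hr : embed2 A B (X * Y) b c = ∑ k, X (b A, b B) k * Y k (c A, c B) := by
      simp only [embed2, Matrix.of_apply, if_pos h, Matrix.mul_apply]
    rw [hr, ← Finset.sum_subset (Finset.subset_univ
      (Finset.univ.image fun k : Fin 2 × Fin 2 =>
        Function.update (Function.update b A k.1) B k.2))]
    · rw [Finset.sum_image fun k _ l _ hkl => by
        have h1 := congrFun hkl A
        have h2 := congrFun hkl B
        simp only [Function.update_self, Function.update_of_ne hAB] at h1 h2
        exact Prod.ext h1 h2]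
      refine Finset.sum_congr rfl fun k _ => ?_
      simp only [embed2, Matrix.of_apply]
      rw [if_pos fun D hD hD' => by simp [hD, hD'],
        if_pos fun D hD hD' => by simpa [hD, hD'] using h D hD hD']
      simp [Function.update_of_ne hAB]
    · intro d _ hd
      simp only [embed2, Matrix.of_apply]
      rw [if_neg, zero_mul]
      intro hbd
      refine hd (Finset.mem_image.2 ⟨(d A, d B), Finset.mem_univ _, ?_⟩)
      funext D
      by_cases hD' : D = B
      · subst hD'; simp
      by_cases hD : D = A
      · subst hD; simp [hD']
      · simp [hD, hD', hbd D hD hD']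
  · have hr : embed2 A B (X * Y) b c = 0 := by
      simp only [embed2, Matrix.of_apply, if_neg h]
    rw [hr]
    refine Finset.sum_eq_zero fun d _ => ?_
    simp only [embed2, Matrix.of_apply]
    by_cases h1 : ∀ D, D ≠ A → D ≠ B → b D = d D
    · rw [if_neg (fun h2 : ∀ D, D ≠ A → D ≠ B → d D = c D =>
        h fun D hD hD' => (h1 D hD hD').trans (h2 D hD hD')), mul_zero]
    · rw [if_neg h1, zero_mul]

/-! ### The gauge transformation removing the gates -/

/-- Labels of possible gates. -/
abbrev GateLabel (M n : ℕ) : Type := Fin M × Fin M × Fin (depth M n + 1)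

/-- The time step of a label. -/
def GateLabel.time {M n : ℕ} (g : GateLabel M n) : ℕ := g.2.2

/-- The action of a gate on the bits. -/
noncomputable def gateMatrix {M n : ℕ} (U : OneDimCircuit M n) (g : GateLabel M n) :
    Matrix (Bits M) (Bits M) ℂ :=
  if g.1 = g.2.1 then embed g.1 (U.gate1 g.1 g.2.2 : Matrix (Fin 2) (Fin 2) ℂ)
  else embed2 g.1 g.2.1 (U.gate2 g.1 g.2.2 : Matrix (Fin 2 × Fin 2) (Fin 2 × Fin 2) ℂ)

theorem localOn_gateMatrix {M n : ℕ} (U : OneDimCircuit M n) (g : GateLabel M n) :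
    LocalOn {g.1, g.2.1} (gateMatrix U g) := by
  unfold gateMatrix
  split_ifs with h
  · rw [← h, Finset.pair_eq_singleton]
    exact localOn_embed _ _
  · exact localOn_embed2 _ _ _

theorem gateMatrix_mul_conjTranspose {M n : ℕ} (U : OneDimCircuit M n) (g : GateLabel M n) :
    gateMatrix U g * (gateMatrix U g)ᴴ = 1 := by
  unfold gateMatrix
  split_ifs with h
  · rw [← embed_conjTranspose, embed_mul, ← embed_one g.1]
    congr 1
    exact Matrix.mem_unitaryGroup_iff.1 (U.gate1 g.1 g.2.2).2
  · rw [← embed2_conjTranspose, embed2_mul h, ← embed2_one g.1 g.2.1]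
    congr 1
    exact Matrix.mem_unitaryGroup_iff.1 (U.gate2 g.1 g.2.2).2

open Classical in
/-- The gates of the circuit, the latest first. -/
noncomputable def gateList (M n : ℕ) : List (GateLabel M n) :=
  (Finset.univ.filter fun g : GateLabel M n => IsGate n g.1 g.2.1 g.2.2).toList.insertionSort
    fun g h => h.time ≤ g.time

theorem mem_gateList {M n : ℕ} {g : GateLabel M n} :
    g ∈ gateList M n ↔ IsGate n g.1 g.2.1 g.2.2 := by
  classical
  simp [gateList, List.mem_insertionSort]

theorem nodup_gateList (M n : ℕ) : (gateList M n).Nodup := by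
  classical
  exact (List.perm_insertionSort _ _).nodup_iff.2 (Finset.nodup_toList _)

theorem pairwise_gateList (M n : ℕ) :
    (gateList M n).Pairwise fun g h => h.time ≤ g.time := by
  classical
  have : Std.Total fun g h : GateLabel M n => h.time ≤ g.time := ⟨fun g h => le_total _ _⟩
  have : IsTrans (GateLabel M n) fun g h => h.time ≤ g.time := ⟨fun _ _ _ h h' => h'.trans h⟩
  exact List.pairwise_insertionSort _ _

/-- All qubits of a gate have passed it. -/
def Passed {M n : ℕ} (x : Pos M n) (g : GateLabel M n) : Prop :=
  g.time ≤ x g.1 ∧ g.time ≤ x g.2.1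

instance {M n : ℕ} (x : Pos M n) (g : GateLabel M n) : Decidable (Passed x g) := by
  unfold Passed; infer_instance

/-- The action of the gates already passed in a list. -/
noncomputable def passedProd {M n : ℕ} (U : OneDimCircuit M n) (x : Pos M n)
    (l : List (GateLabel M n)) : Matrix (Bits M) (Bits M) ℂ :=
  (l.map fun g => if Passed x g then gateMatrix U g else 1).prod

/-- The evolution of the bits up to the time steps `x`. -/
noncomputable def evolution {M n : ℕ} (U : OneDimCircuit M n) (x : Pos M n) :
    Matrix (Bits M) (Bits M) ℂ := passedProd U x (gateList M n)

theorem passedProd_mul_conjTranspose {M n : ℕ} (U : OneDimCircuit M n) (x : Pos M n)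
    (l : List (GateLabel M n)) : passedProd U x l * (passedProd U x l)ᴴ = 1 := by
  induction l with
  | nil => simp [passedProd]
  | cons g l ih =>
    have h : passedProd U x (g :: l) = (if Passed x g then gateMatrix U g else 1) *
        passedProd U x l := by simp [passedProd]
    rw [h, Matrix.conjTranspose_mul, Matrix.mul_assoc, ← Matrix.mul_assoc (passedProd U x l), ih,
      Matrix.one_mul]
    split_ifs
    · exact gateMatrix_mul_conjTranspose U g
    · simp

theorem passedProd_congr {M n : ℕ} (U : OneDimCircuit M n) (x y : Pos M n)
    (l : List (GateLabel M n)) (h : ∀ g ∈ l, (Passed x g ↔ Passed y g)) :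
    passedProd U x l = passedProd U y l := by
  unfold passedProd
  congr 1
  refine List.map_congr_left fun g hg => ?_
  simp only [h g hg]

theorem passedProd_commute {M n : ℕ} (U : OneDimCircuit M n) (x : Pos M n)
    (l : List (GateLabel M n)) (T : Matrix (Bits M) (Bits M) ℂ)
    (h : ∀ g ∈ l, Passed x g → gateMatrix U g * T = T * gateMatrix U g) :
    passedProd U x l * T = T * passedProd U x l := by
  induction l with
  | nil => simp [passedProd]
  | cons g l ih =>
    have hc : passedProd U x (g :: l) = (if Passed x g then gateMatrix U g else 1) *
        passedProd U x l := by simp [passedProd]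
    rw [hc, Matrix.mul_assoc, ih fun g hg => h g (List.mem_cons_of_mem _ hg),
      ← Matrix.mul_assoc, ← Matrix.mul_assoc]
    congr 1
    split_ifs with hp
    · exact h g List.mem_cons_self hp
    · simp

/-- Performing a gate multiplies the evolution by the matrix of the gate. -/
theorem evolution_hop {M n : ℕ} (U : OneDimCircuit M n) {A B : Fin M} {i : ℕ}
    (hg : IsGate n A B i) {x y : Pos M n} (h : hop n A B i (i - 1) y x) :
    evolution U y = gateMatrix U (A, B, ⟨i, Nat.lt_succ_of_le hg.le_depth⟩) * evolution U x := by
  set g₀ : GateLabel M n := (A, B, ⟨i, Nat.lt_succ_of_le hg.le_depth⟩) with hg₀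
  have hi : 1 ≤ i := (firstStep_pos A).trans (hg.firstStep_le (Or.inl rfl))
  have hmem : g₀ ∈ gateList M n := mem_gateList.2 hg
  obtain ⟨l₁, l₂, hl⟩ := List.append_of_mem hmem
  have hnd := nodup_gateList M n
  rw [hl] at hnd
  have hsort := pairwise_gateList M n
  rw [hl] at hsort
  have hyD : ∀ D, D = A ∨ D = B → (y D : ℕ) = i ∧ (x D : ℕ) = i - 1 := by
    rintro D (rfl | rfl)
    · exact ⟨h.2.1, h.2.2.2.1⟩
    · exact ⟨h.2.2.1, h.2.2.2.2⟩
  have hne : ∀ D, ¬ (D = A ∨ D = B) → y D = x D := fun D hD =>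
    h.1 D (fun h => hD (Or.inl h)) (fun h => hD (Or.inr h))
  -- The move changes time steps only across i on A and B, and these qubits have just one gate at
  -- time i. No other gate changes its status.
  have hcongr : ∀ g ∈ gateList M n, g ≠ g₀ → (Passed y g ↔ Passed x g) := by
    intro g hgl hgne
    have hgate := mem_gateList.1 hgl
    have key : ∀ D, D = g.1 ∨ D = g.2.1 → (g.time ≤ y D ↔ g.time ≤ x D) := by
      intro D hD
      by_cases hDAB : D = A ∨ D = B
      · rw [(hyD D hDAB).1, (hyD D hDAB).2]
        have : g.time ≠ i := by
          intro hti
          rw [show ((g.2.2 : ℕ)) = i from hti] at hgate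
          obtain ⟨h1, h2⟩ := hgate.unique hg hD hDAB
          exact hgne (Prod.ext h1 (Prod.ext h2 (Fin.ext hti)))
        omega
      · rw [hne D hDAB]
    unfold Passed
    rw [key g.1 (Or.inl rfl), key g.2.1 (Or.inr rfl)]
  have hsplit : ∀ z, evolution U z = passedProd U z l₁ *
      ((if Passed z g₀ then gateMatrix U g₀ else 1) * passedProd U z l₂) := by
    intro z
    unfold evolution
    rw [hl]
    simp [passedProd]
  rw [hsplit y, hsplit x, if_pos, if_neg]
  · have h1 : passedProd U y l₁ = passedProd U x l₁ := by
      refine passedProd_congr U y x l₁ fun g hgl => hcongr g (by simp [hl, hgl]) ?_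
      rintro rfl
      exact (List.disjoint_of_nodup_append hnd hgl List.mem_cons_self)
    have h2 : passedProd U y l₂ = passedProd U x l₂ := by
      refine passedProd_congr U y x l₂ fun g hgl => hcongr g (by simp [hl, hgl]) ?_
      rintro rfl
      exact (List.nodup_cons.1 (List.Nodup.of_append_right hnd)).1 hgl
    rw [h1, h2, Matrix.one_mul, ← Matrix.mul_assoc, passedProd_commute, Matrix.mul_assoc]
    intro g hgl hpass
    refine (localOn_gateMatrix U g).commute (localOn_gateMatrix U g₀) ?_
    rw [Finset.disjoint_left]
    intro D hD hD'
    simp only [Finset.mem_insert, Finset.mem_singleton] at hD hD'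
    -- Gates in front of `g₀` act no earlier than i. Those passed at x therefore avoid A and B,
    -- which sit at i - 1, and so commute with `g₀`, which can be pulled to the left end.
    have ht : i ≤ g.time := (List.pairwise_append.1 hsort).2.2 g hgl g₀ List.mem_cons_self
    have hx := (hyD D hD').2
    rcases hD with rfl | rfl
    · have := hpass.1
      omega
    · have := hpass.2
      omega
  · intro hp
    have := hp.1
    rw [show (x g₀.1 : ℕ) = i - 1 from h.2.2.2.1, show g₀.time = i from rfl] at this
    omega
  · exact ⟨h.2.1.ge, h.2.2.1.ge⟩

/-- The evolution does not involve a qubit which is still at its initial time step. -/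
theorem evolution_commute_of_start {M n : ℕ} (U : OneDimCircuit M n) {A : Fin M} {x : Pos M n}
    (hx : (x A : ℕ) = firstStep A - 1) (T : Matrix (Bits M) (Bits M) ℂ) (hT : LocalOn {A} T) :
    evolution U x * T = T * evolution U x := by
  refine passedProd_commute U x _ T fun g hg hp => ?_
  refine (localOn_gateMatrix U g).commute hT ?_
  rw [Finset.disjoint_right]
  intro D hD hD'
  simp only [Finset.mem_insert, Finset.mem_singleton] at hD hD'
  subst hD
  have h1 := (mem_gateList.1 hg).firstStep_le hD'
  have h2 := firstStep_pos D
  rcases hD' with rfl | rfl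
  · have := hp.1
    unfold GateLabel.time at this
    omega
  · have := hp.2
    unfold GateLabel.time at this
    omega

/-- The unitary operator `∑ₓ |x⟩⟨x| ⊗ evolution x`. -/
noncomputable def gauge {M n : ℕ} (U : OneDimCircuit M n) : Op M n :=
  Matrix.of fun c d => if pos c = pos d then evolution U (pos d) (bits c) (bits d) else 0

theorem gauge_mul_conjTranspose {M n : ℕ} (U : OneDimCircuit M n) :
    gauge U * (gauge U)ᴴ = 1 := by
  ext c d
  rw [Matrix.mul_apply, sum_conf, Finset.sum_eq_single (pos c)]
  · by_cases h : pos c = pos d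
    · have h1 := congrFun (congrFun (passedProd_mul_conjTranspose U (pos c) (gateList M n))
        (bits c)) (bits d)
      rw [Matrix.mul_apply] at h1
      simp only [gauge, Matrix.of_apply, Matrix.conjTranspose_apply, pos_conf, bits_conf, if_pos,
        h.symm] at h1 ⊢
      refine Eq.trans h1 ?_
      simp only [Matrix.one_apply]
      refine if_congr ⟨fun h2 => ?_, fun h2 => by rw [h2]⟩ rfl rfl
      rw [← conf_pos_bits c, ← conf_pos_bits d, h, h2]
    · rw [Matrix.one_apply_ne (fun h1 => h (by rw [h1]))]
      refine Finset.sum_eq_zero fun b _ => ?_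
      simp [gauge, Ne.symm h]
  · intro x _ hx
    refine Finset.sum_eq_zero fun b _ => ?_
    simp [gauge, Ne.symm hx]
  · simp

theorem tens_mul_gauge_apply {M n : ℕ} (U : OneDimCircuit M n)
    (P : Matrix (Pos M n) (Pos M n) ℂ) (T : Matrix (Bits M) (Bits M) ℂ) (c d : Conf M n) :
    (tens P T * gauge U) c d =
      P (pos c) (pos d) * (T * evolution U (pos d)) (bits c) (bits d) := by
  rw [Matrix.mul_apply, sum_conf, Finset.sum_eq_single (pos d)]
  · rw [Matrix.mul_apply, Finset.mul_sum]
    refine Finset.sum_congr rfl fun b _ => ?_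
    simp [gauge, tens, mul_assoc]
  · intro x _ hx
    refine Finset.sum_eq_zero fun b _ => ?_
    simp [gauge, hx]
  · simp

theorem gauge_mul_tens_apply {M n : ℕ} (U : OneDimCircuit M n)
    (P : Matrix (Pos M n) (Pos M n) ℂ) (T : Matrix (Bits M) (Bits M) ℂ) (c d : Conf M n) :
    (gauge U * tens P T) c d =
      P (pos c) (pos d) * (evolution U (pos c) * T) (bits c) (bits d) := by
  rw [Matrix.mul_apply, sum_conf, Finset.sum_eq_single (pos c)]
  · rw [Matrix.mul_apply, Finset.mul_sum]
    refine Finset.sum_congr rfl fun b _ => ?_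
    simp [gauge, tens]
    ring
  · intro x _ hx
    refine Finset.sum_eq_zero fun b _ => ?_
    simp [gauge, Ne.symm hx]
  · simp

/-- `K` is carried to `K'` by the gauge transformation. -/
def Intertwined {M n : ℕ} (U : OneDimCircuit M n) (K K' : Op M n) : Prop :=
  K * gauge U = gauge U * K'

/-- This reduces the unitary equivalence to one identity per term: the evolutions at the two ends of
a hop need only be related by the bit matrices. -/
theorem intertwined_tens {M n : ℕ} (U : OneDimCircuit M n) {A B : Fin M} {i k : ℕ}
    {T T' : Matrix (Bits M) (Bits M) ℂ}
    (h : ∀ x y, hop n A B i k x y → T * evolution U y = evolution U x * T') :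
    Intertwined U (tens (hopMatrix n ℂ A B i k) T) (tens (hopMatrix n ℂ A B i k) T') := by
  ext c d
  rw [tens_mul_gauge_apply, gauge_mul_tens_apply]
  by_cases hP : hop n A B i k (pos c) (pos d)
  · rw [h _ _ hP]
  · simp [hopMatrix, hP]

namespace Intertwined

variable {M n : ℕ} {U : OneDimCircuit M n} {K K' L L' : Op M n}

theorem add (h : Intertwined U K K') (h' : Intertwined U L L') :
    Intertwined U (K + L) (K' + L') := by
  unfold Intertwined at *
  rw [add_mul, mul_add, h, h']

theorem sub (h : Intertwined U K K') (h' : Intertwined U L L') :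
    Intertwined U (K - L) (K' - L') := by
  unfold Intertwined at *
  rw [sub_mul, mul_sub, h, h']

theorem mul (h : Intertwined U K K') (h' : Intertwined U L L') :
    Intertwined U (K * L) (K' * L') := by
  unfold Intertwined at *
  rw [Matrix.mul_assoc, h', ← Matrix.mul_assoc, h, Matrix.mul_assoc]

theorem smul (z : ℂ) (h : Intertwined U K K') : Intertwined U (z • K) (z • K') := by
  unfold Intertwined at *
  rw [Matrix.smul_mul, Matrix.mul_smul, h]

theorem zero : Intertwined U (0 : Op M n) 0 := by
  unfold Intertwined; simp

theorem sum {ι : Type*} (s : Finset ι) {F F' : ι → Op M n}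
    (h : ∀ i ∈ s, Intertwined U (F i) (F' i)) :
    Intertwined U (∑ i ∈ s, F i) (∑ i ∈ s, F' i) := by
  unfold Intertwined at *
  rw [Finset.sum_mul, Finset.mul_sum]
  exact Finset.sum_congr rfl h

theorem ite {p : Prop} [Decidable p] (h : p → Intertwined U K K') :
    Intertwined U (if p then K else 0) (if p then K' else 0) := by
  split_ifs with hp
  · exact h hp
  · exact zero

end Intertwined

theorem intertwined_bilin_same {M n : ℕ} (U : OneDimCircuit M n) (A : Fin M) (i : ℕ) (z : ℂ) :
    Intertwined U (bilin A i i (z • 1)) (bilin A i i (z • 1)) := by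
  rw [bilin_eq_tens]
  refine intertwined_tens U fun x y h => ?_
  rw [h.eq_of_same, embed_smul, embed_one]
  simp

theorem intertwined_num {M n : ℕ} (U : OneDimCircuit M n) (A : Fin M) (i : ℕ) :
    Intertwined U (num A i) (num A i) := by
  have := intertwined_bilin_same U A i 1
  rwa [one_smul] at this

/-- At its start a qubit has passed no gate, so the evolution commutes with any matrix on its bit.
-/
theorem intertwined_hInit {M n : ℕ} (U : OneDimCircuit M n) (ℰ : ℝ) (A : Fin M) :
    Intertwined U (hInit ℰ A (firstStep A - 1)) (hInit ℰ A (firstStep A - 1)) := by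
  unfold hInit numBit
  refine Intertwined.smul _ ?_
  rw [bilin_eq_tens]
  refine intertwined_tens U fun x y h => ?_
  obtain rfl := h.eq_of_same
  exact (evolution_commute_of_start U h.2.1 _ (localOn_embed _ _)).symm

theorem intertwined_hOne {M n : ℕ} (U : OneDimCircuit M n) (ℰ : ℝ) (A : Fin M) (i : ℕ)
    (hi : IsOneQubitGate n A i) :
    Intertwined U (hOne ℰ A i (U.gate1 A i : Matrix (Fin 2) (Fin 2) ℂ)) (hOne ℰ A i 1) := by
  have hg : IsGate n A A i := Or.inl ⟨rfl, hi⟩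
  set V := (U.gate1 A i : Matrix (Fin 2) (Fin 2) ℂ) with hV
  have hVV : Vᴴ * V = 1 := Matrix.mem_unitaryGroup_iff'.1 (U.gate1 A i).2
  have hm : gateMatrix U (A, A, ⟨i, Nat.lt_succ_of_le hg.le_depth⟩) = embed A V := by
    simp [gateMatrix, hV]
  have hone : ∀ k, Intertwined U (bilin A k k 1) (bilin A k k 1) := fun k => intertwined_num U A k
  unfold hOne
  rw [hVV, Matrix.conjTranspose_one, Matrix.one_mul]
  refine Intertwined.smul _ (Intertwined.add (Intertwined.sub (Intertwined.sub (hone _) ?_) ?_)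
    (hone _))
  · rw [bilin_eq_tens, bilin_eq_tens]
    refine intertwined_tens U fun x y h => ?_
    rw [evolution_hop U hg h, hm, embed_one, Matrix.mul_one]
  · rw [bilin_eq_tens, bilin_eq_tens]
    refine intertwined_tens U fun x y h => ?_
    rw [evolution_hop U hg h.symm, hm, embed_one, Matrix.mul_one, ← Matrix.mul_assoc, embed_mul,
      hVV, embed_one, Matrix.one_mul]

/-- With a general factor z the gate matrix is not unitary and cannot be gauged away. The first gate
of every circuit is the identity, so the evolution is unchanged across it and only a scalar has to
be commuted. -/
theorem intertwined_hOne_first {M n : ℕ} (U : OneDimCircuit M n) (ℰ : ℝ) (A : Fin M) (z : ℂ) :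
    Intertwined U (hOne ℰ A (firstStep A) (z • 1)) (hOne ℰ A (firstStep A) (z • 1)) := by
  have hg : IsGate n A A (firstStep A) := Or.inl ⟨rfl, isOneQubitGate_firstStep n A⟩
  have hev : ∀ x y : Pos M n, hop n A A (firstStep A) (firstStep A - 1) x y →
      evolution U x = evolution U y := by
    intro x y h
    rw [evolution_hop U hg h]
    simp [gateMatrix, U.gate1_first, embed_one]
  have h1 : (z • (1 : Matrix (Fin 2) (Fin 2) ℂ))ᴴ = (star z) • 1 := by
    rw [Matrix.conjTranspose_smul, Matrix.conjTranspose_one]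
  have h2 : (star z • (1 : Matrix (Fin 2) (Fin 2) ℂ)) * (z • 1) = (star z * z) • 1 := by
    rw [Matrix.smul_mul, Matrix.one_mul, smul_smul]
  unfold hOne
  rw [h1, h2]
  refine Intertwined.smul _ (Intertwined.add (Intertwined.sub (Intertwined.sub
    (intertwined_num U A _) ?_) ?_) (intertwined_bilin_same U A _ _))
  · rw [bilin_eq_tens]
    refine intertwined_tens U fun x y h => ?_
    rw [hev x y h, embed_smul, embed_one]
    simp
  · rw [bilin_eq_tens]
    refine intertwined_tens U fun x y h => ?_
    rw [hev y x h.symm, embed_smul, embed_one]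
    simp

theorem intertwined_hTwo {M n : ℕ} (U : OneDimCircuit M n) (ℰ : ℝ) (A B : Fin M) (i : ℕ)
    (hi : IsTwoQubitGate n A B i) :
    Intertwined U (hTwo ℰ A B i (U.gate2 A i : Matrix (Fin 2 × Fin 2) (Fin 2 × Fin 2) ℂ))
      (hTwo ℰ A B i 1) := by
  have hg : IsGate n A B i := Or.inr hi
  set V := (U.gate2 A i : Matrix (Fin 2 × Fin 2) (Fin 2 × Fin 2) ℂ) with hV
  have hVV : Vᴴ * V = 1 := Matrix.mem_unitaryGroup_iff'.1 (U.gate2 A i).2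
  have hm : gateMatrix U (A, B, ⟨i, Nat.lt_succ_of_le hg.le_depth⟩) = embed2 A B V := by
    simp [gateMatrix, hV, hi.ne]
  have hone : ∀ k, Intertwined U (bilin2 A B k k k k 1) (bilin2 A B k k k k 1) := by
    intro k
    rw [bilin2_eq_tens]
    refine intertwined_tens U fun x y h => ?_
    rw [h.eq_of_same, embed2_one]
    simp
  unfold hTwo
  rw [hVV, Matrix.conjTranspose_one, Matrix.one_mul]
  refine Intertwined.smul _ (Intertwined.add (Intertwined.sub (Intertwined.sub (hone _) ?_) ?_)
    (hone _))
  · rw [bilin2_eq_tens, bilin2_eq_tens]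
    refine intertwined_tens U fun x y h => ?_
    rw [evolution_hop U hg h, hm, embed2_one, Matrix.mul_one]
  · rw [bilin2_eq_tens, bilin2_eq_tens]
    refine intertwined_tens U fun x y h => ?_
    rw [evolution_hop U hg h.symm, hm, embed2_one, Matrix.mul_one, ← Matrix.mul_assoc,
      embed2_mul hi.ne, hVV, embed2_one, Matrix.one_mul]

theorem intertwined_H {M n : ℕ} (U : OneDimCircuit M n) (ℰ l : ℝ) :
    Intertwined U (H U ℰ l) (H (identityCircuit M n) ℰ l) := by
  unfold H Hindependent
  refine Intertwined.add (Intertwined.add ?_ ?_) ?_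
  · refine Intertwined.sum _ fun B _ => Intertwined.sum _ fun A _ => Intertwined.ite fun _ =>
      Intertwined.smul _ (Intertwined.sum _ fun i _ => intertwined_num U A i)
  · exact Intertwined.sum _ fun A _ =>
      (intertwined_hInit U ℰ A).add (intertwined_hOne_first U ℰ A _)
  · refine Intertwined.sum _ fun i _ => Intertwined.add ?_ ?_
    · exact Intertwined.sum _ fun A _ => Intertwined.ite fun h => intertwined_hOne U ℰ A i h.1
    · refine Intertwined.sum _ fun A _ => Intertwined.sum _ fun B _ => Intertwined.ite fun h =>
        (intertwined_hTwo U ℰ A B i h).add ?_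
      unfold hPenalty
      refine Intertwined.smul _ (Intertwined.sum _ fun k _ => Intertwined.sum _ fun l _ =>
        Intertwined.add ?_ ?_)
      · exact (intertwined_num U A k).mul (intertwined_num U B l)
      · exact (intertwined_num U A l).mul (intertwined_num U B k)

/-- The Hamiltonian is unitarily equivalent to the one of the identity circuit. -/
theorem H_eq_gauge_conj {M n : ℕ} (U : OneDimCircuit M n) (ℰ l : ℝ) :
    H U ℰ l = gauge U * H (identityCircuit M n) ℰ l * (gauge U)ᴴ := by
  have h := intertwined_H U ℰ l
  unfold Intertwined at h
  rw [← h, Matrix.mul_assoc, gauge_mul_conjTranspose, Matrix.mul_one]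

/-! ### The Hamiltonian of the identity circuit as a real matrix on positions -/

/-- A real matrix on positions, acting trivially on the bits. -/
noncomputable def tensOne {M n : ℕ} (P : Matrix (Pos M n) (Pos M n) ℝ) : Op M n :=
  tens (P.map ((↑) : ℝ → ℂ)) 1

theorem tensOne_add {M n : ℕ} (P Q : Matrix (Pos M n) (Pos M n) ℝ) :
    tensOne (P + Q) = tensOne P + tensOne Q := by
  ext c d; simp [tensOne, tens, add_mul]

theorem tensOne_sub {M n : ℕ} (P Q : Matrix (Pos M n) (Pos M n) ℝ) :
    tensOne (P - Q) = tensOne P - tensOne Q := by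
  ext c d; simp [tensOne, tens, sub_mul]

theorem tensOne_smul {M n : ℕ} (a : ℝ) (P : Matrix (Pos M n) (Pos M n) ℝ) :
    tensOne (a • P) = (a : ℂ) • tensOne P := by
  ext c d; simp [tensOne, tens, mul_assoc]

theorem tensOne_zero {M n : ℕ} : tensOne (0 : Matrix (Pos M n) (Pos M n) ℝ) = 0 := by
  ext c d; simp [tensOne, tens]

theorem tensOne_sum {M n : ℕ} {ι : Type*} (s : Finset ι)
    (F : ι → Matrix (Pos M n) (Pos M n) ℝ) :
    tensOne (∑ i ∈ s, F i) = ∑ i ∈ s, tensOne (F i) := by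
  classical
  induction s using Finset.induction_on with
  | empty => simp [tensOne_zero]
  | insert i s hi ih => rw [Finset.sum_insert hi, Finset.sum_insert hi, tensOne_add, ih]

theorem tens_smul_right {M n : ℕ} (z : ℂ) (P : Matrix (Pos M n) (Pos M n) ℂ)
    (T : Matrix (Bits M) (Bits M) ℂ) : tens P (z • T) = z • tens P T := by
  ext c d
  simp only [tens, Matrix.of_apply, Matrix.smul_apply, smul_eq_mul]
  ring

theorem map_hopMatrix {M n : ℕ} (A B : Fin M) (i k : ℕ) :
    (hopMatrix n ℝ A B i k).map ((↑) : ℝ → ℂ) = hopMatrix n ℂ A B i k := by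
  ext x y
  simp only [hopMatrix, Matrix.map_apply, Matrix.of_apply]
  split_ifs <;> simp

theorem bilin_one {M n : ℕ} (A : Fin M) (i k : ℕ) :
    (bilin A i k 1 : Op M n) = tensOne (hopMatrix n ℝ A A i k) := by
  rw [bilin_eq_tens, embed_one, tensOne, map_hopMatrix]

theorem bilin_smul_one {M n : ℕ} (A : Fin M) (i k : ℕ) (z : ℂ) :
    (bilin A i k (z • 1) : Op M n) = z • tensOne (hopMatrix n ℝ A A i k) := by
  rw [bilin_eq_tens, embed_smul, embed_one, tensOne, map_hopMatrix, tens_smul_right]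

theorem bilin2_one {M n : ℕ} (A B : Fin M) (i k : ℕ) :
    (bilin2 A B i i k k 1 : Op M n) = tensOne (hopMatrix n ℝ A B i k) := by
  rw [bilin2_eq_tens, embed2_one, tensOne, map_hopMatrix]

/-- The matrix `(C†ᵢ - a C†ᵢ₋₁)(Cᵢ - a Cᵢ₋₁)` of a gate on the positions. -/
noncomputable def stepMatrix (n : ℕ) {M : ℕ} (A B : Fin M) (i : ℕ) (a : ℝ) :
    Matrix (Pos M n) (Pos M n) ℝ :=
  hopMatrix n ℝ A B i i - a • hopMatrix n ℝ A B i (i - 1) - a • hopMatrix n ℝ A B (i - 1) i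
    + a ^ 2 • hopMatrix n ℝ A B (i - 1) (i - 1)

theorem hOne_eq {M n : ℕ} (ℰ : ℝ) (A : Fin M) (i : ℕ) (a : ℝ) :
    (hOne ℰ A i ((a : ℂ) • 1) : Op M n) = tensOne (ℰ • stepMatrix n A A i a) := by
  have h1 : ((a : ℂ) • (1 : Matrix (Fin 2) (Fin 2) ℂ))ᴴ = (a : ℂ) • 1 := by
    rw [Matrix.conjTranspose_smul, Matrix.conjTranspose_one]
    simp
  have h2 : ((a : ℂ) • (1 : Matrix (Fin 2) (Fin 2) ℂ)) * ((a : ℂ) • 1) = ((a ^ 2 : ℝ) : ℂ) • 1 := by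
    rw [Matrix.smul_mul, Matrix.one_mul, smul_smul]
    push_cast
    rw [pow_two]
  unfold hOne stepMatrix
  rw [h1, h2, bilin_one, bilin_smul_one, bilin_smul_one, bilin_smul_one, tensOne_smul,
    tensOne_add, tensOne_sub, tensOne_sub, tensOne_smul, tensOne_smul, tensOne_smul]

theorem hOne_one_eq {M n : ℕ} (ℰ : ℝ) (A : Fin M) (i : ℕ) :
    (hOne ℰ A i 1 : Op M n) = tensOne (ℰ • stepMatrix n A A i 1) := by
  have := hOne_eq (n := n) ℰ A i 1
  rwa [Complex.ofReal_one, one_smul] at this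

theorem hTwo_one_eq {M n : ℕ} (ℰ : ℝ) (A B : Fin M) (i : ℕ) :
    (hTwo ℰ A B i 1 : Op M n) = tensOne (ℰ • stepMatrix n A B i 1) := by
  unfold hTwo stepMatrix
  rw [Matrix.conjTranspose_one, Matrix.one_mul, bilin2_one, bilin2_one, bilin2_one, bilin2_one,
    tensOne_smul, tensOne_add, tensOne_sub, tensOne_sub, one_pow, one_smul, one_smul, one_smul]

/-- The matrix of `∑ₗ num A l` etc. is diagonal. -/
theorem tensOne_diagonal_mul {M n : ℕ} (p q : Pos M n → ℝ) :
    tensOne (Matrix.diagonal p) * tensOne (Matrix.diagonal q) =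
      (tensOne (Matrix.diagonal fun x => p x * q x) : Op M n) := by
  have h : ∀ p : Pos M n → ℝ, (tensOne (Matrix.diagonal p) : Op M n) =
      Matrix.diagonal fun c => (p (pos c) : ℂ) := by
    intro p
    ext c d
    simp only [tensOne, tens, Matrix.of_apply, Matrix.map_apply, Matrix.diagonal_apply,
      Matrix.one_apply]
    by_cases hcd : c = d
    · subst hcd; simp
    · rw [if_neg hcd]
      by_cases hp : pos c = pos d
      · have hb : bits c ≠ bits d := fun hb => hcd (by rw [← conf_pos_bits c, hp, hb]; rfl)
        simp [hb]
      · simp [hp]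
  rw [h, h, h, Matrix.diagonal_mul_diagonal]
  simp

theorem hopMatrix_same {M n : ℕ} (A B : Fin M) (i : ℕ) :
    hopMatrix n ℝ A B i i =
      Matrix.diagonal fun x => if (x A : ℕ) = i ∧ (x B : ℕ) = i then 1 else 0 := by
  ext x y
  simp only [hopMatrix, Matrix.of_apply, Matrix.diagonal_apply]
  by_cases h : x = y
  · subst h
    simp only [if_true]
    refine if_congr ⟨fun h => ⟨h.2.1, h.2.2.1⟩, fun h => ⟨fun _ _ _ => rfl, h.1, h.2, h.1, h.2⟩⟩
      rfl rfl
  · rw [if_neg fun h' => h h'.eq_of_same, if_neg h]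

/-- The number of qubits of a gate at `i` that have not passed it, if exactly one has. -/
def violates {M n : ℕ} (x : Pos M n) (A B : Fin M) (i : ℕ) : Prop :=
  ((x A : ℕ) < i ∧ i ≤ (x B : ℕ)) ∨ (i ≤ (x A : ℕ) ∧ (x B : ℕ) < i)

instance {M n : ℕ} (x : Pos M n) (A B : Fin M) (i : ℕ) : Decidable (violates x A B i) := by
  unfold violates; infer_instance

theorem Pos.le_depth {M n : ℕ} (x : Pos M n) (A : Fin M) : (x A : ℕ) ≤ depth M n :=
  (Finset.mem_Icc.1 (x A).2).2.trans (lastStep_le_depth n A)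

theorem Pos.start_le {M n : ℕ} (x : Pos M n) (A : Fin M) : firstStep A - 1 ≤ (x A : ℕ) :=
  (Finset.mem_Icc.1 (x A).2).1

theorem Pos.le_last {M n : ℕ} (x : Pos M n) (A : Fin M) : (x A : ℕ) ≤ lastStep n A :=
  (Finset.mem_Icc.1 (x A).2).2

theorem hPenalty_eq {M n : ℕ} (ℰ : ℝ) (A B : Fin M) (i : ℕ) :
    (hPenalty ℰ A B i : Op M n) =
      tensOne (ℰ • Matrix.diagonal fun x => if violates x A B i then 1 else 0) := by
  have hnum : ∀ (A B : Fin M) (k l : ℕ), (num A k * num B l : Op M n) =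
      tensOne (Matrix.diagonal fun x => if (x A : ℕ) = k ∧ (x B : ℕ) = l then 1 else 0) := by
    intro A B k l
    unfold num
    rw [bilin_one, bilin_one, hopMatrix_same, hopMatrix_same, tensOne_diagonal_mul]
    congr 2
    funext x
    simp only [and_self]
    by_cases h1 : (x A : ℕ) = k <;> by_cases h2 : (x B : ℕ) = l <;> simp [h1, h2]
  unfold hPenalty
  rw [tensOne_smul]
  congr 1
  simp only [hnum, ← tensOne_add, ← tensOne_sum]
  congr 1
  ext x y
  simp only [Matrix.sum_apply, Matrix.add_apply, Matrix.diagonal_apply]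
  by_cases hxy : x = y
  swap
  · simp [hxy]
  subst hxy
  simp only [if_true]
  have hsum : ∀ a b : ℕ, b ≤ depth M n →
      (∑ k ∈ Finset.range i, ∑ l ∈ Finset.Icc i (depth M n),
        if a = k ∧ b = l then (1 : ℝ) else 0) = if a < i ∧ i ≤ b then 1 else 0 := by
    intro a b hb
    simp only [ite_and]
    simp [Finset.sum_ite_eq, hb]
  simp only [Finset.sum_add_distrib]
  rw [hsum _ _ (x.le_depth B)]
  have h2 : (∑ k ∈ Finset.range i, ∑ l ∈ Finset.Icc i (depth M n),
        if (x A : ℕ) = l ∧ (x B : ℕ) = k then (1 : ℝ) else 0) =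
      if (x B : ℕ) < i ∧ i ≤ (x A : ℕ) then 1 else 0 := by
    rw [← hsum _ _ (x.le_depth A)]
    refine Finset.sum_congr rfl fun k _ => Finset.sum_congr rfl fun l _ => ?_
    exact if_congr and_comm rfl rfl
  rw [h2]
  unfold violates
  by_cases h1 : (x A : ℕ) < i <;> by_cases h3 : (x B : ℕ) < i <;>
    simp [h1, h3, not_le.2, not_lt.1]

open Classical in
/-- Sums over the gates, split as in the Hamiltonian. -/
theorem sum_gates {M n : ℕ} {R : Type*} [AddCommMonoid R] (F : Fin M → Fin M → ℕ → R) :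
    (∑ g : GateLabel M n, if IsGate n g.1 g.2.1 g.2.2 then F g.1 g.2.1 g.2.2 else 0) =
      (∑ A, F A A (firstStep A)) + ∑ i ∈ Finset.Icc 1 (depth M n),
        ((∑ A : Fin M, if IsOneQubitGate n A i ∧ i ≠ firstStep A then F A A i else 0)
        + ∑ A : Fin M, ∑ B : Fin M, if IsTwoQubitGate n A B i then F A B i else 0) := by
  have h1 : ∀ (A B : Fin M) (i : ℕ), (if IsGate n A B i then F A B i else 0) =
      (if A = B then (if IsOneQubitGate n A i then F A A i else 0) else 0) +
        if IsTwoQubitGate n A B i then F A B i else 0 := by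
    intro A B i
    by_cases hAB : A = B
    · subst hAB
      have h2 : ¬ IsTwoQubitGate n A A i := fun h => h.ne rfl
      simp [IsGate, h2]
    · simp [IsGate, hAB]
  -- Labels carry times from 0 on, the Hamiltonian sums from 1 on; nothing happens at time 0.
  have hfin : ∀ G : ℕ → R, G 0 = 0 →
      ∑ i : Fin (depth M n + 1), G i = ∑ i ∈ Finset.Icc 1 (depth M n), G i := by
    intro G hG
    rw [Fin.sum_univ_eq_sum_range, Finset.sum_range_succ', hG, add_zero,
      Finset.range_eq_Ico, Finset.sum_Ico_add' G 0 (depth M n) 1]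
    rfl
  rw [Fintype.sum_prod_type]
  simp only [Fintype.sum_prod_type, h1, Finset.sum_add_distrib]
  have h3 : ∀ A : Fin M, (∑ B : Fin M, ∑ i : Fin (depth M n + 1),
      if A = B then (if IsOneQubitGate n A i then F A A i else 0) else 0) =
      F A A (firstStep A) + ∑ i ∈ Finset.Icc 1 (depth M n),
        if IsOneQubitGate n A i ∧ i ≠ firstStep A then F A A i else 0 := by
    intro A
    rw [Finset.sum_eq_single A (fun B _ hB => by simp [hB.symm]) (by simp)]
    simp only [if_true]
    rw [hfin (fun i => if IsOneQubitGate n A i then F A A i else 0)]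
    · have hm : firstStep A ∈ Finset.Icc 1 (depth M n) := Finset.mem_Icc.2
        ⟨firstStep_pos A, (firstStep_lt_lastStep n A).trans (lastStep_le_depth n A)⟩
      rw [← Finset.add_sum_erase _ _ hm, ← Finset.add_sum_erase (Finset.Icc 1 (depth M n))
        (fun i => if IsOneQubitGate n A i ∧ i ≠ firstStep A then F A A i else 0) hm]
      simp only [isOneQubitGate_firstStep, if_true, ne_eq, not_true_eq_false, and_false, if_false,
        zero_add]
      congr 1
      refine Finset.sum_congr rfl fun i hi => ?_
      simp [(Finset.mem_erase.1 hi).1]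
    · rw [if_neg]
      intro h
      have := h.1
      have := firstStep_pos A
      omega
  simp only [h3, Finset.sum_add_distrib]
  rw [add_assoc]
  congr 1
  rw [Finset.sum_comm]
  congr 1
  rw [Finset.sum_comm (s := Finset.Icc 1 (depth M n))]
  refine Finset.sum_congr rfl fun A _ => ?_
  rw [Finset.sum_comm (s := Finset.Icc 1 (depth M n))]
  refine Finset.sum_congr rfl fun B _ => ?_
  refine hfin (fun i => if IsTwoQubitGate n A B i then F A B i else 0) (if_neg fun h => ?_)
  have := h.four_le
  omega

/-- The diagonal part of the Hamiltonian on positions. -/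
noncomputable def potential {M n : ℕ} (lam : Fin M → ℝ) (x : Pos M n) : ℝ :=
  (∑ B : Fin M, ∑ A : Fin M, if A.val = B.val + 1 ∧ firstStep A ≤ (x A : ℕ)
    then 1 - lam B ^ 3 else 0)
  + ∑ i ∈ Finset.Icc 1 (depth M n), ∑ A : Fin M, ∑ B : Fin M,
    if IsTwoQubitGate n A B i ∧ violates x A B i then 1 else 0

/-- The amplitude with which a gate is performed. -/
noncomputable def gateCoef {M : ℕ} (lam : Fin M → ℝ) (A B : Fin M) (i : ℕ) : ℝ :=
  if A = B ∧ i = firstStep A then lam A else 1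

open Classical in
/-- The Hamiltonian of the identity circuit on positions, in units of `ℰ`. -/
noncomputable def posH (n : ℕ) {M : ℕ} (lam : Fin M → ℝ) : Matrix (Pos M n) (Pos M n) ℝ :=
  Matrix.diagonal (potential lam) +
    ∑ g : GateLabel M n, if IsGate n g.1 g.2.1 g.2.2 then
      stepMatrix n g.1 g.2.1 g.2.2 (gateCoef lam g.1 g.2.1 g.2.2) else 0

/-- An operator given by a real matrix on positions, together with the input terms. -/
noncomputable def withInit {M n : ℕ} (ℰ : ℝ) (P : Matrix (Pos M n) (Pos M n) ℝ) : Op M n :=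
  tensOne (ℰ • P) + ∑ A : Fin M, hInit ℰ A (firstStep A - 1)

theorem diagonal_sum {X ι : Type*} [DecidableEq X] (s : Finset ι) (F : ι → X → ℝ) :
    Matrix.diagonal (fun x => ∑ i ∈ s, F i x) = ∑ i ∈ s, Matrix.diagonal (F i) := by
  ext x y
  simp only [Matrix.sum_apply, Matrix.diagonal_apply]
  split_ifs <;> simp

theorem H_identity_eq {M n : ℕ} (ℰ l : ℝ) :
    H (identityCircuit M n) ℰ l = withInit ℰ (posH n (lam l)) := by
  classical
  unfold H Hindependent withInit posH
  have hsum := sum_gates (n := n) (M := M) (R := Matrix (Pos M n) (Pos M n) ℝ)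
    (fun A B i => stepMatrix n A B i (gateCoef (lam l) A B i))
  rw [hsum]
  have hlam : (∑ B : Fin M, ∑ A : Fin M, if A.val = B.val + 1 then
      ((ℰ * (1 - lam l B ^ 3) : ℝ) : ℂ) • ∑ i ∈ Finset.Icc (firstStep A) (lastStep n A),
        (num A i : Op M n) else 0) =
      tensOne (ℰ • Matrix.diagonal fun x : Pos M n => ∑ B : Fin M, ∑ A : Fin M,
        if A.val = B.val + 1 ∧ firstStep A ≤ (x A : ℕ) then 1 - lam l B ^ 3 else 0) := by
    rw [diagonal_sum, Finset.smul_sum, tensOne_sum]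
    refine Finset.sum_congr rfl fun B _ => ?_
    rw [diagonal_sum, Finset.smul_sum, tensOne_sum]
    refine Finset.sum_congr rfl fun A _ => ?_
    by_cases hAB : A.val = B.val + 1
    swap
    · simp [hAB, tensOne_zero]
    simp only [hAB, if_true, true_and]
    rw [Complex.ofReal_mul, mul_smul, tensOne_smul]
    congr 1
    simp only [num, bilin_one, hopMatrix_same, ← tensOne_sum, ← tensOne_smul, ← diagonal_sum,
      and_self]
    congr 1
    ext x y
    simp only [Matrix.smul_apply, Matrix.diagonal_apply, smul_eq_mul]
    by_cases hxy : x = y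
    · subst hxy
      simp only [if_true, Finset.sum_ite_eq, Finset.mem_Icc, x.le_last A, and_true]
      split_ifs <;> simp
    · simp [hxy]
  have hpen : (fun x : Pos M n => ∑ i ∈ Finset.Icc 1 (depth M n), ∑ A : Fin M, ∑ B : Fin M,
      if IsTwoQubitGate n A B i ∧ violates x A B i then (1 : ℝ) else 0) = fun x =>
      ∑ i ∈ Finset.Icc 1 (depth M n), ∑ A : Fin M, ∑ B : Fin M,
        if IsTwoQubitGate n A B i then (if violates x A B i then (1 : ℝ) else 0) else 0 := by
    funext x
    simp only [ite_and]
  have hpot : (Matrix.diagonal (potential (lam l)) : Matrix (Pos M n) (Pos M n) ℝ) =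
      (Matrix.diagonal fun x : Pos M n => ∑ B : Fin M, ∑ A : Fin M,
        if A.val = B.val + 1 ∧ firstStep A ≤ (x A : ℕ) then 1 - lam l B ^ 3 else 0) +
      ∑ i ∈ Finset.Icc 1 (depth M n), ∑ A : Fin M, ∑ B : Fin M,
        if IsTwoQubitGate n A B i then
          (Matrix.diagonal fun x => if violates x A B i then 1 else 0) else 0 := by
    unfold potential
    rw [← Matrix.diagonal_add]
    congr 1
    rw [hpen, diagonal_sum]
    refine Finset.sum_congr rfl fun i _ => ?_
    rw [diagonal_sum]
    refine Finset.sum_congr rfl fun A _ => ?_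
    rw [diagonal_sum]
    refine Finset.sum_congr rfl fun B _ => ?_
    split_ifs
    · rfl
    · simp
  rw [hpot, hlam]
  simp only [Finset.sum_add_distrib]
  have hfirst : ∀ A : Fin M, hOne ℰ A (firstStep A) ((lam l A : ℂ) • 1) =
      (tensOne (ℰ • stepMatrix n A A (firstStep A) (gateCoef (lam l) A A (firstStep A)))
        : Op M n) := by
    intro A
    rw [hOne_eq, gateCoef, if_pos ⟨rfl, rfl⟩]
  have hone : ∀ (i : ℕ) (A : Fin M), (if IsOneQubitGate n A i ∧ i ≠ firstStep A then
      hOne ℰ A i (((identityCircuit M n).gate1 A i : Matrix.unitaryGroup (Fin 2) ℂ) :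
        Matrix (Fin 2) (Fin 2) ℂ) else 0) =
      (tensOne (ℰ • if IsOneQubitGate n A i ∧ i ≠ firstStep A then
        stepMatrix n A A i (gateCoef (lam l) A A i) else 0) : Op M n) := by
    intro i A
    split_ifs with h
    · have h1 : gateCoef (lam l) A A i = 1 := if_neg fun h2 => h.2 h2.2
      rw [h1, ← hOne_one_eq]
      rfl
    · simp [tensOne_zero]
  have htwo : ∀ (i : ℕ) (A B : Fin M), (if IsTwoQubitGate n A B i then
      hTwo ℰ A B i (((identityCircuit M n).gate2 A i :
        Matrix.unitaryGroup (Fin 2 × Fin 2) ℂ) : Matrix (Fin 2 × Fin 2) (Fin 2 × Fin 2) ℂ)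
        + hPenalty ℰ A B i else 0) =
      (tensOne (ℰ • if IsTwoQubitGate n A B i then
        stepMatrix n A B i (gateCoef (lam l) A B i) else 0) : Op M n) +
      tensOne (ℰ • if IsTwoQubitGate n A B i then
        (Matrix.diagonal fun x => if violates x A B i then 1 else 0) else 0) := by
    intro i A B
    split_ifs with h
    · have h1 : gateCoef (lam l) A B i = 1 := if_neg fun h2 => h.ne h2.1
      rw [h1, ← hTwo_one_eq, ← hPenalty_eq]
      rfl
    · simp [tensOne_zero]
  simp only [hfirst, hone, htwo, smul_add, Finset.smul_sum, tensOne_add, tensOne_sum,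
    Finset.sum_add_distrib]
  abel

/-! ### Moves -/

theorem IsGate.le_lastStep {n M : ℕ} {A B D : Fin M} {i : ℕ} (h : IsGate n A B i)
    (hD : D = A ∨ D = B) : i ≤ lastStep n D := by
  rcases h with ⟨rfl, h⟩ | ⟨-, j, hj, rfl, -⟩
  · rcases hD with rfl | rfl <;> exact h.2.1
  · have := (Finset.mem_Icc.1 hj).2
    unfold lastStep
    split_ifs <;> omega

/-- The gate at time step `i` moves `A` and `B` together, from `x` to `y`. -/
def GateMove (n : ℕ) {M : ℕ} (g : GateLabel M n) (x y : Pos M n) : Prop :=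
  IsGate n g.1 g.2.1 g.2.2 ∧ hop n g.1 g.2.1 g.2.2 ((g.2.2 : ℕ) - 1) y x

/-- The position with `A` and `B` moved to the time step `k`. -/
def Pos.setPair {M n : ℕ} (x : Pos M n) (A B : Fin M) (k : ℕ)
    (hk : ∀ D, D = A ∨ D = B → k ∈ Finset.Icc (firstStep D - 1) (lastStep n D)) : Pos M n :=
  fun D => if h : D = A ∨ D = B then ⟨k, hk D h⟩ else x D

theorem Pos.hop_setPair {M n : ℕ} {x : Pos M n} {A B : Fin M} {i k : ℕ}
    (hk : ∀ D, D = A ∨ D = B → k ∈ Finset.Icc (firstStep D - 1) (lastStep n D))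
    (hA : (x A : ℕ) = i) (hB : (x B : ℕ) = i) : hop n A B i k x (x.setPair A B k hk) := by
  refine ⟨fun D h1 h2 => ?_, hA, hB, ?_, ?_⟩
  · simp [Pos.setPair, h1, h2]
  · simp [Pos.setPair]
  · simp [Pos.setPair]

theorem IsGate.pred_mem {n M : ℕ} {A B D : Fin M} {i : ℕ} (h : IsGate n A B i)
    (hD : D = A ∨ D = B) : i - 1 ∈ Finset.Icc (firstStep D - 1) (lastStep n D) := by
  have h1 := h.firstStep_le hD
  have h2 := h.le_lastStep hD
  rw [Finset.mem_Icc]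
  omega

theorem IsGate.mem {n M : ℕ} {A B D : Fin M} {i : ℕ} (h : IsGate n A B i)
    (hD : D = A ∨ D = B) : i ∈ Finset.Icc (firstStep D - 1) (lastStep n D) := by
  have h1 := h.firstStep_le hD
  have h2 := h.le_lastStep hD
  rw [Finset.mem_Icc]
  omega

theorem hop.right_unique {n M : ℕ} {A B : Fin M} {i k : ℕ} {x y y' : Pos M n}
    (h : hop n A B i k x y) (h' : hop n A B i k x y') : y = y' := by
  have := (⟨fun D hA hB => (h.1 D hA hB).symm.trans (h'.1 D hA hB), h.2.2.2.1, h.2.2.2.2,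
    h'.2.2.2.1, h'.2.2.2.2⟩ : hop n A B k k y y')
  exact hop.eq_of_same this

theorem hop.left_unique {n M : ℕ} {A B : Fin M} {i k : ℕ} {x x' y : Pos M n}
    (h : hop n A B i k x y) (h' : hop n A B i k x' y) : x = x' :=
  h.symm.right_unique h'.symm

/-- The change of the amplitude along the moves of a gate. -/
noncomputable def moveForm (n : ℕ) {M : ℕ} (A B : Fin M) (i : ℕ) (a : ℝ) (f : Pos M n → ℝ) : ℝ :=
  ∑ x, ∑ y, if hop n A B i (i - 1) y x then (f y - a * f x) ^ 2 else 0

theorem dotProduct_hopMatrix {n M : ℕ} (A B : Fin M) (i k : ℕ) (f : Pos M n → ℝ) :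
    f ⬝ᵥ hopMatrix n ℝ A B i k *ᵥ f =
      ∑ x, ∑ y, if hop n A B i k x y then f x * f y else 0 := by
  simp only [dotProduct, Matrix.mulVec, Finset.mul_sum]
  refine Finset.sum_congr rfl fun x _ => Finset.sum_congr rfl fun y _ => ?_
  simp only [hopMatrix, Matrix.of_apply]
  split_ifs <;> ring

/-- Both i and i - 1 are admissible time steps for the qubits of a gate, so each position at one end
has exactly one partner at the other. The two diagonal terms thus become sums over moves and
complete the square. -/
theorem IsGate.dotProduct_stepMatrix {n M : ℕ} {A B : Fin M} {i : ℕ} (h : IsGate n A B i)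
    (a : ℝ) (f : Pos M n → ℝ) :
    f ⬝ᵥ stepMatrix n A B i a *ᵥ f = moveForm n A B i a f := by
  have hself : ∀ (j k : ℕ) (_ : ∀ D, D = A ∨ D = B →
      k ∈ Finset.Icc (firstStep D - 1) (lastStep n D)),
      f ⬝ᵥ hopMatrix n ℝ A B j j *ᵥ f = ∑ x, ∑ y, if hop n A B j k x y then f x ^ 2 else 0 := by
    intro j k hk
    rw [dotProduct_hopMatrix]
    refine Finset.sum_congr rfl fun x _ => ?_
    by_cases hx : (x A : ℕ) = j ∧ (x B : ℕ) = j
    · have h1 : hop n A B j j x x := ⟨fun _ _ _ => rfl, hx.1, hx.2, hx.1, hx.2⟩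
      have h2 := Pos.hop_setPair hk hx.1 hx.2
      rw [sum_ite_of_unique (R := fun y => hop n A B j j x y)
          (fun y y' hy hy' => hop.right_unique hy hy') _ h1,
        sum_ite_of_unique (R := fun y => hop n A B j k x y)
          (fun y y' hy hy' => hop.right_unique hy hy') _ h2]
      ring
    · rw [sum_ite_of_none fun y hy => hx ⟨hy.2.1, hy.2.2.1⟩,
        sum_ite_of_none fun y hy => hx ⟨hy.2.1, hy.2.2.1⟩]
  have h1 := hself i (i - 1) fun D hD => h.pred_mem hD
  have h2 := hself (i - 1) i fun D hD => h.mem hD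
  have hswap : ∀ j k (F : Pos M n → Pos M n → ℝ),
      (∑ x, ∑ y, if hop n A B j k x y then F x y else 0) =
        ∑ x, ∑ y, if hop n A B k j x y then F y x else 0 := by
    intro j k F
    rw [Finset.sum_comm]
    exact Finset.sum_congr rfl fun x _ => Finset.sum_congr rfl fun y _ =>
      if_congr ⟨hop.symm, hop.symm⟩ rfl rfl
  rw [stepMatrix, Matrix.add_mulVec, Matrix.sub_mulVec, Matrix.sub_mulVec, dotProduct_add,
    dotProduct_sub, dotProduct_sub, Matrix.smul_mulVec, Matrix.smul_mulVec, Matrix.smul_mulVec,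
    dotProduct_smul, dotProduct_smul, dotProduct_smul, h1, h2, dotProduct_hopMatrix,
    dotProduct_hopMatrix, hswap i (i - 1) (fun x _ => f x ^ 2),
    hswap i (i - 1) (fun x y => f x * f y)]
  have hm : moveForm n A B i a f = ∑ x, ∑ y, if hop n A B (i - 1) i x y
      then (f y - a * f x) ^ 2 else 0 :=
    Finset.sum_congr rfl fun x _ => Finset.sum_congr rfl fun y _ =>
      if_congr ⟨hop.symm, hop.symm⟩ rfl rfl
  rw [hm]
  simp only [smul_eq_mul, Finset.mul_sum, ← Finset.sum_sub_distrib, ← Finset.sum_add_distrib]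
  refine Finset.sum_congr rfl fun x _ => Finset.sum_congr rfl fun y _ => ?_
  split_ifs <;> ring

theorem stepMatrix_transpose {n M : ℕ} (A B : Fin M) (i : ℕ) (a : ℝ) :
    (stepMatrix n A B i a)ᵀ = stepMatrix n A B i a := by
  have h : ∀ j k, (hopMatrix n ℝ A B j k)ᵀ = hopMatrix n ℝ A B k j := by
    intro j k
    ext x y
    simp only [Matrix.transpose_apply, hopMatrix, Matrix.of_apply]
    exact if_congr ⟨hop.symm, hop.symm⟩ rfl rfl
  unfold stepMatrix
  simp only [Matrix.transpose_add, Matrix.transpose_sub, Matrix.transpose_smul, h]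
  abel

open Classical in
/-- The quadratic form of the gates. -/
noncomputable def gatesForm (n : ℕ) {M : ℕ} (lam : Fin M → ℝ) (f : Pos M n → ℝ) : ℝ :=
  ∑ g : GateLabel M n, if IsGate n g.1 g.2.1 g.2.2 then
    moveForm n g.1 g.2.1 g.2.2 (gateCoef lam g.1 g.2.1 g.2.2) f else 0

theorem sum_mulVec' {X ι : Type*} [Fintype X] (s : Finset ι) (F : ι → Matrix X X ℝ) (f : X → ℝ) :
    (∑ i ∈ s, F i) *ᵥ f = ∑ i ∈ s, F i *ᵥ f := by
  classical
  induction s using Finset.induction_on with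
  | empty => simp
  | insert i s hi ih => rw [Finset.sum_insert hi, Finset.sum_insert hi, Matrix.add_mulVec, ih]

theorem dotProduct_posH {n M : ℕ} (lam : Fin M → ℝ) (f : Pos M n → ℝ) :
    f ⬝ᵥ posH n lam *ᵥ f = (∑ x, potential lam x * f x ^ 2) + gatesForm n lam f := by
  classical
  rw [posH, Matrix.add_mulVec, dotProduct_add, sum_mulVec', dotProduct_sum]
  congr 1
  · simp only [dotProduct, Matrix.mulVec_diagonal]
    exact Finset.sum_congr rfl fun x _ => by ring
  · refine Finset.sum_congr rfl fun g _ => ?_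
    split_ifs with hg
    · exact hg.dotProduct_stepMatrix _ f
    · simp

theorem posH_transpose {n M : ℕ} (lam : Fin M → ℝ) : (posH n lam)ᵀ = posH n lam := by
  classical
  rw [posH, Matrix.transpose_add, Matrix.diagonal_transpose, Matrix.transpose_sum]
  congr 1
  refine Finset.sum_congr rfl fun g _ => ?_
  split_ifs
  · exact stepMatrix_transpose _ _ _ _
  · simp

/-- The position matrix without the first gate on the qubit `A`. -/
noncomputable def posR (n : ℕ) {M : ℕ} (lam : Fin M → ℝ) (A : Fin M) :
    Matrix (Pos M n) (Pos M n) ℝ :=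
  posH n lam - stepMatrix n A A (firstStep A) (lam A)

theorem reducedH_eq {M n : ℕ} [NeZero M] (ℰ l : ℝ) :
    reducedH M n ℰ l = withInit ℰ (posR n (lam l) (activeQubit M l)) := by
  rw [reducedH, H_identity_eq, hOne_eq, withInit, withInit, posR, smul_sub, tensOne_sub]
  abel

theorem posR_transpose {n M : ℕ} (lam : Fin M → ℝ) (A : Fin M) :
    (posR n lam A)ᵀ = posR n lam A := by
  rw [posR, Matrix.transpose_sub, posH_transpose, stepMatrix_transpose]

theorem isGate_firstStep {M : ℕ} (n : ℕ) (A : Fin M) : IsGate n A A (firstStep A) :=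
  Or.inl ⟨rfl, isOneQubitGate_firstStep n A⟩

theorem dotProduct_posR {n M : ℕ} (lam : Fin M → ℝ) (A : Fin M) (f : Pos M n → ℝ) :
    f ⬝ᵥ posR n lam A *ᵥ f =
      f ⬝ᵥ posH n lam *ᵥ f - moveForm n A A (firstStep A) (lam A) f := by
  rw [posR, Matrix.sub_mulVec, dotProduct_sub, (isGate_firstStep n A).dotProduct_stepMatrix]

/-! ### Vectors with complex entries and bits -/

/-- The number of qubits at the start with bit value one. -/
noncomputable def initCount {M n : ℕ} (x : Pos M n) (b : Bits M) : ℝ :=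
  ∑ A : Fin M, if (x A : ℕ) = firstStep A - 1 ∧ b A = 1 then 1 else 0

theorem numBit_eq_diagonal {M n : ℕ} (A : Fin M) (i : ℕ) (b : Fin 2) :
    (numBit A i b : Op M n) = Matrix.diagonal fun c =>
      if ((c A).1 : ℕ) = i ∧ (c A).2 = b then 1 else 0 := by
  ext c d
  simp only [numBit, bilin, Matrix.of_apply, Matrix.diagonal_apply, Matrix.single_apply]
  by_cases hcd : c = d
  · subst hcd
    simp only [ne_eq, implies_true, true_and, and_self, if_true, ite_and]
    split_ifs <;> simp_all
  · rw [if_neg hcd]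
    split_ifs with h1 h2
    · refine absurd (funext fun B => ?_) hcd
      by_cases hB : B = A
      · subst hB
        exact Prod.ext (Subtype.ext (h1.2.1.trans h1.2.2.symm)) (h2.1.symm.trans h2.2)
      · exact h1.1 B hB
    · rfl
    · rfl

theorem hInit_mulVec {M n : ℕ} (ℰ : ℝ) (A : Fin M) (v : Conf M n → ℂ) (c : Conf M n) :
    ((hInit ℰ A (firstStep A - 1) : Op M n) *ᵥ v) c =
      (ℰ : ℂ) * ((if ((c A).1 : ℕ) = firstStep A - 1 ∧ (c A).2 = 1 then 1 else 0) * v c) := by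
  rw [hInit, Matrix.smul_mulVec, Pi.smul_apply, smul_eq_mul, numBit_eq_diagonal,
    Matrix.mulVec_diagonal]

theorem withInit_mulVec {M n : ℕ} (ℰ : ℝ) (P : Matrix (Pos M n) (Pos M n) ℝ)
    (v : Conf M n → ℂ) (x : Pos M n) (b : Bits M) :
    (withInit ℰ P *ᵥ v) (conf x b) =
      (ℰ : ℂ) * ((∑ y, (P x y : ℂ) * v (conf y b)) + (initCount x b : ℂ) * v (conf x b)) := by
  have hsum : ∀ (s : Finset (Fin M)) (F : Fin M → Op M n),
      ((∑ A ∈ s, F A) *ᵥ v) (conf x b) = ∑ A ∈ s, (F A *ᵥ v) (conf x b) := by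
    intro s F
    classical
    induction s using Finset.induction_on with
    | empty => simp
    | insert i s hi ih =>
      rw [Finset.sum_insert hi, Finset.sum_insert hi, Matrix.add_mulVec, Pi.add_apply, ih]
  rw [withInit, Matrix.add_mulVec, Pi.add_apply, hsum, mul_add]
  congr 1
  · rw [tensOne_smul, Matrix.smul_mulVec, Pi.smul_apply, smul_eq_mul]
    congr 1
    simp only [Matrix.mulVec, dotProduct]
    rw [sum_conf]
    refine Finset.sum_congr rfl fun y _ => ?_
    rw [Finset.sum_eq_single b]
    · simp [tensOne, tens, Matrix.one_apply]
    · intro b' _ hb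
      simp [tensOne, tens, Matrix.one_apply, hb.symm]
    · simp
  · simp only [hInit_mulVec, initCount]
    rw [← Finset.mul_sum, ← Finset.sum_mul]
    rw [Complex.ofReal_sum]
    congr 2
    refine Finset.sum_congr rfl fun A _ => ?_
    by_cases h : (x A : ℕ) = firstStep A - 1 ∧ b A = 1
    · rw [if_pos h, Complex.ofReal_one]
      exact if_pos h
    · rw [if_neg h, Complex.ofReal_zero]
      exact if_neg h

theorem re_star_dotProduct {M n : ℕ} (v w : Conf M n → ℂ) :
    (star v ⬝ᵥ w).re = ∑ b : Bits M,
      ((∑ x, (v (conf x b)).re * (w (conf x b)).re) +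
        ∑ x, (v (conf x b)).im * (w (conf x b)).im) := by
  rw [dotProduct, sum_conf, Finset.sum_comm, Complex.re_sum]
  refine Finset.sum_congr rfl fun b _ => ?_
  rw [Complex.re_sum, ← Finset.sum_add_distrib]
  refine Finset.sum_congr rfl fun x _ => ?_
  simp [Complex.mul_re]

/-- The quadratic form of `P` with the input term for the bits `b`. -/
noncomputable def blockForm {M n : ℕ} (P : Matrix (Pos M n) (Pos M n) ℝ) (b : Bits M)
    (f : Pos M n → ℝ) : ℝ :=
  f ⬝ᵥ P *ᵥ f + ∑ x, initCount x b * f x ^ 2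

/-- P is real and trivial on bits, and the input terms are diagonal. The form therefore splits over
bit strings and over real and imaginary parts, so all later estimates concern real functions on
positions. -/
theorem re_star_dotProduct_withInit {M n : ℕ} (ℰ : ℝ) (P : Matrix (Pos M n) (Pos M n) ℝ)
    (v : Conf M n → ℂ) :
    (star v ⬝ᵥ withInit ℰ P *ᵥ v).re = ℰ * ∑ b : Bits M,
      (blockForm P b (fun x => (v (conf x b)).re) + blockForm P b fun x => (v (conf x b)).im) := by
  rw [re_star_dotProduct, Finset.mul_sum]
  refine Finset.sum_congr rfl fun b _ => ?_
  have hre : ∀ x, ((withInit ℰ P *ᵥ v) (conf x b)).re =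
      ℰ * ((P *ᵥ fun x => (v (conf x b)).re) x + initCount x b * (v (conf x b)).re) := by
    intro x
    rw [withInit_mulVec, Complex.re_ofReal_mul, Complex.add_re, Complex.re_sum,
      Complex.re_ofReal_mul]
    simp only [Complex.re_ofReal_mul]
    rfl
  have him : ∀ x, ((withInit ℰ P *ᵥ v) (conf x b)).im =
      ℰ * ((P *ᵥ fun x => (v (conf x b)).im) x + initCount x b * (v (conf x b)).im) := by
    intro x
    rw [withInit_mulVec, Complex.im_ofReal_mul, Complex.add_im, Complex.im_sum,
      Complex.im_ofReal_mul]
    simp only [Complex.im_ofReal_mul]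
    rfl
  simp only [hre, him, blockForm, dotProduct, mul_add, Finset.mul_sum, ← Finset.sum_add_distrib]
  exact Finset.sum_congr rfl fun x _ => by ring

theorem withInit_isHermitian {M n : ℕ} (ℰ : ℝ) {P : Matrix (Pos M n) (Pos M n) ℝ}
    (hP : Pᵀ = P) : (withInit ℰ P : Op M n).IsHermitian := by
  have h1 : ∀ A : Fin M, ((hInit ℰ A (firstStep A - 1) : Op M n))ᴴ =
      hInit ℰ A (firstStep A - 1) := by
    intro A
    ext c d
    simp only [hInit, numBit, bilin, Matrix.conjTranspose_apply, Matrix.smul_apply,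
      Matrix.of_apply, Matrix.single_apply, star_smul]
    have h : ((∀ B, B ≠ A → d B = c B) ∧ ((d A).1 : ℕ) = firstStep A - 1 ∧
        ((c A).1 : ℕ) = firstStep A - 1) ↔ ((∀ B, B ≠ A → c B = d B) ∧
        ((c A).1 : ℕ) = firstStep A - 1 ∧ ((d A).1 : ℕ) = firstStep A - 1) :=
      ⟨fun h => ⟨fun B hB => (h.1 B hB).symm, h.2.2, h.2.1⟩,
        fun h => ⟨fun B hB => (h.1 B hB).symm, h.2.2, h.2.1⟩⟩
    rw [if_congr h rfl rfl, if_congr (and_comm (a := 1 = (d A).2)) rfl rfl]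
    split_ifs <;> simp
  have h2 : (tensOne (ℰ • P) : Op M n)ᴴ = tensOne (ℰ • P) := by
    ext c d
    have hs : P (pos d) (pos c) = P (pos c) (pos d) := congrFun (congrFun hP (pos c)) (pos d)
    simp only [tensOne, tens, Matrix.conjTranspose_apply, Matrix.of_apply, Matrix.map_apply,
      Matrix.smul_apply, smul_eq_mul, Matrix.one_apply, hs]
    rw [if_congr (eq_comm (a := bits d)) rfl rfl]
    split_ifs <;> simp
  unfold Matrix.IsHermitian withInit
  rw [Matrix.conjTranspose_add, Matrix.conjTranspose_sum, h2]
  simp only [h1]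

/-! ### Legal positions -/

/-- No qubit of a two-qubit gate has passed the gate without the other one. -/
def Legal (n : ℕ) {M : ℕ} (x : Pos M n) : Prop :=
  ∀ (A B : Fin M) (i : ℕ), IsTwoQubitGate n A B i → ((x A : ℕ) < i ↔ (x B : ℕ) < i)

theorem not_violates_iff {M n : ℕ} (x : Pos M n) (A B : Fin M) (i : ℕ) :
    ¬ violates x A B i ↔ ((x A : ℕ) < i ↔ (x B : ℕ) < i) := by
  unfold violates
  omega

/-- The first gate on the qubit `C`. -/
def IsFirstGate {M n : ℕ} (g : GateLabel M n) (C : Fin M) : Prop :=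
  g.1 = C ∧ g.2.1 = C ∧ (g.2.2 : ℕ) = firstStep C

theorem GateMove.pos {M n : ℕ} {g : GateLabel M n} {x y : Pos M n} (h : GateMove n g x y) :
    1 ≤ (g.2.2 : ℕ) :=
  (firstStep_pos g.1).trans (h.1.firstStep_le (Or.inl rfl))

theorem GateMove.eq_of_not_mem {M n : ℕ} {g : GateLabel M n} {x y : Pos M n}
    (h : GateMove n g x y) {D : Fin M} (hD : ¬ (D = g.1 ∨ D = g.2.1)) : x D = y D := by
  push Not at hD
  exact (h.2.1 D hD.1 hD.2).symm

theorem GateMove.val_of_mem {M n : ℕ} {g : GateLabel M n} {x y : Pos M n}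
    (h : GateMove n g x y) {D : Fin M} (hD : D = g.1 ∨ D = g.2.1) :
    (x D : ℕ) = g.2.2 - 1 ∧ (y D : ℕ) = g.2.2 := by
  rcases hD with rfl | rfl
  · exact ⟨h.2.2.2.2.1, h.2.2.1⟩
  · exact ⟨h.2.2.2.2.2, h.2.2.2.1⟩

/-- A move carries both qubits of its own gate across together, and crosses no other gate. -/
theorem GateMove.legal_iff {M n : ℕ} {g : GateLabel M n} {x y : Pos M n}
    (h : GateMove n g x y) : Legal n x ↔ Legal n y := by
  have hpos := h.pos
  refine forall_congr' fun A => forall_congr' fun B => forall_congr' fun i =>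
    imp_congr_right fun hi => ?_
  by_cases hsame : i = g.2.2 ∧ ∃ D, (D = A ∨ D = B) ∧ (D = g.1 ∨ D = g.2.1)
  · obtain ⟨rfl, D, hD, hDg⟩ := hsame
    obtain ⟨rfl, rfl⟩ := IsGate.unique (Or.inr hi) h.1 hD hDg
    have h1 := h.val_of_mem (Or.inl rfl)
    have h2 := h.val_of_mem (Or.inr rfl)
    simp [h1.1, h1.2, h2.1, h2.2]
  · have key : ∀ D, D = A ∨ D = B → ((x D : ℕ) < i ↔ (y D : ℕ) < i) := by
      intro D hD
      by_cases hDg : D = g.1 ∨ D = g.2.1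
      · have h1 := h.val_of_mem hDg
        have h2 : i ≠ g.2.2 := fun h2 => hsame ⟨h2, D, hD, hDg⟩
        omega
      · rw [h.eq_of_not_mem hDg]
    rw [key A (Or.inl rfl), key B (Or.inr rfl)]

theorem GateMove.start_iff {M n : ℕ} {g : GateLabel M n} {x y : Pos M n}
    (h : GateMove n g x y) {C : Fin M} (hC : ¬ IsFirstGate g C) :
    (x C : ℕ) = firstStep C - 1 ↔ (y C : ℕ) = firstStep C - 1 := by
  by_cases hCg : C = g.1 ∨ C = g.2.1
  · have h1 := h.val_of_mem hCg
    have h2 := h.pos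
    have h3 := h.1.firstStep_le hCg
    have h4 : (g.2.2 : ℕ) ≠ firstStep C := by
      intro h4
      rcases h.1 with ⟨h5, -⟩ | h5
      · rcases hCg with rfl | rfl
        · exact hC ⟨rfl, h5.symm, h4⟩
        · exact hC ⟨h5, rfl, h4⟩
      · have := h5.four_le
        have := firstStep_le_three C
        omega
    have h5 := firstStep_pos C
    omega
  · rw [h.eq_of_not_mem hCg]

/-- Legal positions at which all qubits after `A` are at the start. -/
def Active (n : ℕ) {M : ℕ} (A : Fin M) (x : Pos M n) : Prop :=
  Legal n x ∧ ∀ B, A < B → (x B : ℕ) = firstStep B - 1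

open Classical in
/-- The active positions at which `A` is at the start. -/
noncomputable def startSet (n : ℕ) {M : ℕ} (A : Fin M) : Finset (Pos M n) :=
  Finset.univ.filter fun x => Active n A x ∧ (x A : ℕ) = firstStep A - 1

open Classical in
/-- The active positions at which `A` has left the start. -/
noncomputable def movedSet (n : ℕ) {M : ℕ} (A : Fin M) : Finset (Pos M n) :=
  Finset.univ.filter fun x => Active n A x ∧ (x A : ℕ) ≠ firstStep A - 1

open Classical in
/-- The indicator function of a finite set. -/
noncomputable def ind {X : Type*} (S : Finset X) (x : X) : ℝ := if x ∈ S then 1 else 0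

theorem ind_of_mem {X : Type*} {S : Finset X} {x : X} (h : x ∈ S) : ind S x = 1 := if_pos h

theorem ind_of_notMem {X : Type*} {S : Finset X} {x : X} (h : x ∉ S) : ind S x = 0 := if_neg h

theorem ind_congr {X : Type*} {S : Finset X} {x y : X} (h : x ∈ S ↔ y ∈ S) :
    ind S x = ind S y := by
  by_cases hx : x ∈ S
  · rw [ind_of_mem hx, ind_of_mem (h.1 hx)]
  · rw [ind_of_notMem hx, ind_of_notMem (h.not.1 hx)]

theorem mem_startSet {M n : ℕ} {A : Fin M} {x : Pos M n} :
    x ∈ startSet n A ↔ Active n A x ∧ (x A : ℕ) = firstStep A - 1 := by simp [startSet]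

theorem mem_movedSet {M n : ℕ} {A : Fin M} {x : Pos M n} :
    x ∈ movedSet n A ↔ Active n A x ∧ (x A : ℕ) ≠ firstStep A - 1 := by simp [movedSet]

/-- The parameters while the qubit `A` is being switched on. -/
structure IsStage {M : ℕ} (lam : Fin M → ℝ) (A : Fin M) : Prop where
  before : ∀ B, B < A → lam B = 1
  after : ∀ B, A < B → lam B = 0
  nonneg : 0 ≤ lam A
  le_one : lam A ≤ 1
  lt_or_last : lam A < 1 ∨ A.val + 1 = M

theorem IsStage.mem_Icc {M : ℕ} {lam : Fin M → ℝ} {A : Fin M} (h : IsStage lam A) (B : Fin M) :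
    0 ≤ lam B ∧ lam B ≤ 1 := by
  rcases lt_trichotomy B A with hB | rfl | hB
  · simp [h.before B hB]
  · exact ⟨h.nonneg, h.le_one⟩
  · simp [h.after B hB]

theorem gateCoef_eq_one {M n : ℕ} (lam : Fin M → ℝ) {g : GateLabel M n}
    (h : ∀ C, ¬ IsFirstGate g C) : gateCoef lam g.1 g.2.1 g.2.2 = 1 :=
  if_neg fun h' => h g.1 ⟨rfl, h'.1.symm, h'.2⟩

theorem gateCoef_eq {M n : ℕ} (lam : Fin M → ℝ) {g : GateLabel M n} {C : Fin M}
    (h : IsFirstGate g C) : gateCoef lam g.1 g.2.1 g.2.2 = lam C := by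
  obtain ⟨h1, h2, h3⟩ := h
  rw [h1, h2, h3]
  exact if_pos ⟨rfl, rfl⟩

theorem IsFirstGate.unique {M n : ℕ} {g : GateLabel M n} {C D : Fin M}
    (h : IsFirstGate g C) (h' : IsFirstGate g D) : C = D := h.1.symm.trans h'.1

theorem GateMove.firstGate_val {M n : ℕ} {g : GateLabel M n} {x y : Pos M n}
    (h : GateMove n g x y) {C : Fin M} (hC : IsFirstGate g C) :
    (x C : ℕ) = firstStep C - 1 ∧ (y C : ℕ) = firstStep C := by
  have := h.val_of_mem (Or.inl hC.1.symm)
  rwa [hC.2.2] at this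

theorem GateMove.active_iff {M n : ℕ} {g : GateLabel M n} {x y : Pos M n}
    (h : GateMove n g x y) {A : Fin M} (hA : ∀ C, A < C → ¬ IsFirstGate g C) :
    Active n A x ↔ Active n A y :=
  and_congr h.legal_iff (forall_congr' fun C => imp_congr_right fun hC => h.start_iff (hA C hC))

theorem GateMove.not_active {M n : ℕ} {g : GateLabel M n} {x y : Pos M n}
    (h : GateMove n g x y) {A C : Fin M} (hAC : A < C) (hC : IsFirstGate g C) :
    ¬ Active n A y := by
  intro hy
  have h1 := hy.2 C hAC
  have h2 := (h.firstGate_val hC).2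
  have := firstStep_pos C
  omega

/-- Only first gates can have a coefficient other than one. Those before A have λ = 1, and those
after A lead out of the active positions. -/
theorem GateMove.coef_of_active {M n : ℕ} {g : GateLabel M n} {x y : Pos M n}
    (h : GateMove n g x y) {lam : Fin M → ℝ} {A : Fin M} (hs : IsStage lam A)
    (hA : ¬ IsFirstGate g A) (hy : Active n A y) : gateCoef lam g.1 g.2.1 g.2.2 = 1 := by
  by_cases hC : ∃ C, IsFirstGate g C
  · obtain ⟨C, hC⟩ := hC
    rw [gateCoef_eq lam hC]
    rcases lt_trichotomy C A with hlt | rfl | hlt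
    · exact hs.before C hlt
    · exact absurd hC hA
    · exact absurd hy (h.not_active hlt hC)
  · exact gateCoef_eq_one lam (not_exists.1 hC)

/-- Functions on the active positions that only depend on whether `A` has left the start. -/
theorem GateMove.ind_eq {M n : ℕ} {g : GateLabel M n} {x y : Pos M n}
    (h : GateMove n g x y) {lam : Fin M → ℝ} {A : Fin M} (hs : IsStage lam A)
    (hA : ¬ IsFirstGate g A) :
    ind (startSet n A) y = gateCoef lam g.1 g.2.1 g.2.2 * ind (startSet n A) x ∧
    ind (movedSet n A) y = gateCoef lam g.1 g.2.1 g.2.2 * ind (movedSet n A) x := by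
  have hmem : ∀ z, ¬ Active n A z → ind (startSet n A) z = 0 ∧ ind (movedSet n A) z = 0 := fun z hz =>
    
    ⟨ind_of_notMem fun h => hz (mem_startSet.1 h).1,
      ind_of_notMem fun h => hz (mem_movedSet.1 h).1⟩
  by_cases hC : ∃ C, A < C ∧ IsFirstGate g C
  · obtain ⟨C, hlt, hC⟩ := hC
    rw [gateCoef_eq lam hC, hs.after C hlt, (hmem y (h.not_active hlt hC)).1,
      (hmem y (h.not_active hlt hC)).2]
    simp
  · push Not at hC
    have h1 := h.active_iff hC
    by_cases hy : Active n A y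
    · rw [h.coef_of_active hs hA hy, one_mul, one_mul]
      refine ⟨ind_congr ?_, ind_congr ?_⟩
      · rw [mem_startSet, mem_startSet]
        exact (and_congr h1 (h.start_iff hA)).symm
      · rw [mem_movedSet, mem_movedSet]
        exact (and_congr h1 (h.start_iff hA).not).symm
    · rw [(hmem y hy).1, (hmem y hy).2, (hmem x (h1.not.2 hy)).1, (hmem x (h1.not.2 hy)).2]
      simp

/-! ### The potential -/

theorem potential_nonneg {M n : ℕ} {lam : Fin M → ℝ} (h : ∀ B, 0 ≤ lam B ∧ lam B ≤ 1)
    (x : Pos M n) : 0 ≤ potential lam x := by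
  refine add_nonneg (Finset.sum_nonneg fun B _ => Finset.sum_nonneg fun A _ => ?_)
    (Finset.sum_nonneg fun i _ => Finset.sum_nonneg fun A _ => Finset.sum_nonneg fun B _ => ?_)
  · have : lam B ^ 3 ≤ 1 := pow_le_one₀ (h B).1 (h B).2
    split_ifs <;> linarith
  · split_ifs <;> norm_num

theorem one_le_potential {M n : ℕ} {lam : Fin M → ℝ} (h : ∀ B, 0 ≤ lam B ∧ lam B ≤ 1)
    {x : Pos M n} (hx : ¬ Legal n x) : 1 ≤ potential lam x := by
  unfold Legal at hx
  push Not at hx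
  obtain ⟨A, B, i, hi, hv⟩ := hx
  have hv' : violates x A B i := by
    by_contra h'
    rw [not_violates_iff] at h'
    omega
  have hmem : i ∈ Finset.Icc 1 (depth M n) := by
    have := hi.four_le
    have := hi.le_depth
    rw [Finset.mem_Icc]
    omega
  have h1 : (1 : ℝ) ≤ ∑ i ∈ Finset.Icc 1 (depth M n), ∑ A : Fin M, ∑ B : Fin M,
      if IsTwoQubitGate n A B i ∧ violates x A B i then 1 else 0 := by
    have hnn : ∀ (i : ℕ) (A B : Fin M),
        (0 : ℝ) ≤ if IsTwoQubitGate n A B i ∧ violates x A B i then 1 else 0 := by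
      intro i A B
      split_ifs <;> norm_num
    refine le_trans ?_ (Finset.single_le_sum (fun i _ => Finset.sum_nonneg fun A _ =>
      Finset.sum_nonneg fun B _ => hnn i A B) hmem)
    refine le_trans ?_ (Finset.single_le_sum (fun A _ =>
      Finset.sum_nonneg fun B _ => hnn i A B) (Finset.mem_univ A))
    refine le_trans ?_ (Finset.single_le_sum (fun B _ => hnn i A B) (Finset.mem_univ B))
    rw [if_pos ⟨hi, hv'⟩]
  have h2 : (0 : ℝ) ≤ ∑ B : Fin M, ∑ A : Fin M, if A.val = B.val + 1 ∧ firstStep A ≤ (x A : ℕ)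
      then 1 - lam B ^ 3 else 0 := by
    refine Finset.sum_nonneg fun B _ => Finset.sum_nonneg fun A _ => ?_
    have : lam B ^ 3 ≤ 1 := pow_le_one₀ (h B).1 (h B).2
    split_ifs <;> linarith
  unfold potential
  linarith

theorem potential_of_legal {M n : ℕ} (lam : Fin M → ℝ) {x : Pos M n} (hx : Legal n x) :
    potential lam x = ∑ B : Fin M, ∑ A : Fin M,
      if A.val = B.val + 1 ∧ firstStep A ≤ (x A : ℕ) then 1 - lam B ^ 3 else 0 := by
  unfold potential
  rw [add_eq_left]
  refine Finset.sum_eq_zero fun i _ => Finset.sum_eq_zero fun A _ =>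
    Finset.sum_eq_zero fun B _ => if_neg fun h => ?_
  exact (not_violates_iff x A B i).2 (hx A B i h.1) h.2

/-- Legality removes the penalties. A qubit that has left its start is A or earlier, so its
predecessor already has λ = 1. -/
theorem IsStage.potential_eq_zero {M n : ℕ} {lam : Fin M → ℝ} {A : Fin M} (hs : IsStage lam A)
    {x : Pos M n} (hx : Active n A x) : potential lam x = 0 := by
  rw [potential_of_legal lam hx.1]
  refine Finset.sum_eq_zero fun B _ => Finset.sum_eq_zero fun C _ => ?_
  split_ifs with h
  · have hlt : B < A := by
      by_contra hBA
      have h1 : A < C := Fin.lt_def.2 (by rw [h.1]; exact Nat.lt_succ_of_le (not_lt.1 hBA))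
      have := hx.2 C h1
      have := firstStep_pos C
      omega
    rw [hs.before B hlt]
    norm_num
  · rfl

/-- An inactive position is either illegal and pays a penalty, or has a qubit C beyond A away from
its start, whose predecessor still has λ < 1. -/
theorem IsStage.potential_pos {M n : ℕ} {lam : Fin M → ℝ} {A : Fin M} (hs : IsStage lam A)
    {x : Pos M n} (hx : ¬ Active n A x) : 0 < potential lam x := by
  by_cases hl : Legal n x
  swap
  · exact lt_of_lt_of_le one_pos (one_le_potential hs.mem_Icc hl)
  have hC : ∃ C, A < C ∧ (x C : ℕ) ≠ firstStep C - 1 := by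
    by_contra h
    push Not at h
    exact hx ⟨hl, h⟩
  obtain ⟨C, hAC, hC⟩ := hC
  have hCM := C.2
  have hACv : A.val < C.val := hAC
  rw [potential_of_legal lam hl]
  have hnn : ∀ B C : Fin M, 0 ≤ if C.val = B.val + 1 ∧ firstStep C ≤ (x C : ℕ)
      then 1 - lam B ^ 3 else 0 := by
    intro B C
    have : lam B ^ 3 ≤ 1 := pow_le_one₀ (hs.mem_Icc B).1 (hs.mem_Icc B).2
    split_ifs <;> linarith
  let B : Fin M := ⟨C.val - 1, by omega⟩
  refine lt_of_lt_of_le ?_ (Finset.single_le_sum (fun B _ => Finset.sum_nonneg fun C _ => hnn B C)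
    (Finset.mem_univ B))
  refine lt_of_lt_of_le ?_ (Finset.single_le_sum (fun C _ => hnn B C) (Finset.mem_univ C))
  have h1 := x.start_le C
  rw [if_pos ⟨by simp only [B]; omega, by omega⟩]
  -- If B = A, then A is followed by C and is not the last qubit, so `lt_or_last` leaves only λ_A <
  -- 1.
  have hlt : lam B < 1 := by
    rcases (show A ≤ B from Fin.le_def.2 (by simp only [B]; omega)).eq_or_lt with h | h
    · rcases hs.lt_or_last with h2 | h2
      · rwa [← h]
      · omega
    · rw [hs.after B h]
      norm_num
  have : lam B ^ 3 < 1 := pow_lt_one₀ (hs.mem_Icc B).1 hlt (by norm_num)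
  linarith

/-! ### The kernel -/

theorem moveForm_nonneg {M n : ℕ} (A B : Fin M) (i : ℕ) (a : ℝ) (f : Pos M n → ℝ) :
    0 ≤ moveForm n A B i a f := by
  refine Finset.sum_nonneg fun x _ => Finset.sum_nonneg fun y _ => ?_
  split_ifs
  · exact sq_nonneg _
  · exact le_rfl

theorem moveForm_eq_zero_iff {M n : ℕ} (A B : Fin M) (i : ℕ) (a : ℝ) (f : Pos M n → ℝ) :
    moveForm n A B i a f = 0 ↔ ∀ x y, hop n A B i (i - 1) y x → f y = a * f x := by
  have hnn : ∀ x y : Pos M n, 0 ≤ if hop n A B i (i - 1) y x then (f y - a * f x) ^ 2 else 0 := by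
    intro x y
    split_ifs
    · exact sq_nonneg _
    · exact le_rfl
  unfold moveForm
  rw [Finset.sum_eq_zero_iff_of_nonneg fun x _ => Finset.sum_nonneg fun y _ => hnn x y]
  refine ⟨fun h x y hxy => ?_, fun h x _ => Finset.sum_eq_zero fun y _ => ?_⟩
  · have h1 := (Finset.sum_eq_zero_iff_of_nonneg fun y _ => hnn x y).1 (h x (Finset.mem_univ x)) y
      (Finset.mem_univ y)
    rw [if_pos hxy] at h1
    linarith [pow_eq_zero_iff (two_ne_zero) |>.1 h1]
  · split_ifs with hxy
    · rw [h x y hxy]; ring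
    · rfl

open Classical in
theorem dotProduct_posR_eq {M n : ℕ} (lam : Fin M → ℝ) (A : Fin M) (f : Pos M n → ℝ) :
    f ⬝ᵥ posR n lam A *ᵥ f = (∑ x, potential lam x * f x ^ 2) +
      ∑ g : GateLabel M n, if IsGate n g.1 g.2.1 g.2.2 ∧ ¬ IsFirstGate g A then
        moveForm n g.1 g.2.1 g.2.2 (gateCoef lam g.1 g.2.1 g.2.2) f else 0 := by
  rw [dotProduct_posR, dotProduct_posH, gatesForm, add_sub_assoc]
  congr 1
  let g₀ : GateLabel M n := (A, A, ⟨firstStep A, Nat.lt_succ_of_le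
    ((firstStep_lt_lastStep n A).trans (lastStep_le_depth n A))⟩)
  have h0 : ∀ g : GateLabel M n, IsFirstGate g A ↔ g = g₀ := fun g =>
    ⟨fun h => Prod.ext h.1 (Prod.ext h.2.1 (Fin.ext h.2.2)), fun h => by subst h; exact ⟨rfl, rfl, rfl⟩⟩
  simp only [h0]
  rw [← Finset.add_sum_erase _ _ (Finset.mem_univ g₀),
    ← Finset.add_sum_erase (Finset.univ) (fun g : GateLabel M n =>
      if IsGate n g.1 g.2.1 g.2.2 ∧ ¬ g = g₀ then
        moveForm n g.1 g.2.1 g.2.2 (gateCoef lam g.1 g.2.1 g.2.2) f else 0) (Finset.mem_univ g₀)]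
  have h1 : gateCoef lam g₀.1 g₀.2.1 g₀.2.2 = lam A := gateCoef_eq lam ⟨rfl, rfl, rfl⟩
  rw [if_pos (isGate_firstStep n A), h1, if_neg (fun h => h.2 rfl), zero_add]
  have h2 : moveForm n g₀.1 g₀.2.1 g₀.2.2 (lam A) f = moveForm n A A (firstStep A) (lam A) f := rfl
  rw [h2, add_sub_cancel_left]
  refine Finset.sum_congr rfl fun g hg => ?_
  simp [(Finset.mem_erase.1 hg).1]

theorem dotProduct_posR_nonneg {M n : ℕ} {lam : Fin M → ℝ} (h : ∀ B, 0 ≤ lam B ∧ lam B ≤ 1)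
    (A : Fin M) (f : Pos M n → ℝ) : 0 ≤ f ⬝ᵥ posR n lam A *ᵥ f := by
  rw [dotProduct_posR_eq]
  refine add_nonneg (Finset.sum_nonneg fun x _ =>
    mul_nonneg (potential_nonneg h x) (sq_nonneg _)) (Finset.sum_nonneg fun g _ => ?_)
  split_ifs
  · exact moveForm_nonneg _ _ _ _ _
  · exact le_rfl

/-- The kernel of the quadratic form: the amplitudes follow the moves and vanish where the
potential does not. -/
theorem dotProduct_posR_eq_zero_iff {M n : ℕ} {lam : Fin M → ℝ}
    (h : ∀ B, 0 ≤ lam B ∧ lam B ≤ 1) (A : Fin M) (f : Pos M n → ℝ) :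
    f ⬝ᵥ posR n lam A *ᵥ f = 0 ↔ (∀ x, potential lam x * f x ^ 2 = 0) ∧
      ∀ g x y, GateMove n g x y → ¬ IsFirstGate g A →
        f y = gateCoef lam g.1 g.2.1 g.2.2 * f x := by
  classical
  have h1 : ∀ x, 0 ≤ potential lam x * f x ^ 2 := fun x =>
    mul_nonneg (potential_nonneg h x) (sq_nonneg _)
  have h2 : ∀ g : GateLabel M n, 0 ≤ if IsGate n g.1 g.2.1 g.2.2 ∧ ¬ IsFirstGate g A then
        moveForm n g.1 g.2.1 g.2.2 (gateCoef lam g.1 g.2.1 g.2.2) f else 0 := by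
    intro g
    split_ifs
    · exact moveForm_nonneg _ _ _ _ _
    · exact le_rfl
  rw [dotProduct_posR_eq, add_eq_zero_iff_of_nonneg (Finset.sum_nonneg fun x _ => h1 x)
    (Finset.sum_nonneg fun g _ => h2 g), Finset.sum_eq_zero_iff_of_nonneg fun x _ => h1 x,
    Finset.sum_eq_zero_iff_of_nonneg fun g _ => h2 g]
  refine and_congr ⟨fun h x => h x (Finset.mem_univ x), fun h x _ => h x⟩
    ⟨fun h g x y hg hA => ?_, fun h g _ => ?_⟩
  · have h3 := h g (Finset.mem_univ g)
    rw [if_pos ⟨hg.1, hA⟩, moveForm_eq_zero_iff] at h3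
    exact h3 x y hg.2
  · split_ifs with hg
    · exact (moveForm_eq_zero_iff _ _ _ _ _).2 fun x y hxy => h g x y ⟨hg.1, hxy⟩ hg.2
    · rfl

/-! ### Every active position can be moved down to a lowest one -/

open Classical in
/-- The lowest active position: `A` is at its first step if `b` holds, and all other qubits are
at the start. -/
noncomputable def floorPos (n : ℕ) {M : ℕ} (A : Fin M) (b : Prop) : Pos M n := fun D =>
  if D = A ∧ b then ⟨firstStep D, (isGate_firstStep n D).mem (Or.inl rfl)⟩
  else ⟨firstStep D - 1, (isGate_firstStep n D).pred_mem (Or.inl rfl)⟩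

theorem floorPos_le {M n : ℕ} {A : Fin M} (x : Pos M n) (D : Fin M) :
    (floorPos n A ((x A : ℕ) ≠ firstStep A - 1) D : ℕ) ≤ x D := by
  have h := x.start_le D
  unfold floorPos
  split_ifs with h1
  · obtain ⟨rfl, h2⟩ := h1
    simp only
    omega
  · exact h

/-- Among the qubits above the floor, undo the gate at the one with the largest time step. If this
gate has a partner, legality puts the partner at or beyond the gate and maximality puts it at or
before, so both stand exactly at the gate. -/
theorem exists_move_down {M n : ℕ} {A : Fin M} {x : Pos M n} (hx : Active n A x)
    (hne : x ≠ floorPos n A ((x A : ℕ) ≠ firstStep A - 1)) :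
    ∃ g y, GateMove n g y x ∧ ∀ C, A ≤ C → ¬ IsFirstGate g C := by
  classical
  set z := floorPos n A ((x A : ℕ) ≠ firstStep A - 1) with hz
  let S : Finset (Fin M) := Finset.univ.filter fun D => D ≤ A ∧ (z D : ℕ) < x D
  have hzC : ∀ C, A < C → (z C : ℕ) = firstStep C - 1 := by
    intro C hC
    rw [hz, floorPos, if_neg fun h => hC.ne' h.1]
  have hS : S.Nonempty := by
    obtain ⟨D, hD⟩ := Function.ne_iff.1 hne
    refine ⟨D, Finset.mem_filter.2 ⟨Finset.mem_univ _, ?_, ?_⟩⟩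
    · by_contra hlt
      refine hD (Subtype.ext ?_)
      rw [hx.2 D (not_le.1 hlt), hzC D (not_le.1 hlt)]
    · exact lt_of_le_of_ne (floorPos_le x D) fun h => hD (Subtype.ext h.symm)
  obtain ⟨D, hDS, hmax⟩ := S.exists_max_image (fun D => (x D : ℕ)) hS
  obtain ⟨-, hDA, hDz⟩ := Finset.mem_filter.1 hDS
  have hzs : ∀ D, firstStep D - 1 ≤ (z D : ℕ) := fun D => z.start_le D
  have hz3 : ∀ D, (z D : ℕ) ≤ firstStep D := by
    intro D
    rw [hz, floorPos]
    split_ifs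
    · exact le_rfl
    · exact Nat.sub_le _ _
  set i := (x D : ℕ) with hi
  have hiD : firstStep D ≤ i := by
    have := hzs D
    omega
  have hgen : ∀ P Q : Fin M, IsGate n P Q i → (x P : ℕ) = i → (x Q : ℕ) = i →
      (∀ C, A ≤ C → ¬ (P = C ∧ Q = C ∧ i = firstStep C)) →
      ∃ g y, GateMove n g y x ∧ ∀ C, A ≤ C → ¬ IsFirstGate g C := by
    intro P Q hg hP hQ hf
    have hlt : i < depth M n + 1 := Nat.lt_succ_of_le (x.le_depth D)
    exact ⟨(P, Q, ⟨i, hlt⟩), x.setPair P Q (i - 1) fun D hD => hg.pred_mem hD,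
      ⟨hg, Pos.hop_setPair _ hP hQ⟩, hf⟩
  have htwo : ∀ P Q B : Fin M, IsTwoQubitGate n P Q i → (P = D ∧ Q = B ∨ P = B ∧ Q = D) →
      ∃ g y, GateMove n g y x ∧ ∀ C, A ≤ C → ¬ IsFirstGate g C := by
    intro P Q B hg hPQ
    have h4 := hg.four_le
    have hleg := hx.1 P Q i hg
    have hBi : i ≤ (x B : ℕ) := by
      rcases hPQ with ⟨rfl, rfl⟩ | ⟨rfl, rfl⟩ <;> omega
    -- Later qubits stand at their start, at time at most 2, before any two-qubit gate.
    have hBA : B ≤ A := by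
      by_contra h
      have h1 := hx.2 B (not_le.1 h)
      have := firstStep_le_three B
      omega
    have hBS : B ∈ S := by
      refine Finset.mem_filter.2 ⟨Finset.mem_univ _, hBA, ?_⟩
      have := hz3 B
      have := firstStep_le_three B
      omega
    have hBm := hmax B hBS
    refine hgen P Q (Or.inr hg) ?_ ?_ fun C _ h => hg.ne (h.1.trans h.2.1.symm)
    · rcases hPQ with ⟨rfl, rfl⟩ | ⟨rfl, rfl⟩ <;> omega
    · rcases hPQ with ⟨rfl, rfl⟩ | ⟨rfl, rfl⟩ <;> omega
  by_cases hone : IsOneQubitGate n D i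
  · refine hgen D D (Or.inl ⟨rfl, hone⟩) rfl rfl fun C hC h => ?_
    obtain ⟨rfl, -, h⟩ := h
    obtain rfl := le_antisymm hDA hC
    have hpos := firstStep_pos D
    have hzD : (z D : ℕ) = firstStep D := by
      have hne' : (x D : ℕ) ≠ firstStep D - 1 := by omega
      rw [hz, floorPos, if_pos ⟨rfl, hne'⟩]
    omega
  · have : ∃ B, IsTwoQubitGate n D B i ∨ IsTwoQubitGate n B D i := by
      by_contra h
      push Not at h
      exact hone ⟨hiD, x.le_last D, h⟩
    obtain ⟨B, hB | hB⟩ := this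
    · exact htwo D B B hB (Or.inl ⟨rfl, rfl⟩)
    · exact htwo B D B hB (Or.inr ⟨rfl, rfl⟩)

theorem GateMove.sum_lt {M n : ℕ} {g : GateLabel M n} {x y : Pos M n} (h : GateMove n g x y) :
    ∑ D, (x D : ℕ) < ∑ D, (y D : ℕ) := by
  have hpos := h.pos
  refine Finset.sum_lt_sum (fun D _ => ?_) ⟨g.1, Finset.mem_univ _, ?_⟩
  · by_cases hD : D = g.1 ∨ D = g.2.1
    · have := h.val_of_mem hD
      omega
    · rw [h.eq_of_not_mem hD]
  · have := h.val_of_mem (Or.inl rfl)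
    omega

/-- Moves other than the first gate on A have coefficient one on active positions, so values
propagate unchanged while the sum of all time steps decreases. The proposition given to `floorPos`
does not change along the way. -/
theorem IsStage.eq_floorPos {M n : ℕ} {lam : Fin M → ℝ} {A : Fin M} (hs : IsStage lam A)
    {f : Pos M n → ℝ} (hf : ∀ g x y, GateMove n g x y → ¬ IsFirstGate g A →
      f y = gateCoef lam g.1 g.2.1 g.2.2 * f x) :
    ∀ (k : ℕ) (x : Pos M n), ∑ D, (x D : ℕ) = k → Active n A x →
      f x = f (floorPos n A ((x A : ℕ) ≠ firstStep A - 1)) := by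
  intro k
  induction k using Nat.strong_induction_on with
  | _ k ih =>
    intro x hk hx
    by_cases hne : x = floorPos n A ((x A : ℕ) ≠ firstStep A - 1)
    · exact congrArg f hne
    obtain ⟨g, y, hg, hC⟩ := exists_move_down hx hne
    have hA := hC A le_rfl
    have h1 : Active n A y := (hg.active_iff fun C h => hC C h.le).2 hx
    have h2 := ih _ (hk ▸ hg.sum_lt) y rfl h1
    rw [hf g y x hg hA, hg.coef_of_active hs hA hx, one_mul, h2]
    congr 2
    exact propext (hg.start_iff hA).not

theorem mulVec_eq_zero_of_form {X : Type*} [Fintype X] {P : Matrix X X ℝ} (hP : Pᵀ = P)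
    (hnn : ∀ f, 0 ≤ f ⬝ᵥ P *ᵥ f) {f : X → ℝ} (hf : f ⬝ᵥ P *ᵥ f = 0) : P *ᵥ f = 0 := by
  have hpsd : P.PosSemidef := Matrix.PosSemidef.of_dotProduct_mulVec_nonneg
    (by rw [Matrix.IsHermitian, Matrix.conjTranspose_eq_transpose_of_trivial, hP])
    fun f => by simpa using hnn f
  exact (hpsd.dotProduct_mulVec_zero_iff f).1 (by simpa using hf)

theorem IsStage.posR_mulVec_ind {M n : ℕ} {lam : Fin M → ℝ} {A : Fin M} (hs : IsStage lam A) :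
    posR n lam A *ᵥ ind (startSet n A) = 0 ∧ posR n lam A *ᵥ ind (movedSet n A) = 0 := by
  have hpot : ∀ S : Finset (Pos M n), (∀ x ∈ S, Active n A x) → ∀ x,
      potential lam x * ind S x ^ 2 = 0 := by
    intro S hS x
    by_cases hx : x ∈ S
    · rw [hs.potential_eq_zero (hS x hx), zero_mul]
    · rw [ind_of_notMem hx]; ring
  constructor <;> refine mulVec_eq_zero_of_form (posR_transpose lam A)
    (dotProduct_posR_nonneg hs.mem_Icc A) ((dotProduct_posR_eq_zero_iff hs.mem_Icc A _).2
      ⟨hpot _ fun x hx => ?_, fun g x y hg hA => ?_⟩)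
  · exact (mem_startSet.1 hx).1
  · exact (hg.ind_eq hs hA).1
  · exact (mem_movedSet.1 hx).1
  · exact (hg.ind_eq hs hA).2

/-- Off the active positions the potential is positive and kills f. On them f is constant on each of
the two pieces separated by the removed first gate, so the kernel has no further vectors. -/
theorem IsStage.eq_of_posR_mulVec {M n : ℕ} {lam : Fin M → ℝ} {A : Fin M} (hs : IsStage lam A)
    {f : Pos M n → ℝ} (hf : posR n lam A *ᵥ f = 0) :
    f = f (floorPos n A False) • ind (startSet n A) +
      f (floorPos n A True) • ind (movedSet n A) := by
  obtain ⟨hpot, hmove⟩ := (dotProduct_posR_eq_zero_iff hs.mem_Icc A f).1 (by rw [hf, dotProduct_zero])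
  funext x
  simp only [Pi.add_apply, Pi.smul_apply, smul_eq_mul]
  by_cases hx : Active n A x
  · have h := hs.eq_floorPos hmove _ x rfl hx
    by_cases hxA : (x A : ℕ) = firstStep A - 1
    · rw [ind_of_mem (mem_startSet.2 ⟨hx, hxA⟩), ind_of_notMem fun h => (mem_movedSet.1 h).2 hxA, h]
      simp [hxA]
    · rw [ind_of_mem (mem_movedSet.2 ⟨hx, hxA⟩), ind_of_notMem fun h => hxA (mem_startSet.1 h).2, h]
      simp [hxA]
  · rw [ind_of_notMem fun h => hx (mem_startSet.1 h).1,
      ind_of_notMem fun h => hx (mem_movedSet.1 h).1]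
    have h1 := (mul_eq_zero.1 (hpot x)).resolve_left (hs.potential_pos hx).ne'
    simpa using h1

/-! ### The ground state in the block with all bits zero -/

/-- The amplitudes of the ground state. -/
noncomputable def groundVec (n : ℕ) {M : ℕ} (A : Fin M) (a : ℝ) : Pos M n → ℝ :=
  ind (startSet n A) + a • ind (movedSet n A)

theorem ind_dotProduct {X : Type*} [Fintype X] (S : Finset X) (f : X → ℝ) :
    ind S ⬝ᵥ f = ∑ x ∈ S, f x := by
  classical
  rw [dotProduct, ← Finset.sum_subset (Finset.subset_univ S)]
  · exact Finset.sum_congr rfl fun x hx => by rw [ind_of_mem hx, one_mul]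
  · exact fun x _ hx => by rw [ind_of_notMem hx, zero_mul]

theorem ind_dotProduct_of_subset {X : Type*} [Fintype X] {S T : Finset X} (h : S ⊆ T) :
    ind S ⬝ᵥ ind T = (S.card : ℝ) := by
  rw [ind_dotProduct, Finset.sum_congr rfl fun x hx => ind_of_mem (h hx)]
  simp

theorem ind_dotProduct_of_disjoint {X : Type*} [Fintype X] {S T : Finset X}
    (h : Disjoint S T) : ind S ⬝ᵥ ind T = 0 := by
  rw [ind_dotProduct, Finset.sum_eq_zero fun x hx => ind_of_notMem (Finset.disjoint_left.1 h hx)]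

theorem disjoint_startSet_movedSet {M n : ℕ} (A : Fin M) :
    Disjoint (startSet n A) (movedSet n A) :=
  Finset.disjoint_left.2 fun _ h1 h2 => (mem_movedSet.1 h2).2 (mem_startSet.1 h1).2

theorem groundVec_dotProduct_self {M n : ℕ} (A : Fin M) (a : ℝ) :
    groundVec n A a ⬝ᵥ groundVec n A a =
      (startSet n A).card + a ^ 2 * (movedSet n A).card := by
  simp only [groundVec, add_dotProduct, dotProduct_add, smul_dotProduct, dotProduct_smul,
    ind_dotProduct_of_subset (Finset.Subset.refl _), smul_eq_mul,
    ind_dotProduct_of_disjoint (disjoint_startSet_movedSet A),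
    ind_dotProduct_of_disjoint (disjoint_startSet_movedSet A).symm]
  ring

theorem GateMove.first_mem {M n : ℕ} {g : GateLabel M n} {x y : Pos M n} (h : GateMove n g x y)
    {A : Fin M} (hA : IsFirstGate g A) : x ∈ startSet n A ↔ y ∈ movedSet n A := by
  have h1 := h.firstGate_val hA
  have hpos := firstStep_pos A
  have h2 : Active n A x ↔ Active n A y :=
    h.active_iff fun C hC hC' => hC.ne (hA.unique hC')
  rw [mem_startSet, mem_movedSet, h2]
  refine and_congr_right fun _ => ⟨fun _ => ?_, fun _ => h1.1⟩
  omega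

theorem dotProduct_posH_eq {M n : ℕ} (lam : Fin M → ℝ) (A : Fin M) (f : Pos M n → ℝ) :
    f ⬝ᵥ posH n lam *ᵥ f =
      f ⬝ᵥ posR n lam A *ᵥ f + moveForm n A A (firstStep A) (lam A) f := by
  rw [dotProduct_posR]; ring

theorem dotProduct_posH_nonneg {M n : ℕ} {lam : Fin M → ℝ} (h : ∀ B, 0 ≤ lam B ∧ lam B ≤ 1)
    (A : Fin M) (f : Pos M n → ℝ) : 0 ≤ f ⬝ᵥ posH n lam *ᵥ f := by
  rw [dotProduct_posH_eq lam A]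
  exact add_nonneg (dotProduct_posR_nonneg h A f) (moveForm_nonneg _ _ _ _ _)

/-- The label of the first gate. -/
def firstGate (n : ℕ) {M : ℕ} (A : Fin M) : GateLabel M n :=
  (A, A, ⟨firstStep A, Nat.lt_succ_of_le
    ((firstStep_lt_lastStep n A).trans (lastStep_le_depth n A))⟩)

theorem isFirstGate_firstGate {M n : ℕ} (A : Fin M) : IsFirstGate (firstGate n A) A :=
  ⟨rfl, rfl, rfl⟩

theorem gateMove_firstGate {M n : ℕ} {A : Fin M} {x y : Pos M n}
    (h : hop n A A (firstStep A) (firstStep A - 1) y x) : GateMove n (firstGate n A) x y :=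
  ⟨isGate_firstStep n A, h⟩

/-- The restored first gate asks only that amplitudes after the step be λ_A times those before it.
This fixes the ratio of the two kernel vectors. -/
theorem IsStage.posH_mulVec_groundVec {M n : ℕ} {lam : Fin M → ℝ} {A : Fin M}
    (hs : IsStage lam A) : posH n lam *ᵥ groundVec n A (lam A) = 0 := by
  refine mulVec_eq_zero_of_form (posH_transpose lam) (dotProduct_posH_nonneg hs.mem_Icc A) ?_
  have h1 : posR n lam A *ᵥ groundVec n A (lam A) = 0 := by
    rw [groundVec, Matrix.mulVec_add, Matrix.mulVec_smul, hs.posR_mulVec_ind.1,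
      hs.posR_mulVec_ind.2]
    simp
  rw [dotProduct_posH_eq lam A, h1, dotProduct_zero, zero_add, moveForm_eq_zero_iff]
  intro x y hxy
  have hg := gateMove_firstGate hxy
  have hmem := hg.first_mem (isFirstGate_firstGate A)
  simp only [groundVec, Pi.add_apply, Pi.smul_apply, smul_eq_mul]
  have hy : y ∉ startSet n A := fun hy => by
    have h2 := (mem_startSet.1 hy).2
    have h3 := hxy.2.1
    have := firstStep_pos A
    omega
  have hx : x ∉ movedSet n A := fun hx => (mem_movedSet.1 hx).2 hxy.2.2.2.1
  rw [ind_of_notMem hy, ind_of_notMem hx]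
  by_cases h : x ∈ startSet n A
  · rw [ind_of_mem h, ind_of_mem (hmem.1 h)]; ring
  · rw [ind_of_notMem h, ind_of_notMem (hmem.not.1 h)]; ring

theorem IsStage.posR_form_ge {M n : ℕ} {lam : Fin M → ℝ} {A : Fin M} (hs : IsStage lam A) {e : ℝ}
    (he : ∀ (μ : ℝ) (u : Pos M n → ℝ), u ≠ 0 → posR n lam A *ᵥ u = μ • u → μ ≠ 0 → e ≤ μ)
    {w : Pos M n → ℝ} (h1 : ind (startSet n A) ⬝ᵥ w = 0) (h2 : ind (movedSet n A) ⬝ᵥ w = 0) :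
    e * (w ⬝ᵥ w) ≤ w ⬝ᵥ posR n lam A *ᵥ w := by
  refine form_ge_of_orthogonal_ker _ ?_ e he w fun u hu => ?_
  · rw [Matrix.IsHermitian, Matrix.conjTranspose_eq_transpose_of_trivial, posR_transpose]
  · rw [hs.eq_of_posR_mulVec hu, add_dotProduct, smul_dotProduct, smul_dotProduct, h1, h2]
    simp

theorem dotProduct_mulVec_comm {X : Type*} [Fintype X] {P : Matrix X X ℝ} (hP : Pᵀ = P)
    (f g : X → ℝ) : f ⬝ᵥ P *ᵥ g = g ⬝ᵥ P *ᵥ f := by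
  rw [Matrix.dotProduct_mulVec, ← Matrix.mulVec_transpose, hP, dotProduct_comm]

theorem dotProduct_mulVec_add_ker {X : Type*} [Fintype X] {P : Matrix X X ℝ} (hP : Pᵀ = P)
    {u : X → ℝ} (hu : P *ᵥ u = 0) (w : X → ℝ) (α : ℝ) :
    (α • u + w) ⬝ᵥ P *ᵥ (α • u + w) = w ⬝ᵥ P *ᵥ w := by
  rw [Matrix.mulVec_add, Matrix.mulVec_smul, hu, smul_zero, zero_add, add_dotProduct,
    smul_dotProduct, dotProduct_mulVec_comm hP, hu, dotProduct_zero, smul_zero, zero_add]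

/-- The gap in the block with all bits zero. -/
theorem IsStage.posH_form_ge {M n : ℕ} {lam : Fin M → ℝ} {A : Fin M} (hs : IsStage lam A) {e : ℝ}
    (he0 : 0 < e)
    (he : ∀ (μ : ℝ) (u : Pos M n → ℝ), u ≠ 0 → posR n lam A *ᵥ u = μ • u → μ ≠ 0 → e ≤ μ)
    (hS : 0 < (startSet n A).card) {f : Pos M n → ℝ} (hf : groundVec n A (lam A) ⬝ᵥ f = 0) :
    e * ((startSet n A).card + lam A ^ 2 * (movedSet n A).card) * (f ⬝ᵥ f) ≤
      f ⬝ᵥ posH n lam *ᵥ f * (e + 1 + lam A ^ 2) * (movedSet n A).card := by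
  classical
  set s : ℝ := ((startSet n A).card : ℝ) with hs_def
  set m : ℝ := ((movedSet n A).card : ℝ) with hm_def
  set a := lam A with ha_def
  -- The first gate on A embeds the start positions injectively into the moved ones; `So` is the
  -- image, the moved positions with A at its first step.
  let up : Pos M n → Pos M n := fun x => x.setPair A A (firstStep A)
    fun D hD => (isGate_firstStep n A).mem hD
  have hup : ∀ x ∈ startSet n A, hop n A A (firstStep A) (firstStep A - 1) (up x) x := fun x hx =>
    (Pos.hop_setPair _ (mem_startSet.1 hx).2 (mem_startSet.1 hx).2).symm
  have hupm : ∀ x ∈ startSet n A, up x ∈ movedSet n A := fun x hx =>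
    ((gateMove_firstGate (hup x hx)).first_mem (isFirstGate_firstGate A)).1 hx
  have hinj : Set.InjOn up (startSet n A) := fun x hx y hy hxy =>
    hop.right_unique (hup x hx) (hxy ▸ hup y hy)
  let So := (startSet n A).image up
  have hSoM : So ⊆ movedSet n A := Finset.image_subset_iff.2 hupm
  have hdis := disjoint_startSet_movedSet (n := n) A
  have hdisSo : Disjoint (startSet n A) So := Finset.disjoint_of_subset_right hSoM hdis
  have hSocard : (So.card : ℝ) = s := by rw [Finset.card_image_of_injOn hinj]
  have hs0 : 0 < s := Nat.cast_pos.2 hS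
  have hm0 : 0 < m := lt_of_lt_of_le (hSocard ▸ hs0) (Nat.cast_le.2 (Finset.card_le_card hSoM))
  have hx0 : 0 ≤ a ^ 2 := sq_nonneg a
  have d1 : ind (startSet n A) ⬝ᵥ ind (startSet n A) = s := ind_dotProduct_of_subset (Finset.Subset.refl _)
  have d2 : ind (movedSet n A) ⬝ᵥ ind (movedSet n A) = m := ind_dotProduct_of_subset (Finset.Subset.refl _)
  have d3 : ind (startSet n A) ⬝ᵥ ind (movedSet n A) = 0 := ind_dotProduct_of_disjoint hdis
  have d4 : ind (movedSet n A) ⬝ᵥ ind (startSet n A) = 0 := ind_dotProduct_of_disjoint hdis.symm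
  have d5 : ind So ⬝ᵥ ind (movedSet n A) = s := (ind_dotProduct_of_subset hSoM).trans hSocard
  have d6 : ind So ⬝ᵥ ind (startSet n A) = 0 := ind_dotProduct_of_disjoint hdisSo.symm
  have d7 : ind So ⬝ᵥ ind So = s := (ind_dotProduct_of_subset (Finset.Subset.refl _)).trans hSocard
  have d8 : ind (startSet n A) ⬝ᵥ ind So = 0 := ind_dotProduct_of_disjoint hdisSo
  -- The vector in the kernel of `posR` orthogonal to the ground state.
  set u : Pos M n → ℝ := (a * m) • ind (startSet n A) - s • ind (movedSet n A) with hu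
  -- The direction tested by the first gate; its pairing with f is the sum of f (up x) - a f x over
  -- the start positions.
  set ξ : Pos M n → ℝ := ind So - a • ind (startSet n A) with hξ
  have huu : u ⬝ᵥ u = s * m * (s + a ^ 2 * m) := by
    simp only [hu, sub_dotProduct, dotProduct_sub, smul_dotProduct, dotProduct_smul, smul_eq_mul,
      d1, d2, d3, d4]
    ring
  have hξξ : ξ ⬝ᵥ ξ = s * (1 + a ^ 2) := by
    simp only [hξ, sub_dotProduct, dotProduct_sub, smul_dotProduct, dotProduct_smul, smul_eq_mul,
      d1, d6, d7, d8]
    ring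
  have hξu : ξ ⬝ᵥ u = -(s * (s + a ^ 2 * m)) := by
    simp only [hξ, hu, sub_dotProduct, dotProduct_sub, smul_dotProduct, dotProduct_smul,
      smul_eq_mul, d1, d3, d5, d6]
    ring
  have hpos : 0 < s + a ^ 2 * m := by positivity
  have huu0 : 0 < u ⬝ᵥ u := by rw [huu]; positivity
  set α := (u ⬝ᵥ f) / (u ⬝ᵥ u) with hα
  set w := f - α • u with hw
  have hfw : f = α • u + w := by rw [hw]; abel
  have huw : u ⬝ᵥ w = 0 := by
    rw [hw, dotProduct_sub, dotProduct_smul, smul_eq_mul, hα, div_mul_cancel₀ _ huu0.ne', sub_self]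
  have hgw : groundVec n A a ⬝ᵥ w = 0 := by
    rw [hw, dotProduct_sub, hf, dotProduct_smul]
    simp only [hu, groundVec, add_dotProduct, dotProduct_sub, smul_dotProduct, dotProduct_smul,
      smul_eq_mul, d1, d2, d3, d4]
    ring
  -- Orthogonality to u and to the ground state is orthogonality to the whole kernel, so the bound e
  -- applies to w.
  have hw1 : ind (startSet n A) ⬝ᵥ w = 0 ∧ ind (movedSet n A) ⬝ᵥ w = 0 := by
    rw [hu, sub_dotProduct, smul_dotProduct, smul_dotProduct, smul_eq_mul, smul_eq_mul] at huw
    rw [groundVec, add_dotProduct, smul_dotProduct, smul_eq_mul] at hgw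
    have h2 : (s + a ^ 2 * m) * (ind (movedSet n A) ⬝ᵥ w) = 0 := by
      linear_combination (a * m) * hgw - huw
    have h3 := (mul_eq_zero.1 h2).resolve_left hpos.ne'
    rw [h3, mul_zero, add_zero] at hgw
    exact ⟨hgw, h3⟩
  have hker : posR n lam A *ᵥ u = 0 := by
    rw [hu, Matrix.mulVec_sub, Matrix.mulVec_smul, Matrix.mulVec_smul, hs.posR_mulVec_ind.1,
      hs.posR_mulVec_ind.2]
    simp
  have hX : e * (w ⬝ᵥ w) ≤ f ⬝ᵥ posR n lam A *ᵥ f := by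
    have h1 := dotProduct_mulVec_add_ker (posR_transpose lam A) hker w α
    rw [← hfw] at h1
    rw [h1]
    exact hs.posR_form_ge he hw1.1 hw1.2
  -- Cauchy–Schwarz over the s moves from the start: the first gate dominates 1 + a² times the
  -- projection on ξ.
  have hY : (1 + a ^ 2) * (ξ ⬝ᵥ f) ^ 2 ≤ moveForm n A A (firstStep A) a f * (ξ ⬝ᵥ ξ) := by
    have h1 : ξ ⬝ᵥ f = ∑ x ∈ startSet n A, (f (up x) - a * f x) := by
      rw [hξ, sub_dotProduct, smul_dotProduct, ind_dotProduct, ind_dotProduct,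
        Finset.sum_image hinj, Finset.sum_sub_distrib, smul_eq_mul, Finset.mul_sum]
    have h2 : (ξ ⬝ᵥ f) ^ 2 ≤ s * ∑ x ∈ startSet n A, (f (up x) - a * f x) ^ 2 := by
      rw [h1]
      exact sq_sum_le_card_mul_sum_sq
    have hnn : ∀ x y : Pos M n, 0 ≤ if hop n A A (firstStep A) (firstStep A - 1) y x
        then (f y - a * f x) ^ 2 else 0 := by
      intro x y
      split_ifs
      · exact sq_nonneg _
      · exact le_rfl
    have h3 : ∑ x ∈ startSet n A, (f (up x) - a * f x) ^ 2 ≤ moveForm n A A (firstStep A) a f := by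
      refine le_trans (Finset.sum_le_sum fun x hx => ?_) (Finset.sum_le_sum_of_subset_of_nonneg
        (Finset.subset_univ _) fun x _ _ => Finset.sum_nonneg fun y _ => hnn x y)
      refine le_trans ?_ (Finset.single_le_sum (fun y _ => hnn x y) (Finset.mem_univ (up x)))
      rw [if_pos (hup x hx)]
    rw [hξξ]
    have h4 : (1 + a ^ 2) * (ξ ⬝ᵥ f) ^ 2 ≤
        (1 + a ^ 2) * (s * moveForm n A A (firstStep A) a f) := by
      refine mul_le_mul_of_nonneg_left (h2.trans ?_) (by positivity)
      exact mul_le_mul_of_nonneg_left h3 hs0.le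
    linarith
  have key := two_form_bound u ξ f w α e (1 + a ^ 2) _ _ he0 (add_pos_of_pos_of_nonneg one_pos hx0) hfw huw hX hY
  rw [hξu, hξξ, huu, ← dotProduct_posH_eq] at key
  -- The squared cosine between ξ and u is (s + a² m) / ((1 + a²) m); the remaining common factor is
  -- cancelled here.
  have hcommon : 0 < s ^ 2 * (1 + a ^ 2) * (s + a ^ 2 * m) :=
    mul_pos (mul_pos (pow_pos hs0 2) (add_pos_of_pos_of_nonneg one_pos hx0)) hpos
  refine le_of_mul_le_mul_left ?_ hcommon
  linear_combination key

/-! ### Counting legal positions -/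

/-- The positions of `A` compatible with the position `y` of the next qubit are
`linkBase n A y, …, linkBase n A y + 3`. -/
def linkBase (n : ℕ) {M : ℕ} (A : Fin M) (y : ℕ) : ℕ :=
  if Odd (label A) then 4 * max 1 ((y + 2) / 4) - 2 else 4 * min (y / 4) (n + M / 2)

/-- The gates on A and B recur every four time steps and cut the time axis of A into windows. The
first and last windows also have length four, by the choice of `firstStep` and `lastStep`. Legality
says that A lies in the window determined by y; the `max` and `min` in `linkBase` handle a y beyond
the outermost windows. -/
theorem link_iff {M n : ℕ} (hM : Odd M) {A B : Fin M} (hAB : B.val = A.val + 1) {x y : ℕ}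
    (hx : firstStep A - 1 ≤ x) (hx' : x ≤ lastStep n A)
    (hy : firstStep B - 1 ≤ y) (hy' : y ≤ lastStep n B) :
    (∀ i, IsTwoQubitGate n A B i → (x < i ↔ y < i)) ↔
      linkBase n A y ≤ x ∧ x < linkBase n A y + 4 := by
  obtain ⟨c, rfl⟩ := hM
  have hBM := B.2
  have hgate : (∀ i, IsTwoQubitGate n A B i → (x < i ↔ y < i)) ↔
      ∀ j, 1 ≤ j → j ≤ 2 * n + (2 * c + 1) - 1 → (j + (A.val + 1)) % 2 = 1 →
        (x < 2 * j + 2 ↔ y < 2 * j + 2) := by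
    constructor
    · intro h j h1 h2 h3
      exact h _ ⟨hAB, j, Finset.mem_Icc.2 ⟨h1, h2⟩, rfl, Nat.odd_iff.2 h3⟩
    · rintro h i ⟨-, j, hj, rfl, ho⟩
      rw [Finset.mem_Icc] at hj
      exact h j hj.1 hj.2 (Nat.odd_iff.1 ho)
  rw [hgate]
  unfold firstStep label at hx hy
  unfold lastStep label at hx' hy'
  unfold linkBase label
  simp only [Nat.odd_iff, Nat.even_iff] at *
  rcases Nat.mod_two_eq_zero_or_one A.val with hA | hA
  · have h1 : (A.val + 1) % 2 = 1 := by omega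
    have h2 : (B.val + 1) % 2 = 0 := by omega
    have h3 : A.val + 1 < 2 * c + 1 := by omega
    simp only [h1, h2, h3, and_self, if_true, one_ne_zero, zero_ne_one, if_false, false_and] at *
    constructor
    · intro h
      -- The gates at the lower and the upper end of the window. At the outermost windows one of
      -- them does not exist, and the range of A supplies the bound.
      have ha := h (2 * ((y + 2) / 4 - 1))
      have hb := h (2 * max 1 ((y + 2) / 4))
      omega
    · intro h j hj1 hj2 hj3
      omega
  · have h1 : (A.val + 1) % 2 = 0 := by omega
    have h2 : (B.val + 1) % 2 = 1 := by omega
    simp only [h1, h2, true_and, if_true, one_ne_zero, zero_ne_one, if_false, false_and] at *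
    have hyl : y ≤ 2 * (2 * n + (2 * c + 1)) + 3 := by split_ifs at hy' <;> omega
    constructor
    · intro h
      have ha := h (2 * min (y / 4) (n + (2 * c + 1) / 2) - 1)
      have hb := h (2 * (y / 4) + 1)
      omega
    · intro h j hj1 hj2 hj3
      omega

theorem linkBase_mem {M n : ℕ} (hM : Odd M) {A B : Fin M} (hAB : B.val = A.val + 1) {y : ℕ}
    (hy' : y ≤ lastStep n B) :
    firstStep A - 1 ≤ linkBase n A y ∧ linkBase n A y + 3 ≤ lastStep n A := by
  obtain ⟨c, rfl⟩ := hM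
  have hBM := B.2
  unfold lastStep label at hy'
  unfold linkBase lastStep firstStep label
  simp only [Nat.odd_iff, Nat.even_iff] at *
  rcases Nat.mod_two_eq_zero_or_one A.val with hA | hA
  · have h1 : (A.val + 1) % 2 = 1 := by omega
    have h2 : (B.val + 1) % 2 = 0 := by omega
    have h3 : A.val + 1 < 2 * c + 1 := by omega
    simp only [h1, h2, h3, and_self, if_true, one_ne_zero, zero_ne_one, if_false, false_and] at *
    omega
  · have h1 : (A.val + 1) % 2 = 0 := by omega
    simp only [h1, if_true, zero_ne_one, if_false, false_and] at *
    omega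

open Classical in
/-- Positions at which the qubits up to `A` respect the gates among them, with all later qubits
at the start. -/
noncomputable def chainSet {M n : ℕ} (φ : Pos M n → Prop) (A : Fin M) : Finset (Pos M n) :=
  Finset.univ.filter fun x =>
    (∀ B C i, IsTwoQubitGate n B C i → C ≤ A → ((x B : ℕ) < i ↔ (x C : ℕ) < i)) ∧
    (∀ B, A < B → (x B : ℕ) = firstStep B - 1) ∧ φ x

/-- The number of such positions with a given position of `A`. -/
noncomputable def chains {M n : ℕ} (φ : Pos M n → Prop) (A : Fin M) (j : ℕ) : ℕ :=
  ((chainSet φ A).filter fun x => (x A : ℕ) = j).card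

theorem mem_chainSet {M n : ℕ} {φ : Pos M n → Prop} {A : Fin M} {x : Pos M n} :
    x ∈ chainSet φ A ↔
      (∀ B C i, IsTwoQubitGate n B C i → C ≤ A → ((x B : ℕ) < i ↔ (x C : ℕ) < i)) ∧
      (∀ B, A < B → (x B : ℕ) = firstStep B - 1) ∧ φ x := by
  simp [chainSet]

theorem card_filter_chainSet {M n : ℕ} (φ : Pos M n → Prop) (A : Fin M) (s : Finset ℕ) :
    ((chainSet φ A).filter fun x => (x A : ℕ) ∈ s).card = ∑ k ∈ s, chains φ A k := by
  rw [Finset.card_eq_sum_card_fiberwise (s := (chainSet φ A).filter fun x => (x A : ℕ) ∈ s)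
    (t := s) (f := fun x : Pos M n => (x A : ℕ)) (fun x hx => (Finset.mem_filter.1 hx).2)]
  refine Finset.sum_congr rfl fun k hk => ?_
  rw [chains, Finset.filter_filter]
  congr 1
  refine Finset.filter_congr fun x _ => ?_
  exact ⟨fun h => h.2, fun h => ⟨h ▸ hk, h⟩⟩

/-- The transfer matrix: appending one more qubit. -/
theorem chains_succ {M n : ℕ} (hM : Odd M) {φ : Pos M n → Prop} {A B : Fin M}
    (hAB : B.val = A.val + 1) (hφ : ∀ x k, φ (Function.update x B k) ↔ φ x) {j : ℕ}
    (hj : firstStep B - 1 ≤ j) (hj' : j ≤ lastStep n B) :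
    chains φ B j = ∑ k ∈ Finset.Ico (linkBase n A j) (linkBase n A j + 4), chains φ A k := by
  classical
  have hlt : A < B := Fin.lt_def.2 (by omega)
  have hle : ∀ C, C < B ↔ C ≤ A := fun C => by rw [Fin.lt_def, Fin.le_def]; omega
  have hpred : ∀ C i, IsTwoQubitGate n C B i → C = A := fun C i h =>
    Fin.ext (by have := h.1; omega)
  rw [← card_filter_chainSet, chains]
  refine Finset.card_nbij'
    (fun x => Function.update x B ⟨firstStep B - 1, (isGate_firstStep n B).pred_mem (Or.inl rfl)⟩)
    (fun y => Function.update y B ⟨j, Finset.mem_Icc.2 ⟨hj, hj'⟩⟩) ?_ ?_ ?_ ?_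
  · intro x hx
    obtain ⟨hx, hxj⟩ := Finset.mem_filter.1 hx
    obtain ⟨h1, h2, h3⟩ := mem_chainSet.1 hx
    refine Finset.mem_filter.2 ⟨mem_chainSet.2 ⟨fun C D i hg hD => ?_, fun C hC => ?_, ?_⟩, ?_⟩ <;>
      beta_reduce
    · have hDB : D ≠ B := ((hle D).2 hD).ne
      have hCB : C ≠ B := fun h => by
        have h1 := hg.1
        have h2 := (hle D).2 hD
        rw [Fin.lt_def] at h2
        rw [h] at h1
        omega
      rw [Function.update_of_ne hDB, Function.update_of_ne hCB]
      exact h1 C D i hg ((hle D).2 hD).le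
    · by_cases hCB : C = B
      · subst hCB; simp
      · rw [Function.update_of_ne hCB]
        exact h2 C (lt_of_le_of_ne (not_lt.1 fun h => not_le.2 hC ((hle C).1 h)) (Ne.symm hCB))
    · exact (hφ _ _).2 h3
    · simp only [Function.update_of_ne hlt.ne, Finset.mem_Ico]
      refine (link_iff hM hAB (x.start_le A) (x.le_last A) hj hj').1 fun i hi => ?_
      rw [← hxj]
      exact h1 A B i hi le_rfl
  · intro y hy
    obtain ⟨hy, hyj⟩ := Finset.mem_filter.1 hy
    obtain ⟨h1, h2, h3⟩ := mem_chainSet.1 hy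
    refine Finset.mem_filter.2 ⟨mem_chainSet.2 ⟨fun C D i hg hD => ?_, fun C hC => ?_, ?_⟩, ?_⟩ <;>
      beta_reduce
    · by_cases hDB : D = B
      · subst hDB
        obtain rfl := hpred C i hg
        rw [Function.update_self, Function.update_of_ne hg.ne]
        exact (link_iff hM hAB (y.start_le C) (y.le_last C) hj hj').2 (Finset.mem_Ico.1 hyj) i hg
      · have hDA : D ≤ A := (hle D).1 (lt_of_le_of_ne hD hDB)
        have hCB : C ≠ B := fun h => by
          have h1 := hg.1
          rw [Fin.le_def] at hDA
          rw [h] at h1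
          omega
        rw [Function.update_of_ne hDB, Function.update_of_ne hCB]
        exact h1 C D i hg hDA
    · rw [Function.update_of_ne hC.ne']
      exact h2 C (hlt.trans hC)
    · exact (hφ _ _).2 h3
    · simp
  · intro x hx
    obtain ⟨hx, hxj⟩ := Finset.mem_filter.1 hx
    funext C
    by_cases hC : C = B
    · subst hC
      simp only [Function.update_self]
      exact Subtype.ext hxj.symm
    · simp [Function.update_of_ne hC]
  · intro y hy
    obtain ⟨hy, hyj⟩ := Finset.mem_filter.1 hy
    funext C
    by_cases hC : C = B
    · subst hC
      simp only [Function.update_self]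
      exact Subtype.ext ((mem_chainSet.1 hy).2.1 C hlt).symm
    · simp [Function.update_of_ne hC]

theorem chains_first {M n : ℕ} {A : Fin M} (hA : A.val = 0) {j : ℕ}
    (hj : firstStep A - 1 ≤ j) (hj' : j ≤ lastStep n A) :
    chains (fun _ : Pos M n => True) A j = 1 := by
  rw [chains, Finset.card_eq_one]
  refine ⟨fun D => if h : D = A then ⟨j, by subst h; exact Finset.mem_Icc.2 ⟨hj, hj'⟩⟩
    else ⟨firstStep D - 1, (isGate_firstStep n D).pred_mem (Or.inl rfl)⟩, ?_⟩
  ext x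
  rw [Finset.mem_filter, mem_chainSet, Finset.mem_singleton]
  constructor
  · rintro ⟨⟨-, h, -⟩, hx⟩
    funext D
    refine Subtype.ext ?_
    by_cases hD : D = A
    · subst hD
      simpa using hx
    · have : A < D := Fin.lt_def.2 (by
        have : D.val ≠ A.val := fun h => hD (Fin.ext h)
        omega)
      simpa [hD] using h D this
  · rintro rfl
    refine ⟨⟨fun B C i hg hC => ?_, fun B hB => by simp [hB.ne'], trivial⟩, by simp⟩
    have h1 := hg.1
    rw [Fin.le_def] at hC
    omega

/-- For each position of the next qubit exactly four positions of the previous one are allowed, so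
every added qubit multiplies the count by four whatever its position. -/
theorem chains_true {M n : ℕ} (hM : Odd M) : ∀ (k : ℕ) (A : Fin M), A.val = k → ∀ j,
    firstStep A - 1 ≤ j → j ≤ lastStep n A → chains (fun _ : Pos M n => True) A j = 4 ^ k := by
  intro k
  induction k with
  | zero => exact fun A hA j hj hj' => chains_first hA hj hj'
  | succ k ih =>
    intro B hB j hj hj'
    have hBM := B.2
    let A : Fin M := ⟨k, by omega⟩
    have hmem := linkBase_mem (n := n) hM (A := A) (B := B) hB hj'
    rw [chains_succ hM (A := A) hB (fun _ _ => Iff.rfl) hj hj',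
      Finset.sum_congr rfl fun i hi => ih A rfl i
        (hmem.1.trans (Finset.mem_Ico.1 hi).1) (by have := (Finset.mem_Ico.1 hi).2; omega)]
    simp [pow_succ, mul_comm]

/-! ### The sizes of the two parts of the ground state -/

/-- The last position of `A` at which all later qubits can be at the start. -/
def topStep (n : ℕ) {M : ℕ} (A : Fin M) : ℕ :=
  if A.val + 1 = M then lastStep n A else firstStep A + 2

/-- With the next qubit at its start, A is confined to its first window, which is the bound
`topStep`. Gates between later qubits are respected because these all stand before time 4. -/
theorem active_iff_chainSet {M n : ℕ} (hM : Odd M) {A : Fin M} {x : Pos M n} :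
    Active n A x ↔ x ∈ chainSet (fun _ => True) A ∧ (x A : ℕ) ≤ topStep n A := by
  rw [mem_chainSet]
  have hstart : ∀ (D : Fin M) (i : ℕ), 4 ≤ i → firstStep D - 1 < i := fun D i hi => by
    have := firstStep_le_three D
    omega
  by_cases hlast : A.val + 1 = M
  · have hall : ∀ C : Fin M, C ≤ A := fun C => Fin.le_def.2 (by have := C.2; omega)
    rw [topStep, if_pos hlast]
    exact ⟨fun h => ⟨⟨fun B C i hg _ => h.1 B C i hg, h.2, trivial⟩, x.le_last A⟩,
      fun h => ⟨fun B C i hg => h.1.1 B C i hg (hall C), h.1.2.1⟩⟩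
  · have hAM := A.2
    let B : Fin M := ⟨A.val + 1, by omega⟩
    have hAB : A < B := Fin.lt_def.2 (by simp [B])
    have hlink := fun (hB : (x B : ℕ) = firstStep B - 1) =>
      link_iff (n := n) hM (A := A) (B := B) rfl (x.start_le A) (x.le_last A) le_rfl
        (hB ▸ x.le_last B)
    have hbase : linkBase n A (firstStep B - 1) + 4 = firstStep A + 3 := by
      unfold linkBase firstStep label
      simp only [Nat.odd_iff, Nat.even_iff, B]
      rcases Nat.mod_two_eq_zero_or_one A.val with hA | hA
      · have h1 : (A.val + 1) % 2 = 1 := by omega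
        have h2 : (A.val + 1 + 1) % 2 = 0 := by omega
        simp [h1, h2]
      · have h1 : (A.val + 1) % 2 = 0 := by omega
        have h2 : (A.val + 1 + 1) % 2 = 1 := by omega
        simp [h1, h2]
    rw [topStep, if_neg hlast]
    constructor
    · rintro ⟨h1, h2⟩
      refine ⟨⟨fun B C i hg _ => h1 B C i hg, h2, trivial⟩, ?_⟩
      have := ((hlink (h2 B hAB)).1 fun i hi => by rw [← h2 B hAB]; exact h1 A B i hi).2
      omega
    · rintro ⟨⟨h1, h2, -⟩, h3⟩
      refine ⟨fun C D i hg => ?_, h2⟩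
      rcases le_or_gt D A with hD | hD
      · exact h1 C D i hg hD
      · have h4 := hg.four_le
        have hD' := h2 D hD
        by_cases hC : A < C
        · have := hstart C i h4
          have := hstart D i h4
          rw [h2 C hC, hD']
          omega
        · have hCA : C = A := by
            have := hg.1
            rw [Fin.lt_def] at hD hC
            exact Fin.ext (by omega)
          subst hCA
          have hDB : D = B := Fin.ext hg.1
          subst hDB
          rw [hD']
          refine (hlink hD').2 ⟨?_, by omega⟩ i hg
          have := x.start_le C
          omega

theorem topStep_le {M : ℕ} (n : ℕ) (A : Fin M) : topStep n A ≤ lastStep n A := by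
  have := firstStep_le_three A
  have := A.2
  unfold topStep
  split_ifs
  · exact le_rfl
  · unfold lastStep
    split_ifs <;> omega

theorem startSet_eq {M n : ℕ} (hM : Odd M) (A : Fin M) :
    startSet n A = (chainSet (fun _ => True) A).filter fun x => (x A : ℕ) = firstStep A - 1 := by
  ext x
  rw [mem_startSet, Finset.mem_filter, active_iff_chainSet hM]
  have h1 : firstStep A - 1 ≤ topStep n A := by
    have := firstStep_lt_lastStep n A
    unfold topStep
    split_ifs <;> omega
  exact ⟨fun h => ⟨h.1.1, h.2⟩, fun h => ⟨⟨h.1, h.2.le.trans h1⟩, h.2⟩⟩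

theorem card_startSet {M n : ℕ} (hM : Odd M) (A : Fin M) :
    (startSet n A).card = 4 ^ A.val := by
  rw [startSet_eq hM]
  exact chains_true hM _ A rfl _ le_rfl ((Nat.sub_le _ _).trans (firstStep_lt_lastStep n A))

theorem movedSet_filter {M n : ℕ} (hM : Odd M) (A : Fin M) (s : Finset ℕ)
    (hs : s ⊆ Finset.Icc (firstStep A) (topStep n A)) :
    ((movedSet n A).filter fun x => (x A : ℕ) ∈ s).card = s.card * 4 ^ A.val := by
  have h : ((movedSet n A).filter fun x => (x A : ℕ) ∈ s) =
      (chainSet (fun _ => True) A).filter fun x => (x A : ℕ) ∈ s := by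
    ext x
    rw [Finset.mem_filter, mem_movedSet, Finset.mem_filter, active_iff_chainSet hM]
    have := firstStep_pos A
    refine ⟨fun h => ⟨h.1.1.1, h.2⟩, fun h => ?_⟩
    have h1 := Finset.mem_Icc.1 (hs h.2)
    exact ⟨⟨⟨h.1, h1.2⟩, by omega⟩, h.2⟩
  rw [h, card_filter_chainSet, Finset.sum_congr rfl fun k hk => chains_true hM _ A rfl k
    (by have := Finset.mem_Icc.1 (hs hk); omega)
    ((Finset.mem_Icc.1 (hs hk)).2.trans (topStep_le n A))]
  simp

theorem card_movedSet {M n : ℕ} (hM : Odd M) (A : Fin M) :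
    (movedSet n A).card = (topStep n A + 1 - firstStep A) * 4 ^ A.val := by
  have h := movedSet_filter (n := n) hM A _ (Finset.Subset.refl _)
  rw [Finset.filter_true_of_mem, Nat.card_Icc] at h
  · exact h
  · intro x hx
    obtain ⟨h1, h2⟩ := mem_movedSet.1 hx
    have h3 := ((active_iff_chainSet hM).1 h1).2
    have h4 := x.start_le A
    rw [Finset.mem_Icc]
    omega

/-! ### Counting the legal positions at which a given qubit is at the start -/

theorem sum_Ico_four (g : ℕ → ℕ) (b : ℕ) :
    ∑ k ∈ Finset.Ico b (b + 4), g k = g (b + 0) + g (b + 1) + g (b + 2) + g (b + 3) := by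
  rw [Finset.sum_Ico_eq_sum_range, Nat.add_sub_cancel_left]
  simp [Finset.sum_range_succ]

/-- The number of chains with `4 q - 2 ≤ x A ≤ 4 q + 1`. -/
noncomputable def blockSum {M n : ℕ} (φ : Pos M n → Prop) (A : Fin M) (q : ℕ) : ℕ :=
  ∑ k ∈ Finset.Ico (4 * q - 2) (4 * q - 2 + 4), chains φ A k

/-- The number of chains with `4 q ≤ x A ≤ 4 q + 3`. -/
noncomputable def evenBlockSum {M n : ℕ} (φ : Pos M n → Prop) (A : Fin M) (q : ℕ) : ℕ :=
  ∑ k ∈ Finset.Ico (4 * q) (4 * q + 4), chains φ A k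

theorem chains_of_odd {M n : ℕ} (hM : Odd M) {φ : Pos M n → Prop} {A B : Fin M}
    (hA : Even A.val) (hAB : B.val = A.val + 1)
    (hφ : ∀ x k, φ (Function.update x B k) ↔ φ x) {j : ℕ} (hj' : j ≤ 2 * (2 * n + M) + 1) :
    chains φ B j = blockSum φ A (max 1 ((j + 2) / 4)) := by
  rw [Nat.even_iff] at hA
  have h1 : Odd (label A) := by rw [label, Nat.odd_iff]; omega
  have h2 : Even (label B) := by rw [label, Nat.even_iff]; omega
  rw [chains_succ hM hAB hφ, linkBase, if_pos h1, blockSum]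
  · unfold firstStep
    rw [if_pos h2]
    exact Nat.zero_le _
  · unfold lastStep
    split_ifs <;> omega

theorem chains_of_even {M n : ℕ} (hM : Odd M) {φ : Pos M n → Prop} {A B : Fin M}
    (hA : Odd A.val) (hAB : B.val = A.val + 1)
    (hφ : ∀ x k, φ (Function.update x B k) ↔ φ x) {j : ℕ} (hj : 2 ≤ j)
    (hj' : j ≤ 2 * (2 * n + M) + 1) :
    chains φ B j = evenBlockSum φ A (min (j / 4) (n + M / 2)) := by
  rw [Nat.odd_iff] at hA
  have h1 : ¬ Odd (label A) := by rw [label, Nat.odd_iff]; omega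
  have h2 : ¬ Even (label B) := by rw [label, Nat.even_iff]; omega
  rw [chains_succ hM hAB hφ, linkBase, if_neg h1, evenBlockSum]
  · unfold firstStep
    rw [if_neg h2]
    exact hj
  · unfold lastStep
    split_ifs <;> omega

/-- Windows of neighbouring qubits are offset by two steps, so the four positions in a window of B
see two windows of A, two positions each. -/
theorem blockSum_of_even {M n : ℕ} (hM : Odd M) {φ : Pos M n → Prop} {A B : Fin M}
    (hA : Odd A.val) (hAB : B.val = A.val + 1)
    (hφ : ∀ x k, φ (Function.update x B k) ↔ φ x) {q : ℕ} (hq : 1 ≤ q)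
    (hq' : 4 * q ≤ 2 * (2 * n + M) - 2) :
    blockSum φ B q = 2 * evenBlockSum φ A (q - 1) + 2 * evenBlockSum φ A q := by
  have h : ∀ i < 4, chains φ B (4 * q - 2 + i) =
      evenBlockSum φ A (min ((4 * q - 2 + i) / 4) (n + M / 2)) := fun i hi =>
    chains_of_even hM hA hAB hφ (by omega) (by omega)
  rw [blockSum, sum_Ico_four, h 0 (by omega), h 1 (by omega),
    h 2 (by omega), h 3 (by omega)]
  have e0 : min ((4 * q - 2 + 0) / 4) (n + M / 2) = q - 1 := by omega
  have e1 : min ((4 * q - 2 + 1) / 4) (n + M / 2) = q - 1 := by omega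
  have e2 : min ((4 * q - 2 + 2) / 4) (n + M / 2) = q := by omega
  have e3 : min ((4 * q - 2 + 3) / 4) (n + M / 2) = q := by omega
  rw [e0, e1, e2, e3]
  ring

/-- At the lower edge there is no earlier window of A, so all four positions of B see its first
window. -/
theorem evenBlockSum_zero {M n : ℕ} (hM : Odd M) {φ : Pos M n → Prop} {A B : Fin M}
    (hA : Even A.val) (hAB : B.val = A.val + 1)
    (hφ : ∀ x k, φ (Function.update x B k) ↔ φ x) (hn : 0 < n) :
    evenBlockSum φ B 0 = 4 * blockSum φ A 1 := by
  have h : ∀ i < 4, chains φ B (4 * 0 + i) = blockSum φ A 1 := fun i hi => by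
    rw [chains_of_odd hM hA hAB hφ (by omega)]
    congr 1
    omega
  rw [evenBlockSum, sum_Ico_four, h 0 (by omega), h 1 (by omega),
    h 2 (by omega), h 3 (by omega)]
  ring

theorem evenBlockSum_of_odd {M n : ℕ} (hM : Odd M) {φ : Pos M n → Prop} {A B : Fin M}
    (hA : Even A.val) (hAB : B.val = A.val + 1)
    (hφ : ∀ x k, φ (Function.update x B k) ↔ φ x) {q : ℕ} (hq : 1 ≤ q)
    (hq' : 4 * q ≤ 2 * (2 * n + M) - 2) :
    evenBlockSum φ B q = 2 * blockSum φ A q + 2 * blockSum φ A (q + 1) := by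
  have h : ∀ i < 4, chains φ B (4 * q + i) = blockSum φ A (max 1 ((4 * q + i + 2) / 4)) :=
    fun i hi => chains_of_odd hM hA hAB hφ (by omega)
  rw [evenBlockSum, sum_Ico_four, h 0 (by omega), h 1 (by omega),
    h 2 (by omega), h 3 (by omega)]
  have e0 : max 1 ((4 * q + 0 + 2) / 4) = q := by omega
  have e1 : max 1 ((4 * q + 1 + 2) / 4) = q := by omega
  have e2 : max 1 ((4 * q + 2 + 2) / 4) = q + 1 := by omega
  have e3 : max 1 ((4 * q + 3 + 2) / 4) = q + 1 := by omega
  rw [e0, e1, e2, e3]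
  ring

/-- Two transfer steps act on window sums with rows (12, 4), (4, 8, 4), (4, 8, 4), …, whose columns
all sum to 16. Taking one more window on the left captures the whole columns of the windows on the
right; what is left over is nonnegative. -/
theorem sum_blockSum_succ {M n : ℕ} (hM : Odd M) (hn : 0 < n) {φ : Pos M n → Prop}
    {A B C : Fin M} (hA : Even A.val) (hAB : B.val = A.val + 1) (hBC : C.val = B.val + 1)
    (hφB : ∀ x k, φ (Function.update x B k) ↔ φ x)
    (hφC : ∀ x k, φ (Function.update x C k) ↔ φ x) {h : ℕ}
    (hh : 4 * (h + 2) ≤ 2 * (2 * n + M) - 2) :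
    16 * ∑ q ∈ Finset.range (h + 1), blockSum φ A (q + 1) ≤
      ∑ q ∈ Finset.range (h + 2), blockSum φ C (q + 1) := by
  have hB : Odd B.val := by rw [hAB]; exact hA.add_one
  have h1 : blockSum φ C 1 = 12 * blockSum φ A 1 + 4 * blockSum φ A 2 := by
    rw [blockSum_of_even hM hB hBC hφC le_rfl (by omega), Nat.sub_self,
      evenBlockSum_zero hM hA hAB hφB hn, evenBlockSum_of_odd hM hA hAB hφB le_rfl (by omega)]
    ring
  have h2 : ∀ q, q ≤ h → blockSum φ C (q + 2) =
      4 * blockSum φ A (q + 1) + 8 * blockSum φ A (q + 2) + 4 * blockSum φ A (q + 3) := by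
    intro q hq
    rw [blockSum_of_even hM hB hBC hφC (by omega) (by omega),
      evenBlockSum_of_odd hM hA hAB hφB (by omega) (by omega),
      evenBlockSum_of_odd hM hA hAB hφB (by omega) (by omega)]
    simp only [show q + 2 - 1 = q + 1 by omega]
    ring
  have key : ∀ k, k ≤ h → ∑ q ∈ Finset.range (k + 2), blockSum φ C (q + 1) =
      16 * (∑ q ∈ Finset.range (k + 1), blockSum φ A (q + 1)) + 12 * blockSum φ A (k + 2)
        + 4 * blockSum φ A (k + 3) := by
    intro k
    induction k with
    | zero =>
      intro hk
      simp only [Finset.sum_range_succ, Finset.sum_range_zero, zero_add, h1, h2 0 hk]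
      ring
    | succ k ih =>
      intro hk
      rw [Finset.sum_range_succ, ih (by omega), h2 (k + 1) hk, Finset.sum_range_succ _ (k + 1)]
      ring
  rw [key h le_rfl]
  omega

/-- Each pair of qubits lets the support spread by one window. The circuit is long enough that the
upper edge is never reached, so no weight is lost. -/
theorem le_sum_blockSum {M n : ℕ} (hM : Odd M) (hn : 0 < n) {φ : Pos M n → Prop} {A : Fin M}
    (hA : Even A.val) (hφ : ∀ B, A < B → ∀ x k, φ (Function.update x B k) ↔ φ x) :
    ∀ (r : ℕ) (C : Fin M), C.val = A.val + 2 * r →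
      16 ^ r * blockSum φ A 1 ≤ ∑ q ∈ Finset.range (r + 1), blockSum φ C (q + 1) := by
  intro r
  induction r with
  | zero =>
    intro C hC
    have : C = A := Fin.ext (by omega)
    subst this
    simp
  | succ r ih =>
    intro C hC
    have hCM := C.2
    let D : Fin M := ⟨A.val + 2 * r, by omega⟩
    let B : Fin M := ⟨A.val + 2 * r + 1, by omega⟩
    have hD : Even D.val := hA.add (even_two_mul r)
    have h := sum_blockSum_succ hM hn (A := D) (B := B) (C := C) (φ := φ) (h := r) hD rfl
      (by simp only [B]; omega) (hφ B (Fin.lt_def.2 (by simp only [B]; omega)))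
      (hφ C (Fin.lt_def.2 (by omega))) (by obtain ⟨c, rfl⟩ := hM; omega)
    have h2 := ih D rfl
    calc 16 ^ (r + 1) * blockSum φ A 1 = 16 * (16 ^ r * blockSum φ A 1) := by ring
      _ ≤ _ := Nat.mul_le_mul_left 16 h2
      _ ≤ _ := h

theorem sum_blockSum {M n : ℕ} (φ : Pos M n → Prop) (A : Fin M) (h : ℕ) :
    ∑ q ∈ Finset.range h, blockSum φ A (q + 1) =
      ∑ k ∈ Finset.Ico 2 (4 * h + 2), chains φ A k := by
  induction h with
  | zero => simp
  | succ h ih =>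
    rw [Finset.sum_range_succ, ih, blockSum, show 4 * (h + 1) - 2 = 4 * h + 2 by omega,
      Finset.sum_Ico_consecutive _ (by omega) (by omega)]
    rfl

theorem sum_blockSum_le {M n : ℕ} (φ : Pos M n → Prop) (A : Fin M) (h : ℕ) :
    ∑ q ∈ Finset.range h, blockSum φ A (q + 1) ≤ (chainSet φ A).card := by
  rw [sum_blockSum, ← card_filter_chainSet]
  exact Finset.card_filter_le _ _

open Classical in
/-- The legal positions at which `B` is at the start. -/
noncomputable def legalStart (n : ℕ) {M : ℕ} (B : Fin M) : Finset (Pos M n) :=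
  Finset.univ.filter fun x => Legal n x ∧ (x B : ℕ) = firstStep B - 1

theorem mem_legalStart {M n : ℕ} {B : Fin M} {x : Pos M n} :
    x ∈ legalStart n B ↔ Legal n x ∧ (x B : ℕ) = firstStep B - 1 := by simp [legalStart]

theorem legalStart_eq {M n : ℕ} {A : Fin M} (hA : A.val + 1 = M) (B : Fin M) :
    legalStart n B = chainSet (fun x => (x B : ℕ) = firstStep B - 1) A := by
  have hall : ∀ C : Fin M, C ≤ A := fun C => Fin.le_def.2 (by have := C.2; omega)
  ext x
  rw [mem_legalStart, mem_chainSet]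
  exact ⟨fun h => ⟨fun P Q i hg _ => h.1 P Q i hg, fun C hC => absurd (hall C) (not_le.2 hC), h.2⟩,
    fun h => ⟨fun P Q i hg => h.1 P Q i hg (hall Q), h.2.2⟩⟩

theorem chains_start {M n : ℕ} (hM : Odd M) (B : Fin M) :
    chains (fun x : Pos M n => (x B : ℕ) = firstStep B - 1) B (firstStep B - 1) =
      4 ^ B.val := by
  rw [← chains_true (n := n) hM _ B rfl (firstStep B - 1) le_rfl
    ((Nat.sub_le _ _).trans (firstStep_lt_lastStep n B)), chains, chains]
  congr 1
  ext x
  simp only [Finset.mem_filter, mem_chainSet, and_true]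
  tauto

/-- The count starts from the 4 ^ B.val chains with B at its start, supported in the first window,
and is propagated to the last qubit two qubits at a time. For odd B.val one unpaired step is needed
first, and it may cost a factor 2. -/
theorem le_card_legalStart {M n : ℕ} (hM : Odd M) (hn : 0 < n) (B : Fin M) :
    4 ^ (M - 1) ≤ 2 * (legalStart n B).card := by
  have hBM := B.2
  let φ : Pos M n → Prop := fun x => (x B : ℕ) = firstStep B - 1
  have hφ : ∀ C, B < C → ∀ x k, φ (Function.update x C k) ↔ φ x := by
    intro C hC x k
    simp only [φ, Function.update_of_ne hC.ne]
  let T : Fin M := ⟨M - 1, by omega⟩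
  rw [legalStart_eq (A := T) (by simp only [T]; omega) B]
  rcases Nat.even_or_odd B.val with hB | hB
  · have h1 : 4 ^ B.val ≤ blockSum φ B 1 := by
      rw [← chains_start (n := n) hM B]
      have h2 : firstStep B - 1 = 2 := by
        unfold firstStep label
        rw [if_neg (Nat.not_even_iff_odd.2 hB.add_one)]
      exact Finset.single_le_sum (f := fun k => chains φ B k) (fun k _ => Nat.zero_le _)
        (Finset.mem_Ico.2 (by omega))
    obtain ⟨r, hr⟩ : ∃ r, M - 1 = B.val + 2 * r := by
      obtain ⟨c, rfl⟩ := hM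
      obtain ⟨d, hd⟩ := hB
      exact ⟨c - d, by omega⟩
    have h2 := le_sum_blockSum hM hn hB hφ r T hr
    have h3 := h2.trans (sum_blockSum_le φ T (r + 1))
    have h4 : 4 ^ (M - 1) ≤ (chainSet φ T).card := by
      refine le_trans ?_ h3
      rw [hr, pow_add, pow_mul, mul_comm]
      exact Nat.mul_le_mul_left _ h1
    calc 4 ^ (M - 1) ≤ (chainSet φ T).card := h4
      _ ≤ 2 * (chainSet φ T).card := by omega
  · have hlt : B.val + 1 < M := by
      obtain ⟨c, rfl⟩ := hM
      obtain ⟨d, hd⟩ := hB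
      omega
    let C : Fin M := ⟨B.val + 1, hlt⟩
    have hBC : B < C := Fin.lt_def.2 (by simp only [C]; omega)
    -- Only two of the four positions in the first window of C see the window of B containing its
    -- start.
    have h1 : 2 * 4 ^ B.val ≤ blockSum φ C 1 := by
      rw [blockSum_of_even hM (A := B) (B := C) hB rfl (hφ C hBC) le_rfl
        (by obtain ⟨c, rfl⟩ := hM; omega), ← chains_start (n := n) hM B]
      have h2 : firstStep B - 1 = 0 := by
        unfold firstStep label
        rw [if_pos hB.add_one]
      have h3 : chains φ B (firstStep B - 1) ≤ evenBlockSum φ B (1 - 1) :=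
        Finset.single_le_sum (f := fun k => chains φ B k) (fun k _ => Nat.zero_le _)
          (Finset.mem_Ico.2 (by omega))
      change 2 * chains φ B (firstStep B - 1) ≤ _
      omega
    obtain ⟨r, hr⟩ : ∃ r, M - 1 = C.val + 2 * r := by
      simp only [C]
      obtain ⟨c, rfl⟩ := hM
      obtain ⟨d, hd⟩ := hB
      exact ⟨c - d - 1, by omega⟩
    have hC : Even C.val := hB.add_one
    have h2 := le_sum_blockSum hM hn hC (fun D hD => hφ D (hBC.trans hD)) r T hr
    have h3 := h2.trans (sum_blockSum_le φ T (r + 1))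
    have h4 : 4 ^ (M - 1) = 2 * (16 ^ r * (2 * 4 ^ B.val)) := by
      rw [hr]
      simp only [C]
      rw [pow_add, pow_add, pow_mul]
      ring
    rw [h4]
    exact Nat.mul_le_mul_left 2 ((Nat.mul_le_mul_left _ h1).trans h3)

/-! ### A trial function -/

theorem sum_range_affine (ℓ : ℕ) (d : ℝ) :
    ∑ i ∈ Finset.range ℓ, (2 * (i : ℝ) - d) = ℓ * (ℓ - 1) - d * ℓ := by
  induction ℓ with
  | zero => simp
  | succ ℓ ih => rw [Finset.sum_range_succ, ih]; push_cast; ring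

theorem sum_range_affine_sq (ℓ : ℕ) (d : ℝ) :
    ∑ i ∈ Finset.range ℓ, (2 * (i : ℝ) - d) ^ 2 =
      2 / 3 * (ℓ - 1) * ℓ * (2 * ℓ - 1) - 2 * d * ℓ * (ℓ - 1) + d ^ 2 * ℓ := by
  induction ℓ with
  | zero => simp
  | succ ℓ ih => rw [Finset.sum_range_succ, ih]; push_cast; ring

/-- Each of the ℓ time steps available to A after its start is taken by 4 ^ A.val moved positions.
-/
theorem sum_movedSet {M n : ℕ} (hM : Odd M) {A : Fin M} {ℓ : ℕ}
    (hℓ : topStep n A + 1 = firstStep A + ℓ) (F : ℕ → ℝ) :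
    ∑ x ∈ movedSet n A, F (x A) = 4 ^ A.val * ∑ i ∈ Finset.range ℓ, F (firstStep A + i) := by
  classical
  have h1 : ∑ i ∈ Finset.range ℓ, F (firstStep A + i) =
      ∑ k ∈ Finset.Icc (firstStep A) (topStep n A), F k := by
    rw [show Finset.Icc (firstStep A) (topStep n A) =
      Finset.Ico (firstStep A) (firstStep A + ℓ) by ext k; simp; omega,
      Finset.sum_Ico_eq_sum_range, Nat.add_sub_cancel_left]
  have hmaps : ∀ x ∈ movedSet n A, (x A : ℕ) ∈ Finset.Icc (firstStep A) (topStep n A) := by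
    intro x hx
    obtain ⟨h1, h2⟩ := mem_movedSet.1 hx
    have h3 := ((active_iff_chainSet hM).1 h1).2
    have h4 := x.start_le A
    rw [Finset.mem_Icc]
    omega
  rw [h1, ← Finset.sum_fiberwise_of_maps_to hmaps, Finset.mul_sum]
  refine Finset.sum_congr rfl fun k hk => ?_
  have h2 := movedSet_filter (n := n) hM A {k} (Finset.singleton_subset_iff.2 hk)
  simp only [Finset.mem_singleton, Finset.card_singleton, one_mul] at h2
  rw [Finset.sum_congr rfl fun x hx => by rw [(Finset.mem_filter.1 hx).2], Finset.sum_const,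
    nsmul_eq_mul]
  congr 1
  rw [show (4 : ℝ) ^ A.val = ((4 ^ A.val : ℕ) : ℝ) by push_cast; ring, ← h2]

/-- The lowest nonzero energy is at most that of a linear function of the position of `A`. -/
theorem IsStage.eigenvalue_le {M n : ℕ} (hM : Odd M) {lam : Fin M → ℝ} {A : Fin M}
    (hs : IsStage lam A) {e : ℝ}
    (he : ∀ (μ : ℝ) (u : Pos M n → ℝ), u ≠ 0 → posR n lam A *ᵥ u = μ • u → μ ≠ 0 → e ≤ μ)
    {ℓ : ℕ} (hℓ : topStep n A + 1 = firstStep A + ℓ) (hℓ1 : 2 ≤ ℓ) :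
    e * (ℓ * (ℓ + 1)) ≤ 12 := by
  classical
  -- Linear in the time step of A, and centred so that the sum over the moved positions vanishes;
  -- this makes w orthogonal to the kernel of `posR`.
  set w : Pos M n → ℝ := fun x =>
    ind (movedSet n A) x * (2 * ((x A : ℕ) : ℝ) - (2 * firstStep A + (ℓ - 1))) with hw
  have hw0 : ∀ x, x ∉ movedSet n A → w x = 0 := fun x hx => by
    rw [hw]; simp only; rw [ind_of_notMem hx, zero_mul]
  have hw1 : ∀ x, x ∈ movedSet n A → w x = 2 * ((x A : ℕ) : ℝ) - (2 * firstStep A + (ℓ - 1)) :=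
    fun x hx => by rw [hw]; simp only; rw [ind_of_mem hx, one_mul]
  have h1 : ind (startSet n A) ⬝ᵥ w = 0 := by
    rw [ind_dotProduct]
    exact Finset.sum_eq_zero fun x hx =>
      hw0 x (Finset.disjoint_left.1 (disjoint_startSet_movedSet A) hx)
  have h2 : ind (movedSet n A) ⬝ᵥ w = 0 := by
    rw [ind_dotProduct, Finset.sum_congr rfl hw1,
      sum_movedSet hM hℓ fun k => 2 * (k : ℝ) - (2 * firstStep A + (ℓ - 1))]
    have h3 : ∀ i : ℕ, 2 * ((firstStep A + i : ℕ) : ℝ) - (2 * firstStep A + (ℓ - 1)) =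
        2 * (i : ℝ) - (ℓ - 1) := fun i => by push_cast; ring
    simp only [h3]
    rw [sum_range_affine]
    ring
  have h3 : w ⬝ᵥ w = 4 ^ A.val * (ℓ * (ℓ ^ 2 - 1) / 3) := by
    rw [dotProduct, ← Finset.sum_subset (Finset.subset_univ (movedSet n A))
      (fun x _ hx => by rw [hw0 x hx, zero_mul]),
      Finset.sum_congr rfl fun x hx => by rw [hw1 x hx, ← pow_two],
      sum_movedSet hM hℓ fun k => (2 * (k : ℝ) - (2 * firstStep A + (ℓ - 1))) ^ 2]
    have h3 : ∀ i : ℕ, 2 * ((firstStep A + i : ℕ) : ℝ) - (2 * firstStep A + (ℓ - 1)) =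
        2 * (i : ℝ) - (ℓ - 1) := fun i => by push_cast; ring
    simp only [h3]
    rw [sum_range_affine_sq]
    ring
  set S := (movedSet n A).filter fun x => (x A : ℕ) ∈ Finset.Icc (firstStep A + 1) (topStep n A)
    with hS
  have hScard : (S.card : ℝ) = (ℓ - 1) * 4 ^ A.val := by
    rw [hS, movedSet_filter hM A _ (Finset.Icc_subset_Icc_left (Nat.le_succ _)), Nat.card_Icc,
      show topStep n A + 1 - (firstStep A + 1) = ℓ - 1 by omega]
    push_cast [show 1 ≤ ℓ by omega]
    ring
  -- The moves along which w changes. Each changes it by 2, costing 4, and is determined by its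
  -- target, because A has only one gate at a given time.
  let T : Finset (GateLabel M n × Pos M n × Pos M n) := Finset.univ.filter fun p =>
    GateMove n p.1 p.2.1 p.2.2 ∧ ¬ IsFirstGate p.1 A ∧ (A = p.1.1 ∨ A = p.1.2.1) ∧
      p.2.2 ∈ movedSet n A
  have hT : T.card ≤ S.card := by
    refine Finset.card_le_card_of_injOn (fun p => p.2.2) (fun p hp => ?_) ?_
    · obtain ⟨-, hg, hf, hA, hm⟩ := Finset.mem_filter.1 hp
      have hval := hg.val_of_mem hA
      have hmA := mem_movedSet.1 hm
      have htop := ((active_iff_chainSet hM).1 hmA.1).2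
      have hge := hg.1.firstStep_le hA
      have hne : (p.1.2.2 : ℕ) ≠ firstStep A := by
        intro h
        have h5 := hg.1
        rw [h] at h5
        obtain ⟨h6, h7⟩ := h5.unique (isGate_firstStep n A) hA (Or.inl rfl)
        exact hf ⟨h6, h7, h⟩
      refine Finset.mem_filter.2 ⟨hm, Finset.mem_Icc.2 ⟨?_, htop⟩⟩
      beta_reduce
      omega
    · rintro ⟨g, x, y⟩ hp ⟨g', x', y'⟩ hp' hyy
      obtain ⟨-, hg, hf, hA, hm⟩ := Finset.mem_filter.1 hp
      obtain ⟨-, hg', hf', hA', hm'⟩ := Finset.mem_filter.1 hp'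
      simp only at hyy hg hg' hA hA'
      subst hyy
      have hi : (g.2.2 : ℕ) = g'.2.2 := (hg.val_of_mem hA).2.symm.trans (hg'.val_of_mem hA').2
      have h5 := hg.1
      rw [hi] at h5
      obtain ⟨h6, h7⟩ := h5.unique hg'.1 hA hA'
      have hgg : g = g' := Prod.ext h6 (Prod.ext h7 (Fin.ext hi))
      subst hgg
      have hxx : x = x' := hop.right_unique hg.2 hg'.2
      subst hxx
      rfl
  have hform : w ⬝ᵥ posR n lam A *ᵥ w ≤ 4 * S.card := by
    rw [dotProduct_posR_eq]
    have hp0 : ∑ x, potential lam x * w x ^ 2 = 0 := Finset.sum_eq_zero fun x _ => by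
      by_cases hx : x ∈ movedSet n A
      · rw [hs.potential_eq_zero (mem_movedSet.1 hx).1, zero_mul]
      · rw [hw0 x hx]; ring
    rw [hp0, zero_add]
    have hle : ∀ g : GateLabel M n, (if IsGate n g.1 g.2.1 g.2.2 ∧ ¬ IsFirstGate g A then
        moveForm n g.1 g.2.1 g.2.2 (gateCoef lam g.1 g.2.1 g.2.2) w else 0) ≤
        ∑ x, ∑ y, if (g, x, y) ∈ T then (4 : ℝ) else 0 := by
      intro g
      split_ifs with hg
      swap
      · refine Finset.sum_nonneg fun x _ => Finset.sum_nonneg fun y _ => ?_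
        split_ifs <;> norm_num
      refine Finset.sum_le_sum fun x _ => Finset.sum_le_sum fun y _ => ?_
      have hnn : (0 : ℝ) ≤ if (g, x, y) ∈ T then (4 : ℝ) else 0 := by split_ifs <;> norm_num
      by_cases hxy : hop n g.1 g.2.1 g.2.2 ((g.2.2 : ℕ) - 1) y x
      swap
      · rw [if_neg hxy]
        exact hnn
      rw [if_pos hxy]
      have hm : GateMove n g x y := ⟨hg.1, hxy⟩
      have hind := (hm.ind_eq hs hg.2).2
      by_cases hy : y ∈ movedSet n A
      · have hc := hm.coef_of_active hs hg.2 (mem_movedSet.1 hy).1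
        have hx : x ∈ movedSet n A := by
          by_contra hx
          rw [ind_of_mem hy, ind_of_notMem hx, mul_zero] at hind
          exact one_ne_zero hind
        rw [hc, hw1 x hx, hw1 y hy]
        by_cases hA : A = g.1 ∨ A = g.2.1
        · have hT' : (g, x, y) ∈ T := Finset.mem_filter.2 ⟨Finset.mem_univ _, hm, hg.2, hA, hy⟩
          rw [if_pos hT']
          have hv := hm.val_of_mem hA
          have hpos := hm.pos
          have hyx : ((y A : ℕ) : ℝ) = (x A : ℕ) + 1 := by
            have : (y A : ℕ) = (x A : ℕ) + 1 := by omega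
            rw [this]; push_cast; ring
          rw [hyx]
          exact le_of_eq (by ring)
        · rw [hm.eq_of_not_mem hA]
          refine le_trans (le_of_eq ?_) hnn
          ring
      · rw [ind_of_notMem hy] at hind
        have hz : gateCoef lam g.1 g.2.1 g.2.2 * w x = 0 := by
          rw [hw]; simp only
          rw [← mul_assoc, ← hind, zero_mul]
        rw [hz, hw0 y hy]
        refine le_trans (le_of_eq ?_) hnn
        ring
    refine (Finset.sum_le_sum fun g _ => hle g).trans ?_
    have hsum : (∑ g : GateLabel M n, ∑ x : Pos M n, ∑ y : Pos M n,
        if (g, x, y) ∈ T then (4 : ℝ) else 0) = 4 * T.card := by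
      have : (∑ p : GateLabel M n × Pos M n × Pos M n, if p ∈ T then (4 : ℝ) else 0) =
          4 * T.card := by
        rw [Finset.sum_ite_mem, Finset.univ_inter, Finset.sum_const, nsmul_eq_mul, mul_comm]
      rw [← this, Fintype.sum_prod_type fun p : GateLabel M n × Pos M n × Pos M n =>
        if p ∈ T then (4 : ℝ) else 0]
      exact Finset.sum_congr rfl fun g _ =>
        (Fintype.sum_prod_type fun q : Pos M n × Pos M n => if (g, q) ∈ T then (4 : ℝ) else 0).symm
    rw [hsum]
    exact mul_le_mul_of_nonneg_left (Nat.cast_le.2 hT) (by norm_num)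
  have key := (hs.posR_form_ge he h1 h2).trans hform
  rw [h3, hScard] at key
  have h4 : (0 : ℝ) < 4 ^ A.val := by positivity
  have hℓr : (2 : ℝ) ≤ ℓ := by exact_mod_cast hℓ1
  have h5 : 0 < (ℓ - 1 : ℝ) * 4 ^ A.val / 3 := by
    have : (0 : ℝ) < ℓ - 1 := by linarith
    positivity
  -- The norm ℓ(ℓ² - 1)/3 against the energy 4(ℓ - 1), both times 4 ^ A.val, leaves 12 / (ℓ(ℓ + 1)).
  refine le_of_mul_le_mul_left ?_ h5
  linear_combination key

/-! ### Blocks with a nonzero bit -/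

/-- A shared qubit would give both gates the same time step, and a qubit has only one gate at a
time. -/
theorem GateMove.disjoint_of_source {M n : ℕ} {l k : GateLabel M n} {x y x' : Pos M n}
    (h : GateMove n l x y) (h' : GateMove n k x x') (hlk : l ≠ k) {D : Fin M}
    (hD : D = l.1 ∨ D = l.2.1) : ¬ (D = k.1 ∨ D = k.2.1) := by
  intro hD'
  have h1 := (h.val_of_mem hD).1
  have h2 := (h'.val_of_mem hD').1
  have h3 := h.pos
  have h4 := h'.pos
  have hi : (l.2.2 : ℕ) = k.2.2 := by omega
  have h5 := h.1
  rw [hi] at h5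
  obtain ⟨h6, h7⟩ := h5.unique h'.1 hD hD'
  exact hlk (Prod.ext h6 (Prod.ext h7 (Fin.ext hi)))

theorem GateMove.disjoint_of_target {M n : ℕ} {l k : GateLabel M n} {x y y' : Pos M n}
    (h : GateMove n l x y) (h' : GateMove n k y' y) (hlk : l ≠ k) {D : Fin M}
    (hD : D = l.1 ∨ D = l.2.1) : ¬ (D = k.1 ∨ D = k.2.1) := by
  intro hD'
  have hi : (l.2.2 : ℕ) = k.2.2 := (h.val_of_mem hD).2.symm.trans (h'.val_of_mem hD').2
  have h5 := h.1
  rw [hi] at h5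
  obtain ⟨h6, h7⟩ := h5.unique h'.1 hD hD'
  exact hlk (Prod.ext h6 (Prod.ext h7 (Fin.ext hi)))

theorem Pos.setPair_of_not_mem {M n : ℕ} (x : Pos M n) {A B D : Fin M} {k : ℕ}
    (hk : ∀ D, D = A ∨ D = B → k ∈ Finset.Icc (firstStep D - 1) (lastStep n D))
    (hD : ¬ (D = A ∨ D = B)) : x.setPair A B k hk D = x D := dif_neg hD

theorem Pos.setPair_val {M n : ℕ} (x : Pos M n) {A B D : Fin M} {k : ℕ}
    (hk : ∀ D, D = A ∨ D = B → k ∈ Finset.Icc (firstStep D - 1) (lastStep n D))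
    (hD : D = A ∨ D = B) : (x.setPair A B k hk D : ℕ) = k := by
  unfold Pos.setPair
  rw [dif_pos hD]

theorem gateMove_of_val {M n : ℕ} {g : GateLabel M n} {x y : Pos M n}
    (hg : IsGate n g.1 g.2.1 g.2.2) (h1 : ∀ D, ¬ (D = g.1 ∨ D = g.2.1) → x D = y D)
    (h2 : ∀ D, D = g.1 ∨ D = g.2.1 → (x D : ℕ) = g.2.2 - 1 ∧ (y D : ℕ) = g.2.2) :
    GateMove n g x y :=
  ⟨hg, fun D hA hB => (h1 D (by tauto)).symm, (h2 _ (Or.inl rfl)).2, (h2 _ (Or.inr rfl)).2,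
    (h2 _ (Or.inl rfl)).1, (h2 _ (Or.inr rfl)).1⟩

/-- Different gates available at one position act on disjoint qubits, so performing one does not
affect the other. -/
theorem commutingMoves_gateMove (M n : ℕ) :
    CommutingMoves (fun (g : GateLabel M n) (x y : Pos M n) => GateMove n g x y) where
  target h h' := hop.left_unique h.2 h'.2
  source h h' := hop.right_unique h.2 h'.2
  up := by
    intro l k x y x' h h' hlk
    have hdis := fun D => h.disjoint_of_source h' hlk (D := D)
    let y' := y.setPair k.1 k.2.1 k.2.2 fun D hD => h'.1.mem hD
    refine ⟨y', gateMove_of_val h'.1 (fun D hD => (y.setPair_of_not_mem _ hD).symm)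
      fun D hD => ⟨?_, y.setPair_val _ hD⟩, gateMove_of_val h.1 (fun D hD => ?_) fun D hD => ?_⟩
    · have h1 : ¬ (D = l.1 ∨ D = l.2.1) := fun h2 => hdis D h2 hD
      rw [← h.eq_of_not_mem h1]
      exact (h'.val_of_mem hD).1
    · by_cases hDk : D = k.1 ∨ D = k.2.1
      · refine Subtype.ext ((h'.val_of_mem hDk).2.trans (y.setPair_val _ hDk).symm)
      · rw [← h'.eq_of_not_mem hDk, h.eq_of_not_mem hD]
        exact (y.setPair_of_not_mem _ hDk).symm
    · have hDk := hdis D hD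
      rw [← h'.eq_of_not_mem hDk, show y' D = y D from y.setPair_of_not_mem _ hDk]
      exact h.val_of_mem hD
  down := by
    intro l k x y y' h h' hlk
    have hdis := fun D => h.disjoint_of_target h' hlk (D := D)
    let x' := x.setPair k.1 k.2.1 (k.2.2 - 1) fun D hD => h'.1.pred_mem hD
    refine ⟨x', gateMove_of_val h'.1 (fun D hD => x.setPair_of_not_mem _ hD)
      fun D hD => ⟨x.setPair_val _ hD, ?_⟩, gateMove_of_val h.1 (fun D hD => ?_) fun D hD => ?_⟩
    · have h1 : ¬ (D = l.1 ∨ D = l.2.1) := fun h2 => hdis D h2 hD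
      rw [h.eq_of_not_mem h1]
      exact (h'.val_of_mem hD).2
    · by_cases hDk : D = k.1 ∨ D = k.2.1
      · exact Subtype.ext ((x.setPair_val _ hDk).trans (h'.val_of_mem hDk).1.symm)
      · rw [h'.eq_of_not_mem hDk, ← h.eq_of_not_mem hD]
        exact x.setPair_of_not_mem _ hDk
    · have hDk := hdis D hD
      rw [h'.eq_of_not_mem hDk, show x' D = x D from x.setPair_of_not_mem _ hDk]
      exact h.val_of_mem hD

open Classical in
/-- The part of the potential that is used in a block in which the bit of `B` is one. -/
noncomputable def startPotential (n : ℕ) {M : ℕ} (B : Fin M) (x : Pos M n) : ℝ :=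
  if Legal n x → (x B : ℕ) = firstStep B - 1 then 1 else 0

theorem startPotential_nonneg {M n : ℕ} (B : Fin M) (x : Pos M n) :
    0 ≤ startPotential n B x := by
  unfold startPotential
  split_ifs <;> norm_num

theorem startPotential_le_one {M n : ℕ} (B : Fin M) (x : Pos M n) :
    startPotential n B x ≤ 1 := by
  unfold startPotential
  split_ifs <;> norm_num

/-- No move brings a qubit back to its start, and legality is invariant. The killing term thus never
increases along moves, as the comparison argument requires. -/
theorem GateMove.startPotential_le {M n : ℕ} {g : GateLabel M n} {x y : Pos M n}
    (h : GateMove n g x y) (B : Fin M) : startPotential n B y ≤ startPotential n B x := by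
  by_cases hy : Legal n y → (y B : ℕ) = firstStep B - 1
  · have hx : Legal n x → (x B : ℕ) = firstStep B - 1 := by
      intro hl
      have h1 := hy (h.legal_iff.1 hl)
      have hB : ¬ (B = g.1 ∨ B = g.2.1) := by
        intro hB
        have h2 := (h.val_of_mem hB).2
        have h3 := h.1.firstStep_le hB
        have := firstStep_pos B
        omega
      rw [h.eq_of_not_mem hB, h1]
    refine (startPotential_le_one B y).trans (le_of_eq ?_)
    exact (if_pos hx).symm
  · refine le_trans (le_of_eq ?_) (startPotential_nonneg B x)
    exact if_neg hy

/-- At illegal positions the penalty alone suffices; at legal ones with B at its start the input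
term for B does. -/
theorem startPotential_le {M n : ℕ} {lam : Fin M → ℝ} (h : ∀ B, 0 ≤ lam B ∧ lam B ≤ 1)
    {b : Bits M} {B : Fin M} (hb : b B = 1) (x : Pos M n) :
    startPotential n B x ≤ potential lam x + initCount x b := by
  have hnn : ∀ A : Fin M, (0 : ℝ) ≤
      if (x A : ℕ) = firstStep A - 1 ∧ b A = 1 then 1 else 0 := by
    intro A
    split_ifs <;> norm_num
  have hi : 0 ≤ initCount x b := Finset.sum_nonneg fun A _ => hnn A
  have hp := potential_nonneg h x
  unfold startPotential
  split_ifs with hx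
  swap
  · linarith
  by_cases hl : Legal n x
  · have : 1 ≤ initCount x b := by
      refine le_trans ?_ (Finset.single_le_sum (fun A _ => hnn A) (Finset.mem_univ B))
      rw [if_pos ⟨hx hl, hb⟩]
    linarith
  · linarith [one_le_potential h hl]

theorem gateCoef_mem {M : ℕ} {lam : Fin M → ℝ} (h : ∀ B, 0 ≤ lam B ∧ lam B ≤ 1)
    (A B : Fin M) (i : ℕ) : 0 ≤ gateCoef lam A B i ∧ gateCoef lam A B i ≤ 1 := by
  unfold gateCoef
  split_ifs
  · exact h A
  · norm_num

open Classical in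
theorem gatesForm_eq {M n : ℕ} (lam : Fin M → ℝ) (f : Pos M n → ℝ) :
    gatesForm n lam f = ∑ g : GateLabel M n, ∑ x, ∑ y, if GateMove n g x y then
      (f y - gateCoef lam g.1 g.2.1 g.2.2 * f x) ^ 2 else 0 := by
  unfold gatesForm moveForm GateMove
  refine Finset.sum_congr rfl fun g _ => ?_
  split_ifs with hg
  · refine Finset.sum_congr rfl fun x _ => Finset.sum_congr rfl fun y _ => ?_
    by_cases hxy : hop n g.1 g.2.1 g.2.2 ((g.2.2 : ℕ) - 1) y x
    · rw [if_pos hxy, if_pos ⟨hg, hxy⟩]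
    · rw [if_neg hxy, if_neg fun h => hxy h.2]
  · refine (Finset.sum_eq_zero fun x _ => Finset.sum_eq_zero fun y _ => if_neg fun h => ?_).symm
    exact hg h.1

/-- Splitting a function into its legal and its illegal part. -/
theorem gatesForm_split {M n : ℕ} (lam : Fin M → ℝ) {f g h : Pos M n → ℝ}
    (hg : ∀ x, Legal n x → g x = f x ∧ h x = 0) (hh : ∀ x, ¬ Legal n x → g x = 0 ∧ h x = f x) :
    gatesForm n lam g ≤ gatesForm n lam f := by
  classical
  rw [gatesForm_eq, gatesForm_eq]
  refine Finset.sum_le_sum fun l _ => Finset.sum_le_sum fun x _ => Finset.sum_le_sum fun y _ => ?_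
  split_ifs with hxy
  · by_cases hx : Legal n x
    · rw [(hg x hx).1, (hg y (hxy.legal_iff.1 hx)).1]
    · rw [(hh x hx).1, (hh y (hxy.legal_iff.not.1 hx)).1, mul_zero, sub_zero, zero_pow two_ne_zero]
      exact sq_nonneg _
  · exact le_rfl

theorem isStage_one {M : ℕ} {T : Fin M} (hT : T.val + 1 = M) :
    IsStage (fun _ : Fin M => (1 : ℝ)) T where
  before _ _ := rfl
  after B hB := absurd (Fin.lt_def.1 hB) (by have := B.2; omega)
  nonneg := zero_le_one
  le_one := le_rfl
  lt_or_last := Or.inr hT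

theorem active_last {M n : ℕ} {T : Fin M} (hT : T.val + 1 = M) {x : Pos M n} :
    Active n T x ↔ Legal n x :=
  ⟨fun h => h.1, fun h => ⟨h, fun B hB => absurd (Fin.lt_def.1 hB) (by have := B.2; omega)⟩⟩

theorem groundVec_one {M n : ℕ} {T : Fin M} (hT : T.val + 1 = M) (x : Pos M n) :
    (Legal n x → groundVec n T 1 x = 1) ∧ (¬ Legal n x → groundVec n T 1 x = 0) := by
  simp only [groundVec, Pi.add_apply, Pi.smul_apply, smul_eq_mul, one_mul]
  constructor
  · intro hx
    by_cases h : (x T : ℕ) = firstStep T - 1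
    · rw [ind_of_mem (mem_startSet.2 ⟨(active_last hT).2 hx, h⟩),
        ind_of_notMem fun h' => (mem_movedSet.1 h').2 h, add_zero]
    · rw [ind_of_mem (mem_movedSet.2 ⟨(active_last hT).2 hx, h⟩),
        ind_of_notMem fun h' => h (mem_startSet.1 h').2, zero_add]
  · intro hx
    rw [ind_of_notMem fun h => hx (mem_startSet.1 h).1.1,
      ind_of_notMem fun h => hx (mem_movedSet.1 h).1.1, add_zero]

/-- The undamped energy with a killing term at the start of `B`. -/
theorem gatesForm_one_add_startPotential_ge {M n : ℕ} {T : Fin M} (hT : T.val + 1 = M) {e : ℝ}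
    (he0 : 0 < e)
    (he : ∀ (μ : ℝ) (u : Pos M n → ℝ), u ≠ 0 → posR n (fun _ => 1) T *ᵥ u = μ • u → μ ≠ 0 → e ≤ μ)
    (B : Fin M) {s m σ μ : ℝ} (hs : s = (startSet n T).card) (hm : m = (movedSet n T).card)
    (hσ : σ = (legalStart n B).card) (hs0 : 0 < s) (hm0 : 0 < m) (hσ0 : 0 < σ) (hμ1 : μ ≤ 1)
    (hμ : μ * ((e * (s + m) + (e + 2) * m) * (s + m)) ≤ e * (s + m) * σ) (f : Pos M n → ℝ) :
    μ * ∑ x, f x ^ 2 ≤ gatesForm n (fun _ => 1) f + ∑ x, startPotential n B x * f x ^ 2 := by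
  classical
  have hstage := isStage_one hT
  -- Moves preserve legality, so the two parts do not interact. The illegal part already has killing
  -- term one, which is at least μ.
  let g : Pos M n → ℝ := fun x => if Legal n x then f x else 0
  let h : Pos M n → ℝ := fun x => if Legal n x then 0 else f x
  have hg : ∀ x, Legal n x → g x = f x ∧ h x = 0 := fun x hx => ⟨if_pos hx, if_pos hx⟩
  have hh : ∀ x, ¬ Legal n x → g x = 0 ∧ h x = f x := fun x hx => ⟨if_neg hx, if_neg hx⟩
  have hgates := gatesForm_split (fun _ => (1 : ℝ)) hg hh
  have hsq : ∑ x, f x ^ 2 = g ⬝ᵥ g + ∑ x, h x ^ 2 := by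
    rw [dotProduct, ← Finset.sum_add_distrib]
    refine Finset.sum_congr rfl fun x _ => ?_
    by_cases hx : Legal n x
    · rw [(hg x hx).1, (hg x hx).2]; ring
    · rw [(hh x hx).1, (hh x hx).2]; ring
  have hV : ∑ x, startPotential n B x * f x ^ 2 =
      (∑ x ∈ legalStart n B, g x ^ 2) + ∑ x, h x ^ 2 := by
    rw [← ind_dotProduct (legalStart n B) (fun x => g x ^ 2), dotProduct, ← Finset.sum_add_distrib]
    refine Finset.sum_congr rfl fun x _ => ?_
    by_cases hx : Legal n x
    · rw [(hg x hx).1, (hg x hx).2]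
      by_cases hxB : (x B : ℕ) = firstStep B - 1
      · rw [ind_of_mem (mem_legalStart.2 ⟨hx, hxB⟩), startPotential, if_pos fun _ => hxB]
        ring
      · rw [ind_of_notMem fun h => hxB (mem_legalStart.1 h).2, startPotential,
          if_neg fun h => hxB (h hx)]
        ring
    · rw [(hh x hx).1, (hh x hx).2, startPotential, if_pos fun h => absurd h hx]
      ring
  have hQ : g ⬝ᵥ posH n (fun _ => 1) *ᵥ g = gatesForm n (fun _ => 1) g := by
    rw [dotProduct_posH, Finset.sum_eq_zero fun x _ => ?_, zero_add]
    by_cases hx : Legal n x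
    · rw [hstage.potential_eq_zero ((active_last hT).2 hx), zero_mul]
    · rw [(hh x hx).1]; ring
  set u := groundVec n T 1 with hu
  have huu : u ⬝ᵥ u = s + m := by
    rw [hu, groundVec_dotProduct_self, ← hs, ← hm]; ring
  have hsm : 0 < s + m := add_pos hs0 hm0
  set α := (u ⬝ᵥ g) / (u ⬝ᵥ u) with hα
  set w := g - α • u with hw
  have hgw : g = α • u + w := by rw [hw]; abel
  have huw : u ⬝ᵥ w = 0 := by
    rw [hw, dotProduct_sub, dotProduct_smul, smul_eq_mul, hα,
      div_mul_cancel₀ _ (huu ▸ hsm.ne'), sub_self]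
  -- The zero-bit gap at λ = 1; the undamped form vanishes on the indicator u of the legal
  -- positions.
  have hX : e * (s + m) / ((e + 2) * m) * (w ⬝ᵥ w) ≤ gatesForm n (fun _ => 1) g := by
    have h1 := dotProduct_mulVec_add_ker (posH_transpose (n := n) fun _ : Fin M => (1 : ℝ))
      hstage.posH_mulVec_groundVec w α
    rw [← hu, ← hgw, hQ] at h1
    have h2 := hstage.posH_form_ge he0 he (Nat.cast_pos.1 (hs ▸ hs0)) huw
    rw [← h1, ← hs, ← hm] at h2
    rw [div_mul_eq_mul_div, div_le_iff₀ (by positivity)]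
    linarith
  have hmem : ∀ x ∈ legalStart n B, u x = 1 := fun x hx =>
    (groundVec_one hT x).1 (mem_legalStart.1 hx).1
  have hξu : ind (legalStart n B) ⬝ᵥ u = σ := by
    rw [ind_dotProduct, Finset.sum_congr rfl hmem, hσ]
    simp
  have hξξ : ind (legalStart n B) ⬝ᵥ ind (legalStart n B) = σ := by
    rw [ind_dotProduct_of_subset (Finset.Subset.refl _), hσ]
  have hY : 1 * (ind (legalStart n B) ⬝ᵥ g) ^ 2 ≤
      (∑ x ∈ legalStart n B, g x ^ 2) * (ind (legalStart n B) ⬝ᵥ ind (legalStart n B)) := by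
    rw [hξξ, ind_dotProduct, one_mul, mul_comm, hσ]
    exact sq_sum_le_card_mul_sum_sq
  have hG : 0 < e * (s + m) / ((e + 2) * m) := by positivity
  -- With G the gap in `hX`, this bounds the energy by G / (G + 1) times the fraction σ / (s + m) of
  -- legal positions with B at its start, which is the condition `hμ` on μ.
  have key := two_form_bound u (ind (legalStart n B)) g w α _ 1 _ _ hG one_pos hgw huw hX hY
  rw [hξu, hξξ, huu] at key
  set Z := gatesForm n (fun _ => 1) g + ∑ x ∈ legalStart n B, g x ^ 2 with hZ
  have hgg : 0 ≤ g ⬝ᵥ g := Finset.sum_nonneg fun x _ => mul_self_nonneg (g x)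
  have hR : 0 < (e + 2) * m := by positivity
  have key2 : e * (s + m) * σ * (g ⬝ᵥ g) ≤ Z * ((e * (s + m) + (e + 2) * m) * (s + m)) := by
    have h1 : σ * (e * (s + m) * σ * (g ⬝ᵥ g)) ≤
        σ * (Z * ((e * (s + m) + (e + 2) * m) * (s + m))) := by
      have h2 := mul_le_mul_of_nonneg_left key hR.le
      have h3 : (e + 2) * m * (e * (s + m) / ((e + 2) * m) * 1 * σ ^ 2 * (g ⬝ᵥ g)) =
          σ * (e * (s + m) * σ * (g ⬝ᵥ g)) := by field_simp
      have h4 : (e + 2) * m * (Z * (e * (s + m) / ((e + 2) * m) + 1) * σ * (s + m)) =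
          σ * (Z * ((e * (s + m) + (e + 2) * m) * (s + m))) := by field_simp
      rwa [h3, h4] at h2
    exact le_of_mul_le_mul_left h1 hσ0
  have hD : 0 < (e * (s + m) + (e + 2) * m) * (s + m) := by positivity
  have key3 : μ * (g ⬝ᵥ g) ≤ Z := by
    have h1 := mul_le_mul_of_nonneg_right hμ hgg
    refine le_of_mul_le_mul_right ?_ hD
    linarith
  have hh2 : 0 ≤ ∑ x, h x ^ 2 := Finset.sum_nonneg fun x _ => sq_nonneg _
  have key4 : μ * ∑ x, h x ^ 2 ≤ ∑ x, h x ^ 2 := mul_le_of_le_one_left hh2 hμ1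
  rw [hsq, hV, mul_add]
  linarith

/-- The killing term used does not depend on λ, and first gates with λ ≤ 1 are damped moves, so the
comparison theorem transfers the bound at λ = 1 to all parameters. -/
theorem blockForm_ge_of_bit {M n : ℕ} {T : Fin M} (hT : T.val + 1 = M) {e : ℝ}
    (he0 : 0 < e)
    (he : ∀ (μ : ℝ) (u : Pos M n → ℝ), u ≠ 0 → posR n (fun _ => 1) T *ᵥ u = μ • u → μ ≠ 0 → e ≤ μ)
    {b : Bits M} {B : Fin M} (hb : b B = 1) {lam : Fin M → ℝ}
    (hlam : ∀ B, 0 ≤ lam B ∧ lam B ≤ 1)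
    {s m σ μ : ℝ} (hs : s = (startSet n T).card) (hm : m = (movedSet n T).card)
    (hσ : σ = (legalStart n B).card) (hs0 : 0 < s) (hm0 : 0 < m) (hσ0 : 0 < σ) (hμ1 : μ ≤ 1)
    (hμ : μ * ((e * (s + m) + (e + 2) * m) * (s + m)) ≤ e * (s + m) * σ) (f : Pos M n → ℝ) :
    μ * ∑ x, f x ^ 2 ≤ blockForm (posH n lam) b f := by
  classical
  have h1 : ∀ f : Pos M n → ℝ, μ * (∑ x, f x ^ 2) ≤
      (∑ l : GateLabel M n, ∑ x, ∑ y, if GateMove n l x y then (f y - f x) ^ 2 else 0) +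
        ∑ x, startPotential n B x * f x ^ 2 := by
    intro f
    have h2 := gatesForm_one_add_startPotential_ge hT he0 he B hs hm hσ hs0 hm0 hσ0 hμ1 hμ f
    rw [gatesForm_eq] at h2
    have h3 : ∀ (A B : Fin M) (i : ℕ), gateCoef (fun _ : Fin M => (1 : ℝ)) A B i = 1 :=
      fun A B i => ite_self 1
    simp only [h3, one_mul] at h2
    exact h2
  have h2 := (commutingMoves_gateMove M n).damped_form_ge (V := startPotential n B)
    (startPotential_le_one B) (fun l x y hxy => hxy.startPotential_le B) h1
    (fun l => gateCoef lam l.1 l.2.1 l.2.2) (fun l => (gateCoef_mem hlam _ _ _).1)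
    (fun l => (gateCoef_mem hlam _ _ _).2) f
  refine h2.trans ?_
  rw [blockForm, dotProduct_posH, gatesForm_eq]
  have h3 : ∑ x, startPotential n B x * f x ^ 2 ≤
      (∑ x, potential lam x * f x ^ 2) + ∑ x, initCount x b * f x ^ 2 := by
    rw [← Finset.sum_add_distrib]
    refine Finset.sum_le_sum fun x _ => ?_
    rw [← add_mul]
    exact mul_le_mul_of_nonneg_right (startPotential_le hlam hb x) (sq_nonneg _)
  linarith

/-! ### The parameters -/

theorem ramp_of_one_le {x : ℝ} (hx : 1 ≤ x) : ramp x = 1 := by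
  rw [ramp, if_neg (by linarith), if_pos hx]

theorem ramp_of_nonpos {x : ℝ} (hx : x ≤ 0) : ramp x = 0 := if_pos hx

theorem ramp_mem {x : ℝ} : 0 ≤ ramp x ∧ ramp x ≤ 1 := by
  unfold ramp
  split_ifs with h0 h1
  · norm_num
  · norm_num
  · push Not at h0 h1
    constructor
    · have : 10 * x ^ 3 - 15 * x ^ 4 + 6 * x ^ 5 = x ^ 3 * (6 * (x - 5 / 4) ^ 2 + 5 / 8) := by ring
      rw [this]
      positivity
    · have h2 : 0 ≤ (1 - x) ^ 3 * (1 + 3 * x + 6 * x ^ 2) := by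
        have : 0 < 1 - x := by linarith
        positivity
      linarith [h2, show (1 - x) ^ 3 * (1 + 3 * x + 6 * x ^ 2) =
        1 - (10 * x ^ 3 - 15 * x ^ 4 + 6 * x ^ 5) by ring]

theorem ramp_lt_one {x : ℝ} (hx : x < 1) : ramp x < 1 := by
  unfold ramp
  split_ifs with h0 h1
  · norm_num
  · linarith
  · push Not at h0 h1
    have h2 : 0 < (1 - x) ^ 3 * (1 + 3 * x + 6 * x ^ 2) := by
      have : 0 < 1 - x := by linarith
      positivity
    linarith [h2, show (1 - x) ^ 3 * (1 + 3 * x + 6 * x ^ 2) =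
      1 - (10 * x ^ 3 - 15 * x ^ 4 + 6 * x ^ 5) by ring]

theorem lam_eq {M : ℕ} (l : ℝ) (A : Fin M) : lam l A = ramp (M * l - A.val) := by
  rw [lam, label]
  push_cast
  rw [add_sub_cancel_right]

theorem isStage_lam {M : ℕ} [NeZero M] {l : ℝ} (hl : l ∈ Set.Icc (0 : ℝ) 1) :
    IsStage (lam l) (activeQubit M l) := by
  have hMpos : 0 < M := Nat.pos_of_ne_zero (NeZero.ne M)
  have hMl : 0 ≤ (M : ℝ) * l := mul_nonneg (Nat.cast_nonneg M) hl.1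
  have hval : (activeQubit M l).val = min ⌊(M : ℝ) * l⌋₊ (M - 1) := rfl
  refine ⟨fun B hB => ?_, fun B hB => ?_, ?_, ?_, ?_⟩
  · rw [lam_eq]
    apply ramp_of_one_le
    rw [Fin.lt_def, hval] at hB
    have h1 : B.val + 1 ≤ ⌊(M : ℝ) * l⌋₊ := by omega
    have h2 : ((B.val + 1 : ℕ) : ℝ) ≤ M * l := (Nat.cast_le.2 h1).trans (Nat.floor_le hMl)
    push_cast at h2
    linarith
  · rw [lam_eq]
    apply ramp_of_nonpos
    rw [Fin.lt_def, hval] at hB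
    have h1 : ⌊(M : ℝ) * l⌋₊ + 1 ≤ B.val := by have := B.2; omega
    have h2 : (M : ℝ) * l ≤ B.val := (Nat.lt_floor_add_one _).le.trans (by exact_mod_cast h1)
    linarith
  · rw [lam_eq]; exact ramp_mem.1
  · rw [lam_eq]; exact ramp_mem.2
  · by_cases h : (activeQubit M l).val + 1 = M
    · exact Or.inr h
    · left
      rw [lam_eq]
      apply ramp_lt_one
      have h1 : ⌊(M : ℝ) * l⌋₊ = (activeQubit M l).val := by omega
      rw [← h1]
      linarith [Nat.lt_floor_add_one ((M : ℝ) * l)]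

/-- When λ_A is small the start weight is close to one and the value under the infimum may be too
large. A parameter of the same stage with λ_A bounded below avoids this. -/
theorem exists_later_parameter {M : ℕ} [NeZero M] {l : ℝ} (hl : l ∈ Set.Icc (0 : ℝ) 1) :
    ∃ l' ∈ Set.Icc (0 : ℝ) 1, activeQubit M l' = activeQubit M l ∧
      lam l (activeQubit M l) ≤ lam l' (activeQubit M l) ∧
      1 / 2 ≤ lam l' (activeQubit M l) ^ 2 := by
  set A := activeQubit M l with hA
  have hMpos : (0 : ℝ) < M := Nat.cast_pos.2 (Nat.pos_of_ne_zero (NeZero.ne M))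
  -- Three quarters into the stage the ramp has reached 459/512, whose square exceeds ½.
  have hr : ramp (3 / 4) = 459 / 512 := by
    rw [ramp, if_neg (by norm_num), if_neg (by norm_num)]
    norm_num
  by_cases h : 459 / 512 ≤ lam l A
  · refine ⟨l, hl, rfl, le_rfl, ?_⟩
    nlinarith
  · have hAM : ((A.val + 1 : ℕ) : ℝ) ≤ M := Nat.cast_le.2 A.2
    push_cast at hAM
    have hml : (M : ℝ) * ((A.val + 3 / 4) / M) = A.val + 3 / 4 := by field_simp
    have hlam : lam ((A.val + 3 / 4) / M) A = 459 / 512 := by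
      rw [lam_eq, hml, add_sub_cancel_left, hr]
    refine ⟨(A.val + 3 / 4) / M, ⟨by positivity, ?_⟩, ?_, ?_, ?_⟩
    · rw [div_le_one hMpos]
      linarith
    · refine Fin.ext ?_
      have hfl : ⌊(A.val : ℝ) + 3 / 4⌋₊ = A.val := by
        rw [Nat.floor_eq_iff (by positivity)]
        constructor <;> linarith
      change min ⌊(M : ℝ) * ((A.val + 3 / 4) / M)⌋₊ (M - 1) = A.val
      rw [hml, hfl]
      have := A.2
      omega
    · rw [hlam]
      exact (not_le.1 h).le
    · rw [hlam]
      norm_num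

theorem lam_one {M : ℕ} : lam (M := M) 1 = fun _ => 1 := by
  funext B
  rw [lam_eq]
  apply ramp_of_one_le
  have : ((B.val + 1 : ℕ) : ℝ) ≤ M := Nat.cast_le.2 B.2
  push_cast at this
  linarith

theorem activeQubit_one (M : ℕ) [NeZero M] : (activeQubit M 1).val + 1 = M := by
  have hMpos : 0 < M := Nat.pos_of_ne_zero (NeZero.ne M)
  have : (activeQubit M 1).val = min ⌊(M : ℝ) * 1⌋₊ (M - 1) := rfl
  rw [this, mul_one, Nat.floor_natCast]
  omega

/-! ### The lowest nonzero energy -/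

theorem withInit_mulVec_zero_bits {M n : ℕ} (ℰ : ℝ) (P : Matrix (Pos M n) (Pos M n) ℝ)
    (v : Conf M n → ℂ) (x : Pos M n) :
    (withInit ℰ P *ᵥ v) (conf x 0) = (ℰ : ℂ) * ∑ y, (P x y : ℂ) * v (conf y 0) := by
  rw [withInit_mulVec, initCount, Finset.sum_eq_zero fun A _ => if_neg fun h => ?_]
  · simp
  · simp at h

open Classical in
/-- A real vector on positions, placed in the block with all bits zero. -/
noncomputable def zeroBitVec {M n : ℕ} (u : Pos M n → ℝ) (c : Conf M n) : ℂ :=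
  if bits c = 0 then (u (pos c) : ℂ) else 0

theorem zeroBitVec_zero {M n : ℕ} (u : Pos M n → ℝ) (x : Pos M n) :
    zeroBitVec u (conf x 0) = u x := if_pos rfl

theorem zeroBitVec_ne {M n : ℕ} (u : Pos M n → ℝ) (x : Pos M n) {b : Bits M} (hb : b ≠ 0) :
    zeroBitVec u (conf x b) = 0 := if_neg hb

theorem withInit_mulVec_zeroBitVec {M n : ℕ} (ℰ : ℝ) (P : Matrix (Pos M n) (Pos M n) ℝ)
    (u : Pos M n → ℝ) : withInit ℰ P *ᵥ zeroBitVec u = (ℰ : ℂ) • zeroBitVec (P *ᵥ u) := by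
  funext c
  obtain ⟨x, b, rfl⟩ : ∃ x b, c = conf x b := ⟨pos c, bits c, rfl⟩
  rw [Pi.smul_apply, smul_eq_mul]
  by_cases hb : b = 0
  · subst hb
    rw [withInit_mulVec_zero_bits, zeroBitVec_zero]
    simp only [zeroBitVec_zero, Matrix.mulVec, dotProduct, Complex.ofReal_sum, Complex.ofReal_mul]
  · rw [withInit_mulVec, zeroBitVec_ne _ _ hb]
    simp [zeroBitVec_ne _ _ hb]

theorem mem_nonzeroReducedEnergies {M n : ℕ} [NeZero M] {ℰ l : ℝ} (hℰ : 0 < ℰ) {μ : ℝ}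
    {u : Pos M n → ℝ} (hu : u ≠ 0) (h : posR n (lam l) (activeQubit M l) *ᵥ u = μ • u)
    (hμ : μ ≠ 0) : ℰ * μ ∈ nonzeroReducedEnergies M n ℰ l := by
  refine ⟨⟨zeroBitVec u, ?_, ?_, ?_⟩, mul_ne_zero hℰ.ne' hμ⟩
  · obtain ⟨x, hx⟩ := Function.ne_iff.1 hu
    intro h0
    have := congrFun h0 (conf x 0)
    rw [zeroBitVec_zero] at this
    exact hx (Complex.ofReal_eq_zero.1 this)
  · rintro c ⟨A, hA⟩
    exact if_neg fun h => hA (congrFun h A)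
  · rw [reducedH_eq, withInit_mulVec_zeroBitVec, h]
    funext c
    simp only [Pi.smul_apply, smul_eq_mul, zeroBitVec]
    split_ifs <;> push_cast <;> ring

theorem exists_of_mem_nonzeroReducedEnergies {M n : ℕ} [NeZero M] {ℰ l : ℝ} (hℰ : 0 < ℰ) {μ : ℝ}
    (h : μ ∈ nonzeroReducedEnergies M n ℰ l) :
    μ ≠ 0 ∧ ∃ u : Pos M n → ℝ, u ≠ 0 ∧
      posR n (lam l) (activeQubit M l) *ᵥ u = (μ / ℰ) • u := by
  obtain ⟨⟨v, hv0, hvb, hv⟩, hμ⟩ := h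
  refine ⟨hμ, ?_⟩
  rw [reducedH_eq] at hv
  set P := posR n (lam l) (activeQubit M l)
  have hx : ∀ x, ∑ y, (P x y : ℂ) * v (conf y 0) = ((μ / ℰ : ℝ) : ℂ) * v (conf x 0) := by
    intro x
    have h1 := congrFun hv (conf x 0)
    rw [withInit_mulVec_zero_bits, Pi.smul_apply, smul_eq_mul] at h1
    have h2 : (ℰ : ℂ) ≠ 0 := Complex.ofReal_ne_zero.2 hℰ.ne'
    rw [Complex.ofReal_div, div_mul_eq_mul_div, eq_div_iff h2, ← h1, mul_comm]
  have hre : P *ᵥ (fun x => (v (conf x 0)).re) = (μ / ℰ) • fun x => (v (conf x 0)).re := by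
    funext x
    have h1 := congrArg Complex.re (hx x)
    rw [Complex.re_sum, Complex.re_ofReal_mul] at h1
    simp only [Complex.re_ofReal_mul] at h1
    exact h1
  have him : P *ᵥ (fun x => (v (conf x 0)).im) = (μ / ℰ) • fun x => (v (conf x 0)).im := by
    funext x
    have h1 := congrArg Complex.im (hx x)
    rw [Complex.im_sum, Complex.im_ofReal_mul] at h1
    simp only [Complex.im_ofReal_mul] at h1
    exact h1
  -- The matrix is real, so the real and the imaginary part each satisfy the eigenvalue equation,
  -- and one of them is nonzero.
  by_cases h1 : (fun x : Pos M n => (v (conf x 0)).re) = 0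
  · refine ⟨_, fun h2 => hv0 ?_, him⟩
    funext c
    by_cases hb : bits c = 0
    · have : c = conf (pos c) 0 := by rw [← hb]; rfl
      rw [this]
      exact Complex.ext (congrFun h1 (pos c)) (congrFun h2 (pos c))
    · obtain ⟨A, hA⟩ := Function.ne_iff.1 hb
      exact hvb c ⟨A, hA⟩
  · exact ⟨_, h1, hre⟩

theorem exists_ell {M : ℕ} (n : ℕ) (hn : 0 < n) (hM : Odd M) (A : Fin M) :
    ∃ ℓ : ℕ, topStep n A + 1 = firstStep A + ℓ ∧ 3 ≤ ℓ ∧ ℓ ≤ 4 * n + 2 * M - 1 ∧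
      (A.val + 1 = M → ℓ = 4 * n + 2 * M - 1) := by
  have hAM := A.2
  by_cases hA : A.val + 1 = M
  · have h1 : topStep n A = 2 * (2 * n + M) + 1 := by
      rw [topStep, if_pos hA, lastStep, if_neg]
      rintro ⟨-, h⟩
      unfold label at h
      omega
    have h2 : firstStep A = 3 := by
      rw [firstStep, if_neg]
      rw [label, hA, Nat.not_even_iff_odd]
      exact hM
    exact ⟨4 * n + 2 * M - 1, by omega, by omega, le_rfl, fun _ => rfl⟩
  · refine ⟨3, ?_, le_rfl, by omega, fun h => absurd h hA⟩
    rw [topStep, if_neg hA]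

theorem IsStage.posR_ne_zero {M n : ℕ} (hM : Odd M) (hn : 0 < n) {lam : Fin M → ℝ} {A : Fin M}
    (hs : IsStage lam A) : posR n lam A ≠ 0 := by
  intro h0
  obtain ⟨ℓ, hℓ, hℓ3, -, -⟩ := exists_ell n hn hM A
  -- A zero matrix has no nonzero eigenvalue, so the hypothesis holds vacuously for e = 12, which
  -- the trial function refutes.
  have h := hs.eigenvalue_le (n := n) hM (e := 12) (fun μ u hu h hμ => ?_) hℓ (by omega)
  · have : (3 : ℝ) ≤ ℓ := by exact_mod_cast hℓ3
    nlinarith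
  · rw [h0, Matrix.zero_mulVec] at h
    exact absurd ((smul_eq_zero.1 h.symm).resolve_right hu) hμ

theorem dotProduct_self_pos {X : Type*} [Fintype X] {u : X → ℝ} (hu : u ≠ 0) : 0 < u ⬝ᵥ u := by
  obtain ⟨x, hx⟩ := Function.ne_iff.1 hu
  exact Finset.sum_pos' (fun x _ => mul_self_nonneg (u x))
    ⟨x, Finset.mem_univ x, mul_self_pos.2 hx⟩

theorem eigenvalue_nonneg {X : Type*} [Fintype X] {P : Matrix X X ℝ}
    (hP : ∀ f, 0 ≤ f ⬝ᵥ P *ᵥ f) {μ : ℝ} {u : X → ℝ} (hu : u ≠ 0) (h : P *ᵥ u = μ • u) : 0 ≤ μ := by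
  have h1 := hP u
  rw [h, dotProduct_smul, smul_eq_mul] at h1
  have h2 : 0 < u ⬝ᵥ u := dotProduct_self_pos hu
  exact nonneg_of_mul_nonneg_left h1 h2

theorem isLeast_e₁ {M n : ℕ} [NeZero M] (hM : Odd M) (hn : 0 < n) {ℰ : ℝ} (hℰ : 0 < ℰ) {l : ℝ}
    (hl : l ∈ Set.Icc (0 : ℝ) 1) : IsLeast (nonzeroReducedEnergies M n ℰ l) (e₁ M n ℰ l) := by
  have hfin : (nonzeroReducedEnergies M n ℰ l).Finite := by
    refine (energies_finite (reducedH M n ℰ l)).subset ?_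
    rintro μ ⟨⟨v, hv, -, h⟩, -⟩
    exact (mem_energies_iff _ _).2 ⟨v, hv, h⟩
  have hne : (nonzeroReducedEnergies M n ℰ l).Nonempty := by
    obtain ⟨μ, u, hu, h, hμ⟩ := exists_ne_zero_eigenvalue (posR n (lam l) (activeQubit M l))
      (by rw [Matrix.IsHermitian, Matrix.conjTranspose_eq_transpose_of_trivial, posR_transpose])
      ((isStage_lam hl).posR_ne_zero hM hn)
    exact ⟨_, mem_nonzeroReducedEnergies hℰ hu h hμ⟩
  exact ⟨hne.csInf_mem hfin, fun μ hμ => csInf_le hfin.bddBelow hμ⟩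

theorem e₁_pos {M n : ℕ} [NeZero M] (hM : Odd M) (hn : 0 < n) {ℰ : ℝ} (hℰ : 0 < ℰ) {l : ℝ}
    (hl : l ∈ Set.Icc (0 : ℝ) 1) : 0 < e₁ M n ℰ l := by
  obtain ⟨h0, u, hu, h⟩ := exists_of_mem_nonzeroReducedEnergies hℰ (isLeast_e₁ hM hn hℰ hl).1
  have h1 := eigenvalue_nonneg
    (dotProduct_posR_nonneg (isStage_lam hl).mem_Icc (activeQubit M l)) hu h
  have h2 : 0 ≤ e₁ M n ℰ l := by
    by_contra hlt
    exact absurd h1 (not_le.2 (div_neg_of_neg_of_pos (not_le.1 hlt) hℰ))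
  exact lt_of_le_of_ne h2 (Ne.symm h0)

theorem e₁_div_le {M n : ℕ} [NeZero M] (hM : Odd M) (hn : 0 < n) {ℰ : ℝ} (hℰ : 0 < ℰ) {l : ℝ}
    (hl : l ∈ Set.Icc (0 : ℝ) 1) (μ : ℝ) (u : Pos M n → ℝ) (hu : u ≠ 0)
    (h : posR n (lam l) (activeQubit M l) *ᵥ u = μ • u) (hμ : μ ≠ 0) : e₁ M n ℰ l / ℰ ≤ μ := by
  rw [div_le_iff₀ hℰ, mul_comm]
  exact (isLeast_e₁ hM hn hℰ hl).2 (mem_nonzeroReducedEnergies hℰ hu h hμ)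

/-- The lowest nonzero energy decreases while a qubit is being switched on. -/
theorem IsStage.antitone {M n : ℕ} {lam lam' : Fin M → ℝ} {A : Fin M} (hs : IsStage lam A)
    (hs' : IsStage lam' A) (hle : lam A ≤ lam' A) {e e' : ℝ} (he : e ≠ 0) {u : Pos M n → ℝ}
    (hu : u ≠ 0) (h : posR n lam A *ᵥ u = e • u)
    (he' : ∀ (μ : ℝ) (u : Pos M n → ℝ), u ≠ 0 → posR n lam' A *ᵥ u = μ • u → μ ≠ 0 → e' ≤ μ) :
    e' ≤ e := by
  classical
  have hort : ∀ g : Pos M n → ℝ, posR n lam A *ᵥ g = 0 → g ⬝ᵥ u = 0 := by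
    intro g hg
    have h1 := dotProduct_mulVec_comm (posR_transpose lam A) g u
    rw [h, hg, dotProduct_zero, dotProduct_smul, smul_eq_mul] at h1
    exact (mul_eq_zero.1 h1).resolve_left he
  -- The kernel of `posR` does not depend on λ_A, so the old eigenvector is a trial vector for the
  -- new parameter.
  have h1 := hs'.posR_form_ge he' (hort _ hs.posR_mulVec_ind.1) (hort _ hs.posR_mulVec_ind.2)
  have hlam : ∀ B, B ≠ A → lam B = lam' B := by
    intro B hB
    rcases lt_or_gt_of_ne hB with hB | hB
    · rw [hs.before B hB, hs'.before B hB]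
    · rw [hs.after B hB, hs'.after B hB]
  have hlam' : ∀ B, lam B ≤ lam' B := by
    intro B
    by_cases hB : B = A
    · rw [hB]; exact hle
    · exact (hlam B hB).le
  -- With the first gate on A removed, λ_A enters only through the potential 1 - λ_A³ on the next
  -- qubit, which decreases.
  have h2 : u ⬝ᵥ posR n lam' A *ᵥ u ≤ u ⬝ᵥ posR n lam A *ᵥ u := by
    rw [dotProduct_posR_eq, dotProduct_posR_eq]
    refine add_le_add (Finset.sum_le_sum fun x _ => mul_le_mul_of_nonneg_right ?_ (sq_nonneg _))
      (le_of_eq (Finset.sum_congr rfl fun g _ => ?_))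
    · unfold potential
      refine add_le_add_left (Finset.sum_le_sum fun B _ => Finset.sum_le_sum fun C _ => ?_) _
      have : lam B ^ 3 ≤ lam' B ^ 3 := pow_le_pow_left₀ (hs.mem_Icc B).1 (hlam' B) 3
      split_ifs <;> linarith
    · split_ifs with hg
      · congr 1
        unfold gateCoef
        split_ifs with hg'
        · refine (hlam _ fun h => hg.2 ?_).symm
          exact ⟨h, hg'.1.symm.trans h, by rw [hg'.2, h]⟩
        · rfl
      · rfl
  rw [h, dotProduct_smul, smul_eq_mul] at h2
  have h3 : 0 < u ⬝ᵥ u := dotProduct_self_pos hu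
  exact le_of_mul_le_mul_right (h1.trans h2) h3

/-! ### From real forms to the Hamiltonian -/

theorem star_zeroBitVec_dotProduct {M n : ℕ} (u : Pos M n → ℝ) (w : Conf M n → ℂ) :
    star (zeroBitVec u) ⬝ᵥ w = ∑ x, (u x : ℂ) * w (conf x 0) := by
  rw [dotProduct, sum_conf]
  refine Finset.sum_congr rfl fun x _ => ?_
  rw [Finset.sum_eq_single 0]
  · rw [Pi.star_apply, zeroBitVec_zero]
    simp
  · intro b _ hb
    rw [Pi.star_apply, zeroBitVec_ne _ _ hb]
    simp
  · simp

theorem blockForm_zero {M n : ℕ} (P : Matrix (Pos M n) (Pos M n) ℝ) (f : Pos M n → ℝ) :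
    blockForm P 0 f = f ⬝ᵥ P *ᵥ f := by
  rw [blockForm, Finset.sum_eq_zero fun x _ => ?_, add_zero]
  rw [initCount, Finset.sum_eq_zero fun A _ => if_neg fun h => ?_, zero_mul]
  simp at h

theorem dotProduct_self_eq_sum_sq {X : Type*} [Fintype X] (f : X → ℝ) :
    f ⬝ᵥ f = ∑ x, f x ^ 2 := Finset.sum_congr rfl fun _ _ => (pow_two _).symm

theorem form_withInit_ge {M n : ℕ} {ℰ : ℝ} (hℰ : 0 < ℰ) {P : Matrix (Pos M n) (Pos M n) ℝ}
    {u : Pos M n → ℝ} {γ : ℝ} (h0 : ∀ f, u ⬝ᵥ f = 0 → γ * (f ⬝ᵥ f) ≤ f ⬝ᵥ P *ᵥ f)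
    (h1 : ∀ (b : Bits M) (f : Pos M n → ℝ), b ≠ 0 → γ * (f ⬝ᵥ f) ≤ blockForm P b f)
    {v : Conf M n → ℂ} (hv : star (zeroBitVec u) ⬝ᵥ v = 0) :
    ℰ * γ * (star v ⬝ᵥ v).re ≤ (star v ⬝ᵥ withInit ℰ P *ᵥ v).re := by
  rw [re_star_dotProduct_withInit, re_star_dotProduct, mul_assoc]
  refine mul_le_mul_of_nonneg_left ?_ hℰ.le
  rw [Finset.mul_sum]
  refine Finset.sum_le_sum fun b _ => ?_
  rw [mul_add]
  by_cases hb : b = 0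
  · subst hb
    rw [star_zeroBitVec_dotProduct] at hv
    rw [blockForm_zero, blockForm_zero]
    refine add_le_add (h0 _ ?_) (h0 _ ?_)
    · have := congrArg Complex.re hv
      rw [Complex.re_sum] at this
      simp only [Complex.re_ofReal_mul] at this
      exact this
    · have := congrArg Complex.im hv
      rw [Complex.im_sum] at this
      simp only [Complex.im_ofReal_mul] at this
      exact this
  · exact add_le_add (h1 b _ hb) (h1 b _ hb)

theorem blockForm_posH_nonneg {M n : ℕ} {lam : Fin M → ℝ} (h : ∀ B, 0 ≤ lam B ∧ lam B ≤ 1)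
    (A : Fin M) (b : Bits M) (f : Pos M n → ℝ) : 0 ≤ blockForm (posH n lam) b f := by
  refine add_nonneg (dotProduct_posH_nonneg h A f) (Finset.sum_nonneg fun _ _ =>
    mul_nonneg (Finset.sum_nonneg fun A _ => ?_) (sq_nonneg _))
  split_ifs <;> norm_num

theorem form_H_nonneg {M n : ℕ} [NeZero M] {ℰ : ℝ} (hℰ : 0 < ℰ) {l : ℝ}
    (hl : l ∈ Set.Icc (0 : ℝ) 1) (v : Conf M n → ℂ) :
    0 ≤ (star v ⬝ᵥ H (identityCircuit M n) ℰ l *ᵥ v).re := by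
  rw [H_identity_eq, re_star_dotProduct_withInit]
  have h : ∀ B : Fin M, 0 ≤ lam l B ∧ lam l B ≤ 1 := (isStage_lam hl).mem_Icc
  exact mul_nonneg hℰ.le (Finset.sum_nonneg fun b _ =>
    add_nonneg (blockForm_posH_nonneg h (activeQubit M l) b _)
      (blockForm_posH_nonneg h (activeQubit M l) b _))

theorem H_identity_isHermitian {M n : ℕ} (ℰ l : ℝ) :
    (H (identityCircuit M n) ℰ l).IsHermitian := by
  rw [H_identity_eq]
  exact withInit_isHermitian ℰ (posH_transpose _)

/-! ### The bound -/

/-- The weight of the start of the active qubit in the ground state. -/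
noncomputable def startWeight (M n : ℕ) [NeZero M] (l : ℝ) : ℝ :=
  (startSet n (activeQubit M l)).card / ((startSet n (activeQubit M l)).card +
    lam l (activeQubit M l) ^ 2 * (movedSet n (activeQubit M l)).card)

/-- Here x = λ_A² at the given parameter and x' at the later one. After e + 1 + x ≤ 2 + x the claim
is s m (2 + x) ≤ 4 (s + x m)(s + x' m), where the cross term 4 x' s m absorbs 2 s m since x' ≥ ½. -/
theorem quarter_le_of_le_one {e e' s m x x' F Q : ℝ} (hs : 0 < s) (hm : 0 < m) (hx : 0 ≤ x)
    (hx' : 1 / 2 ≤ x') (he : 0 < e) (he1 : e ≤ 1) (hee : e' ≤ e) (hF : 0 ≤ F)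
    (h : e * (s + x * m) * F ≤ Q * (e + 1 + x) * m) :
    1 / 4 * e' * (s / (s + x' * m)) * F ≤ Q := by
  have hQ : 0 ≤ Q := by
    have h1 : 0 ≤ Q * ((e + 1 + x) * m) := by
      refine le_trans ?_ (h.trans_eq (mul_assoc _ _ _))
      positivity
    exact nonneg_of_mul_nonneg_left h1 (by positivity)
  have hden : 0 < s + x' * m := by positivity
  have h2 : e * (s + x * m) * F ≤ Q * ((2 + x) * m) := by
    refine h.trans ?_
    rw [mul_assoc]
    refine mul_le_mul_of_nonneg_left ?_ hQ
    exact mul_le_mul_of_nonneg_right (by linarith) hm.le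
  have h3 : s * ((2 + x) * m) ≤ 4 * (s + x * m) * (s + x' * m) := by
    have h4 : 0 ≤ s * m * (4 * x' - 2) := mul_nonneg (by positivity) (by linarith)
    have h5 : 0 ≤ 4 * s ^ 2 + 3 * (x * m * s) + 4 * (x * m * (x' * m)) := by positivity
    nlinarith
  have h6 : 1 / 4 * e' * (s / (s + x' * m)) * F = 1 / 4 * e' * s * F / (s + x' * m) := by
    field_simp
  rw [h6, div_le_iff₀ hden]
  have hD : 0 < 4 * ((2 + x) * m) := by positivity
  refine le_of_mul_le_mul_right ?_ hD
  calc 1 / 4 * e' * s * F * (4 * ((2 + x) * m)) = e' * F * (s * ((2 + x) * m)) := by ring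
    _ ≤ e * F * (4 * (s + x * m) * (s + x' * m)) := by
        refine mul_le_mul (mul_le_mul_of_nonneg_right hee hF) h3 (by positivity) (by positivity)
    _ = e * (s + x * m) * F * (4 * (s + x' * m)) := by ring
    _ ≤ Q * ((2 + x) * m) * (4 * (s + x' * m)) :=
        mul_le_mul_of_nonneg_right h2 (by positivity)
    _ = Q * (s + x' * m) * (4 * ((2 + x) * m)) := by ring

/-- For e ≥ 1 the gap is at least s / (2m) ≥ 1 / (2ℓ), while the value at λ = 1 is of order ℓ⁻³
because e₁ ≤ 12 / (ℓ(ℓ + 1)). -/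
theorem quarter_le_of_one_le {e e₁ s m x k F Q ℓ : ℝ} (hs : 0 < s) (hmk : m = k * s)
    (hk : 1 ≤ k) (hkℓ : k ≤ ℓ) (hℓ : 9 ≤ ℓ) (hx : 0 ≤ x) (he : 1 ≤ e) (he₁ : 0 < e₁)
    (heℓ : e₁ * (ℓ * (ℓ + 1)) ≤ 12) (hF : 0 ≤ F)
    (h : e * (s + x * m) * F ≤ Q * (e + 1 + x) * m) :
    1 / 4 * e₁ * (1 / (1 + ℓ)) * F ≤ Q := by
  have hm : 0 < m := by rw [hmk]; positivity
  have hQ : 0 ≤ Q := by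
    have h1 : 0 ≤ Q * ((e + 1 + x) * m) := by
      refine le_trans ?_ (h.trans_eq (mul_assoc _ _ _))
      positivity
    exact nonneg_of_mul_nonneg_left h1 (by positivity)
  have h2 : e * (s + x * m) * F ≤ e * (Q * ((2 + x) * m)) := by
    refine h.trans ?_
    have : Q * (e + 1 + x) * m ≤ Q * (e * (2 + x)) * m := by
      refine mul_le_mul_of_nonneg_right (mul_le_mul_of_nonneg_left ?_ hQ) hm.le
      nlinarith
    linarith
  have h3 : (s + x * m) * F ≤ Q * ((2 + x) * m) := by
    rw [mul_assoc] at h2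
    exact le_of_mul_le_mul_left h2 (by linarith)
  have h4 : (2 + x) * s ≤ 2 * (s + x * m) := by
    rw [hmk]
    nlinarith [mul_nonneg hx (mul_nonneg (sub_nonneg.2 hk) hs.le), mul_nonneg hx hs.le]
  have h5 : s * F ≤ 2 * Q * m := by
    have h6 : (2 + x) * (s * F) ≤ (2 + x) * (2 * Q * m) := by
      have := mul_le_mul_of_nonneg_right h4 hF
      linarith
    exact le_of_mul_le_mul_left h6 (by linarith)
  have h6 : F ≤ 2 * Q * ℓ := by
    have h7 : s * F ≤ s * (2 * Q * ℓ) := by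
      refine h5.trans ?_
      rw [hmk]
      have := mul_le_mul_of_nonneg_left hkℓ (mul_nonneg hQ hs.le)
      linarith
    exact le_of_mul_le_mul_left h7 hs
  have h8 : 1 / 4 * e₁ * (1 / (1 + ℓ)) * F ≤ 1 / 4 * e₁ * (1 / (1 + ℓ)) * (2 * Q * ℓ) :=
    mul_le_mul_of_nonneg_left h6 (by positivity)
  refine h8.trans ?_
  have h9 : 1 / 4 * e₁ * (1 / (1 + ℓ)) * (2 * Q * ℓ) = Q * (e₁ * ℓ / (2 * (1 + ℓ))) := by
    field_simp
    ring
  rw [h9]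
  refine mul_le_of_le_one_right hQ ?_
  rw [div_le_one (by positivity)]
  nlinarith

/-- With m = ℓ s the claim reduces to ¼ (e (1 + 2ℓ) + 2ℓ) s ≤ (1 + ℓ) σ. When σ is only half of s,
this needs e (1 + 2ℓ) ≤ 2, which follows from e ≤ 12 / (ℓ(ℓ + 1)) once ℓ ≥ 13. -/
theorem quarter_le_of_bit {e s σ ℓ : ℝ} (hs : 0 < s) (hℓ : 9 ≤ ℓ) (he : 0 < e)
    (heℓ : e * (ℓ * (ℓ + 1)) ≤ 12) (hσ : s ≤ σ ∨ (s ≤ 2 * σ ∧ 13 ≤ ℓ)) :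
    1 / 4 * e * (1 / (1 + ℓ)) * ((e * (s + ℓ * s) + (e + 2) * (ℓ * s)) * (s + ℓ * s)) ≤
      e * (s + ℓ * s) * σ := by
  have h1 : 1 / 4 * e * (1 / (1 + ℓ)) * ((e * (s + ℓ * s) + (e + 2) * (ℓ * s)) * (s + ℓ * s)) =
      e * s * (1 / 4 * (e * (1 + 2 * ℓ) + 2 * ℓ) * s) := by
    field_simp
    ring
  have h2 : e * (s + ℓ * s) * σ = e * s * ((1 + ℓ) * σ) := by ring
  rw [h1, h2]
  refine mul_le_mul_of_nonneg_left ?_ (by positivity)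
  rcases hσ with hσ | ⟨hσ, hℓ'⟩
  · have h3 : e * (1 + 2 * ℓ) ≤ 4 := by nlinarith
    have h4 : 1 / 4 * (e * (1 + 2 * ℓ) + 2 * ℓ) ≤ 1 + ℓ := by linarith
    exact mul_le_mul h4 hσ hs.le (by linarith)
  · have h3 : e * (1 + 2 * ℓ) ≤ 2 := by
      have h5 : 6 * (1 + 2 * ℓ) ≤ ℓ * (ℓ + 1) := by nlinarith
      have h6 : 6 * (e * (1 + 2 * ℓ)) ≤ 12 := by nlinarith
      linarith
    have h4 : 1 / 4 * (e * (1 + 2 * ℓ) + 2 * ℓ) * s ≤ 1 / 2 * (1 + ℓ) * s :=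
      mul_le_mul_of_nonneg_right (by linarith) hs.le
    nlinarith

theorem card_startSet_pos {M n : ℕ} (hM : Odd M) (A : Fin M) : 0 < (startSet n A).card := by
  rw [card_startSet hM]
  positivity

theorem card_movedSet_eq_mul {M n ℓ : ℕ} (hM : Odd M) {A : Fin M}
    (hℓ : topStep n A + 1 = firstStep A + ℓ) :
    ((movedSet n A).card : ℝ) = ℓ * (startSet n A).card := by
  rw [card_movedSet hM, card_startSet hM, hℓ, Nat.add_sub_cancel_left, Nat.cast_mul]

theorem startWeight_pos {M n : ℕ} [NeZero M] (hM : Odd M) (l : ℝ) : 0 < startWeight M n l := by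
  have h : (0 : ℝ) < (startSet n (activeQubit M l)).card := Nat.cast_pos.2 (card_startSet_pos hM _)
  exact div_pos h (by positivity)

theorem startWeight_one {M n ℓ : ℕ} [NeZero M] (hM : Odd M)
    (hℓ : topStep n (activeQubit M 1) + 1 = firstStep (activeQubit M 1) + ℓ) :
    startWeight M n 1 = 1 / (1 + ℓ) := by
  have h : (0 : ℝ) < (startSet n (activeQubit M 1)).card := Nat.cast_pos.2 (card_startSet_pos hM _)
  rw [startWeight, card_movedSet_eq_mul hM hℓ, lam_one]
  field_simp

/-- The quantity whose infimum bounds the gap, for unit energy. -/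
noncomputable def gapValue (M n : ℕ) [NeZero M] (ℰ l : ℝ) : ℝ :=
  1 / 4 * (e₁ M n ℰ l / ℰ) * startWeight M n l

theorem gapValue_pos {M n : ℕ} [NeZero M] (hM : Odd M) (hn : 0 < n) {ℰ : ℝ} (hℰ : 0 < ℰ) {l : ℝ}
    (hl : l ∈ Set.Icc (0 : ℝ) 1) : 0 < gapValue M n ℰ l := by
  have h1 := e₁_pos hM hn hℰ hl
  have h2 := startWeight_pos (n := n) hM l
  unfold gapValue
  positivity

theorem one_mem_Icc : (1 : ℝ) ∈ Set.Icc (0 : ℝ) 1 := ⟨zero_le_one, le_rfl⟩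

/-- The ground state of the Hamiltonian with identity gates, on positions. -/
noncomputable def stageVec (M n : ℕ) [NeZero M] (l : ℝ) : Pos M n → ℝ :=
  groundVec n (activeQubit M l) (lam l (activeQubit M l))

theorem e₁_one_mul_le {M n ℓ : ℕ} [NeZero M] (hM : Odd M) (hn : 0 < n) {ℰ : ℝ} (hℰ : 0 < ℰ)
    (hℓ : topStep n (activeQubit M 1) + 1 = firstStep (activeQubit M 1) + ℓ) (hℓ3 : 3 ≤ ℓ) :
    e₁ M n ℰ 1 / ℰ * (ℓ * (ℓ + 1)) ≤ 12 :=
  (isStage_lam one_mem_Icc).eigenvalue_le hM (e₁_div_le hM hn hℰ one_mem_Icc) hℓ (by omega)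

theorem exists_min_gapValue_le_posH {M n : ℕ} [NeZero M] (hM : Odd M) (hn2 : 2 ≤ n) {ℰ : ℝ}
    (hℰ : 0 < ℰ) {l : ℝ} (hl : l ∈ Set.Icc (0 : ℝ) 1) :
    ∃ l' ∈ Set.Icc (0 : ℝ) 1, ∀ f : Pos M n → ℝ, stageVec M n l ⬝ᵥ f = 0 →
      min (gapValue M n ℰ 1) (gapValue M n ℰ l') * (f ⬝ᵥ f) ≤ f ⬝ᵥ posH n (lam l) *ᵥ f := by
  have hn : 0 < n := by omega
  obtain ⟨l', hl', hA, hle, hhalf⟩ := exists_later_parameter (M := M) hl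
  refine ⟨l', hl', fun f hf => ?_⟩
  have hs := isStage_lam (M := M) hl
  have he := e₁_div_le (n := n) hM hn hℰ hl
  have he0 : 0 < e₁ M n ℰ l / ℰ := div_pos (e₁_pos hM hn hℰ hl) hℰ
  have hS := card_startSet_pos (n := n) hM (activeQubit M l)
  obtain ⟨k, hk, hk3, hkle, -⟩ := exists_ell n hn hM (activeQubit M l)
  obtain ⟨ℓ, hℓ, hℓ3, -, hℓeq⟩ := exists_ell n hn hM (activeQubit M 1)
  have hℓeq := hℓeq (activeQubit_one M)
  have hM1 := hM.pos
  have hm := card_movedSet_eq_mul (n := n) hM hk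
  have hS' : (0 : ℝ) < (startSet n (activeQubit M l)).card := Nat.cast_pos.2 hS
  have hk3' : (3 : ℝ) ≤ k := by exact_mod_cast hk3
  have hff : 0 ≤ f ⬝ᵥ f := (dotProduct_self_eq_sum_sq f).symm ▸ Finset.sum_nonneg fun _ _ => sq_nonneg _
  have key := hs.posH_form_ge he0 he hS hf
  -- A small e is compared with the later parameter of the same stage, a large e with λ = 1.
  rcases le_total (e₁ M n ℰ l / ℰ) 1 with he1 | he1
  · refine (mul_le_mul_of_nonneg_right (min_le_right _ _) hff).trans ?_
    obtain ⟨hne, u, hu, hu'⟩ := exists_of_mem_nonzeroReducedEnergies hℰ (isLeast_e₁ hM hn hℰ hl).1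
    have hs' := isStage_lam (M := M) hl'
    have he' := e₁_div_le (n := n) hM hn hℰ hl'
    rw [hA] at hs' he'
    have hee := hs.antitone hs' hle he0.ne' hu hu' he'
    rw [gapValue, startWeight, hA]
    refine quarter_le_of_le_one hS' ?_ (sq_nonneg _) hhalf he0 he1 hee hff key
    rw [hm]
    positivity
  · refine (mul_le_mul_of_nonneg_right (min_le_left _ _) hff).trans ?_
    rw [gapValue, startWeight_one hM hℓ]
    refine quarter_le_of_one_le hS' hm (by linarith) (by exact_mod_cast hℓeq ▸ hkle) ?_
      (sq_nonneg _) he1 (div_pos (e₁_pos hM hn hℰ one_mem_Icc) hℰ)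
      (e₁_one_mul_le hM hn hℰ hℓ hℓ3) hff key
    have : 9 ≤ ℓ := by omega
    exact_mod_cast this

theorem gapValue_le_blockForm {M n : ℕ} [NeZero M] (hM : Odd M) (hn2 : 2 ≤ n) {ℰ : ℝ}
    (hℰ : 0 < ℰ) {lam' : Fin M → ℝ} (hlam : ∀ B, 0 ≤ lam' B ∧ lam' B ≤ 1) {b : Bits M}
    (hb : b ≠ 0) (f : Pos M n → ℝ) :
    gapValue M n ℰ 1 * (f ⬝ᵥ f) ≤ blockForm (posH n lam') b f := by
  have hn : 0 < n := by omega
  have hMpos := hM.pos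
  obtain ⟨B, hB⟩ := Function.ne_iff.1 hb
  have hB1 : b B = 1 := by
    rw [Pi.zero_apply] at hB
    omega
  have hT := activeQubit_one M
  obtain ⟨ℓ, hℓ, hℓ3, -, hℓeq⟩ := exists_ell n hn hM (activeQubit M 1)
  have hℓeq := hℓeq hT
  have hm := card_movedSet_eq_mul (n := n) hM hℓ
  have hS' : (0 : ℝ) < (startSet n (activeQubit M 1)).card := Nat.cast_pos.2 (card_startSet_pos hM _)
  have hℓ3' : (3 : ℝ) ≤ ℓ := by exact_mod_cast hℓ3
  have he := e₁_div_le (n := n) hM hn hℰ one_mem_Icc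
  rw [lam_one] at he
  have he0 : 0 < e₁ M n ℰ 1 / ℰ := div_pos (e₁_pos hM hn hℰ one_mem_Icc) hℰ
  have h12 := e₁_one_mul_le hM hn hℰ hℓ hℓ3
  -- For M ≥ 3 the general count loses a factor 2, but then ℓ = 4n + 2M - 1 ≥ 13. For M = 1 the
  -- qubit B is the last one and nothing is lost.
  have hσ : ((startSet n (activeQubit M 1)).card : ℝ) ≤ (legalStart n B).card ∨
      ((startSet n (activeQubit M 1)).card : ℝ) ≤ 2 * (legalStart n B).card ∧ (13 : ℝ) ≤ ℓ := by
    rcases Nat.lt_or_ge 1 M with hM1 | hM1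
    · have hM3 : 3 ≤ M := by
        obtain ⟨k, rfl⟩ := hM
        omega
      have h13 : 13 ≤ ℓ := by omega
      refine Or.inr ⟨?_, by exact_mod_cast h13⟩
      have h := le_card_legalStart hM hn B
      rw [show M - 1 = (activeQubit M 1).val by omega, ← card_startSet (n := n) hM] at h
      exact_mod_cast h
    · have hBT : B = activeQubit M 1 := Fin.ext (by omega)
      refine Or.inl (Nat.cast_le.2 (Finset.card_le_card fun x hx => ?_))
      rw [mem_startSet, active_last hT] at hx
      rw [mem_legalStart, hBT]
      exact hx
  rw [gapValue, startWeight_one hM hℓ, dotProduct_self_eq_sum_sq]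
  refine blockForm_ge_of_bit hT he0 he hB1 hlam rfl hm.symm rfl hS' (by positivity) ?_ ?_
    (quarter_le_of_bit hS' ?_ he0 h12 hσ) f
  · rcases hσ with hσ | ⟨hσ, -⟩ <;> linarith
  · have h1 : e₁ M n ℰ 1 / ℰ ≤ 1 := by
      have h3 : (12 : ℝ) ≤ ℓ * (ℓ + 1) := by nlinarith
      nlinarith [mul_le_mul_of_nonneg_left h3 he0.le]
    have h2 : 1 / (1 + (ℓ : ℝ)) ≤ 1 := by
      rw [div_le_one (by positivity)]
      linarith
    exact mul_le_one₀ (by linarith) (by positivity) h2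
  · have : 9 ≤ ℓ := by omega
    exact_mod_cast this

theorem stageVec_posH {M n : ℕ} [NeZero M] {l : ℝ} (hl : l ∈ Set.Icc (0 : ℝ) 1) :
    posH n (lam l) *ᵥ stageVec M n l = 0 := (isStage_lam hl).posH_mulVec_groundVec

/-- The ground state of the Hamiltonian with identity gates. -/
noncomputable def stageState (M n : ℕ) [NeZero M] (l : ℝ) : Conf M n → ℂ :=
  zeroBitVec (stageVec M n l)

theorem H_identity_mulVec_stageState {M n : ℕ} [NeZero M] (ℰ : ℝ) {l : ℝ}
    (hl : l ∈ Set.Icc (0 : ℝ) 1) :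
    H (identityCircuit M n) ℰ l *ᵥ stageState M n l = 0 := by
  rw [H_identity_eq, stageState, withInit_mulVec_zeroBitVec, stageVec_posH hl]
  funext c
  simp [zeroBitVec]

theorem exists_min_gapValue_le_form {M n : ℕ} [NeZero M] (hM : Odd M) (hn2 : 2 ≤ n) {ℰ : ℝ}
    (hℰ : 0 < ℰ) {l : ℝ} (hl : l ∈ Set.Icc (0 : ℝ) 1) :
    ∃ l' ∈ Set.Icc (0 : ℝ) 1, ∀ v : Conf M n → ℂ, star (stageState M n l) ⬝ᵥ v = 0 →
      ℰ * min (gapValue M n ℰ 1) (gapValue M n ℰ l') * (star v ⬝ᵥ v).re ≤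
        (star v ⬝ᵥ H (identityCircuit M n) ℰ l *ᵥ v).re := by
  obtain ⟨l', hl', h⟩ := exists_min_gapValue_le_posH (n := n) hM hn2 hℰ hl
  refine ⟨l', hl', fun v hv => ?_⟩
  rw [H_identity_eq]
  refine form_withInit_ge hℰ h (fun b f hb => ?_) hv
  refine (mul_le_mul_of_nonneg_right (min_le_left _ _) ?_).trans
    (gapValue_le_blockForm hM hn2 hℰ (isStage_lam hl).mem_Icc hb f)
  rw [dotProduct_self_eq_sum_sq]
  exact Finset.sum_nonneg fun _ _ => sq_nonneg _

theorem star_stageState_dotProduct_self {M n : ℕ} [NeZero M] (l : ℝ) :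
    star (stageState M n l) ⬝ᵥ stageState M n l =
      (((startSet n (activeQubit M l)).card + lam l (activeQubit M l) ^ 2 *
        (movedSet n (activeQubit M l)).card : ℝ) : ℂ) := by
  rw [← groundVec_dotProduct_self, stageState, star_zeroBitVec_dotProduct]
  simp only [zeroBitVec_zero, dotProduct, Complex.ofReal_sum, Complex.ofReal_mul]
  rfl

theorem numBit_stageState {M n : ℕ} [NeZero M] (l : ℝ) :
    star (stageState M n l) ⬝ᵥ
      numBit (activeQubit M l) (firstStep (activeQubit M l) - 1) 0 *ᵥ stageState M n l =
      ((startSet n (activeQubit M l)).card : ℂ) := by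
  rw [stageState, star_zeroBitVec_dotProduct, numBit_eq_diagonal]
  simp only [Matrix.mulVec_diagonal, zeroBitVec_zero, conf, Pi.zero_apply, and_true]
  rw [Finset.cast_card, ← Finset.sum_subset (Finset.subset_univ (startSet n (activeQubit M l)))]
  · refine Finset.sum_congr rfl fun x hx => ?_
    have hx' := (mem_startSet.1 hx).2
    have h2 : x ∉ movedSet n (activeQubit M l) := fun h => (mem_movedSet.1 h).2 hx'
    rw [if_pos hx', stageVec, groundVec, Pi.add_apply, Pi.smul_apply, ind_of_mem hx,
      ind_of_notMem h2]
    simp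
  · intro x _ hx
    split_ifs with h
    · have h2 : x ∉ movedSet n (activeQubit M l) := fun h' => (mem_movedSet.1 h').2 h
      rw [stageVec, groundVec, Pi.add_apply, Pi.smul_apply, ind_of_notMem hx, ind_of_notMem h2]
      simp
    · simp

theorem stageState_ne_zero {M n : ℕ} [NeZero M] (hM : Odd M) (l : ℝ) : stageState M n l ≠ 0 := by
  intro h
  have h1 := star_stageState_dotProduct_self (M := M) (n := n) l
  rw [h, dotProduct_zero, eq_comm, Complex.ofReal_eq_zero] at h1
  have h2 : (0 : ℝ) < (startSet n (activeQubit M l)).card := Nat.cast_pos.2 (card_startSet_pos hM _)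
  have h3 : (0 : ℝ) ≤ lam l (activeQubit M l) ^ 2 * (movedSet n (activeQubit M l)).card := by
    positivity
  linarith

theorem IsGroundState.mulVec_eq_zero {M n : ℕ} {K : Op M n} {ψ : Conf M n → ℂ}
    (h : IsGroundState K ψ) (hK : ∀ v, 0 ≤ (star v ⬝ᵥ K *ᵥ v).re) {φ : Conf M n → ℂ}
    (hφ : φ ≠ 0) (hKφ : K *ᵥ φ = 0) : K *ᵥ ψ = 0 := by
  obtain ⟨h1, E, hE, hKψ⟩ := h
  have h2 : E ≤ 0 := hE.2 ((mem_energies_iff K 0).2 ⟨φ, hφ, by simp [hKφ]⟩)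
  have h3 : 0 ≤ E := by
    have := hK ψ
    rw [hKψ, dotProduct_smul, h1] at this
    simpa using this
  rw [hKψ, le_antisymm h2 h3]
  simp

theorem eq_smul_of_form_ge {ι : Type*} [Fintype ι] {K : Matrix ι ι ℂ} {φ ψ : ι → ℂ}
    (hφ : star φ ⬝ᵥ φ ≠ 0) (hKφ : K *ᵥ φ = 0) (hKψ : K *ᵥ ψ = 0) {γ : ℝ} (hγ : 0 < γ)
    (h : ∀ v, star φ ⬝ᵥ v = 0 → γ * (star v ⬝ᵥ v).re ≤ (star v ⬝ᵥ K *ᵥ v).re) :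
    ψ = (star φ ⬝ᵥ ψ / (star φ ⬝ᵥ φ)) • φ := by
  by_contra hne
  have h1 := h (ψ - (star φ ⬝ᵥ ψ / (star φ ⬝ᵥ φ)) • φ) (by
    rw [dotProduct_sub, dotProduct_smul, smul_eq_mul, div_mul_cancel₀ _ hφ, sub_self])
  rw [Matrix.mulVec_sub, Matrix.mulVec_smul, hKφ, hKψ, smul_zero, sub_zero, dotProduct_zero,
    Complex.zero_re] at h1
  have h2 := mul_pos hγ (star_dotProduct_self_pos (sub_ne_zero.2 hne))
  linarith

/-- The gap already established shows that a ground state of the identity circuit is a multiple of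
`stageState`. The phase drops out and normalization gives the ratio of counts. -/
theorem startOccupation_eq {M n : ℕ} [NeZero M] (hM : Odd M) (hn2 : 2 ≤ n) {ℰ : ℝ}
    (hℰ : 0 < ℰ) {l : ℝ} (hl : l ∈ Set.Icc (0 : ℝ) 1) {ψ : Conf M n → ℂ}
    (hψ : IsGroundState (H (identityCircuit M n) ℰ l) ψ) :
    startOccupation l ψ = startWeight M n l := by
  obtain ⟨l', hl', h⟩ := exists_min_gapValue_le_form hM hn2 hℰ hl
  have hn : 0 < n := by omega
  have hγ : 0 < ℰ * min (gapValue M n ℰ 1) (gapValue M n ℰ l') :=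
    mul_pos hℰ (lt_min (gapValue_pos hM hn hℰ one_mem_Icc) (gapValue_pos hM hn hℰ hl'))
  have h0 := H_identity_mulVec_stageState (M := M) (n := n) ℰ hl
  have hne := stageState_ne_zero (n := n) hM l
  have hself := star_stageState_dotProduct_self (M := M) (n := n) l
  have hs : (0 : ℝ) < (startSet n (activeQubit M l)).card := Nat.cast_pos.2 (card_startSet_pos hM _)
  set s : ℝ := ((startSet n (activeQubit M l)).card : ℝ) with hsdef
  set t : ℝ := s + lam l (activeQubit M l) ^ 2 * (movedSet n (activeQubit M l)).card with ht
  have ht0 : 0 < t := by positivity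
  obtain ⟨c, hc⟩ : ∃ c : ℂ, ψ = c • stageState M n l :=
    ⟨_, eq_smul_of_form_ge (by rw [hself]; exact Complex.ofReal_ne_zero.2 ht0.ne') h0
      (hψ.mulVec_eq_zero (form_H_nonneg hℰ hl) hne h0) hγ h⟩
  have hnorm := hψ.1
  rw [hc, star_smul, smul_dotProduct, dotProduct_smul, hself, smul_eq_mul, smul_eq_mul,
    ← mul_assoc, Complex.star_def, Complex.conj_mul', ← Complex.ofReal_pow, ← Complex.ofReal_mul,
    ← Complex.ofReal_one, Complex.ofReal_inj] at hnorm
  rw [startOccupation, expectation, hc, Matrix.mulVec_smul, star_smul, smul_dotProduct,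
    dotProduct_smul, numBit_stageState, smul_eq_mul, smul_eq_mul, ← mul_assoc, Complex.star_def,
    Complex.conj_mul', ← Complex.ofReal_pow, Complex.re_ofReal_mul, Complex.natCast_re,
    startWeight, ← hsdef, ← ht, eq_div_iff ht0.ne', mul_right_comm, hnorm, one_mul]

theorem gauge_conjTranspose_mul {M n : ℕ} (U : OneDimCircuit M n) : (gauge U)ᴴ * gauge U = 1 :=
  mul_eq_one_comm.1 (gauge_mul_conjTranspose U)

theorem star_dotProduct_gauge {M n : ℕ} (U : OneDimCircuit M n) (v w : Conf M n → ℂ) :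
    star v ⬝ᵥ gauge U *ᵥ w = star ((gauge U)ᴴ *ᵥ v) ⬝ᵥ w := by
  rw [Matrix.star_mulVec, Matrix.conjTranspose_conjTranspose, Matrix.dotProduct_mulVec]

theorem star_gauge_dotProduct_self {M n : ℕ} (U : OneDimCircuit M n) (v : Conf M n → ℂ) :
    star ((gauge U)ᴴ *ᵥ v) ⬝ᵥ (gauge U)ᴴ *ᵥ v = star v ⬝ᵥ v := by
  rw [← star_dotProduct_gauge, Matrix.mulVec_mulVec, gauge_mul_conjTranspose, Matrix.one_mulVec]

theorem star_dotProduct_H_mulVec {M n : ℕ} (U : OneDimCircuit M n) (ℰ l : ℝ)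
    (v : Conf M n → ℂ) : star v ⬝ᵥ H U ℰ l *ᵥ v = star ((gauge U)ᴴ *ᵥ v) ⬝ᵥ
      H (identityCircuit M n) ℰ l *ᵥ ((gauge U)ᴴ *ᵥ v) := by
  rw [H_eq_gauge_conj, ← star_dotProduct_gauge, Matrix.mulVec_mulVec, Matrix.mulVec_mulVec,
    Matrix.mul_assoc]

theorem exists_isGap_H {M n : ℕ} [NeZero M] (hM : Odd M) (hn2 : 2 ≤ n) {ℰ : ℝ} (hℰ : 0 < ℰ)
    (U : OneDimCircuit M n) {l : ℝ} (hl : l ∈ Set.Icc (0 : ℝ) 1) :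
    ∃ l' ∈ Set.Icc (0 : ℝ) 1, ∃ g, IsGap (H U ℰ l) g ∧
      ℰ * min (gapValue M n ℰ 1) (gapValue M n ℰ l') ≤ g := by
  obtain ⟨l', hl', h⟩ := exists_min_gapValue_le_form hM hn2 hℰ hl
  have hn : 0 < n := by omega
  refine ⟨l', hl', ?_⟩
  have hγ : 0 < ℰ * min (gapValue M n ℰ 1) (gapValue M n ℰ l') :=
    mul_pos hℰ (lt_min (gapValue_pos hM hn hℰ one_mem_Icc) (gapValue_pos hM hn hℰ hl'))
  have hcancel : ∀ w : Conf M n → ℂ, (gauge U)ᴴ *ᵥ gauge U *ᵥ w = w := fun w => by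
    rw [Matrix.mulVec_mulVec, gauge_conjTranspose_mul, Matrix.one_mulVec]
  have hinner : ∀ w v : Conf M n → ℂ, star (gauge U *ᵥ w) ⬝ᵥ v = star w ⬝ᵥ (gauge U)ᴴ *ᵥ v :=
    fun w v => by rw [Matrix.star_mulVec, Matrix.dotProduct_mulVec]
  refine exists_isGap (H U ℰ l) ?_ (fun v => ?_) (gauge U *ᵥ stageState M n l) (fun h0 => ?_) ?_ _
    hγ (fun v hv => ?_) ?_
  · rw [H_eq_gauge_conj]
    exact Matrix.isHermitian_mul_mul_conjTranspose _ (H_identity_isHermitian ℰ l)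
  · rw [star_dotProduct_H_mulVec]
    exact form_H_nonneg hℰ hl _
  · refine stageState_ne_zero (n := n) hM l ?_
    rw [← hcancel (stageState M n l), h0, Matrix.mulVec_zero]
  · rw [H_eq_gauge_conj, ← Matrix.mulVec_mulVec, hcancel, ← Matrix.mulVec_mulVec,
      H_identity_mulVec_stageState ℰ hl, Matrix.mulVec_zero]
  · rw [star_dotProduct_H_mulVec, ← star_gauge_dotProduct_self U]
    exact h _ (by rw [← hinner, hv])
  -- A basis state with all bits one is orthogonal to the ground state, which lives in the zero-bit
  -- block; its image under the gauge shows the space is more than one-dimensional.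
  · let c : Conf M n := conf (floorPos n (activeQubit M l) False) fun _ => 1
    refine ⟨gauge U *ᵥ Pi.single c 1, fun h0 => ?_, ?_⟩
    · have h1 := hcancel (Pi.single c 1)
      rw [h0, Matrix.mulVec_zero] at h1
      have h2 := congrFun h1 c
      simp at h2
    · rw [hinner, hcancel, dotProduct_single, mul_one, Pi.star_apply, stageState]
      have hb : (fun _ => 1 : Bits M) ≠ 0 := fun h => one_ne_zero (congrFun h (activeQubit M l))
      rw [zeroBitVec_ne _ _ hb, star_zero]

end GSQC

/-! ### The gap theorem -/

theorem mainTheorem2 (M n : ℕ) [NeZero M] (hM : Odd M) (hn : Even n) (hn_pos : 0 < n)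
    (hnM : M - 1 ≤ n) (ℰ : ℝ) (hℰ : 0 < ℰ) (U : GSQC.OneDimCircuit M n)
    (ψ₀ : ℝ → GSQC.Conf M n → ℂ)
    (hψ₀ : ∀ l ∈ Set.Icc (0 : ℝ) 1,
      GSQC.IsGroundState (GSQC.H (GSQC.identityCircuit M n) ℰ l) (ψ₀ l)) :
    (∀ l ∈ Set.Icc (0 : ℝ) 1,
      IsLeast (GSQC.nonzeroReducedEnergies M n ℰ l) (GSQC.e₁ M n ℰ l)) ∧
    ∀ l ∈ Set.Icc (0 : ℝ) 1, ∃ g : ℝ, GSQC.IsGap (GSQC.H U ℰ l) g ∧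
      (⨅ l' : Set.Icc (0 : ℝ) 1,
        1 / 4 * GSQC.e₁ M n ℰ l' * GSQC.startOccupation (l' : ℝ) (ψ₀ l')) ≤ g := by
  refine ⟨fun l hl => GSQC.isLeast_e₁ hM hn_pos hℰ hl, fun l hl => ?_⟩
  -- This makes ℓ = 4n + 2M - 1 at least 9, as the numerical comparisons require.
  have hn2 : 2 ≤ n := by
    obtain ⟨k, rfl⟩ := hn
    omega
  have hval : ∀ l' : Set.Icc (0 : ℝ) 1, 1 / 4 * GSQC.e₁ M n ℰ l' *
      GSQC.startOccupation (l' : ℝ) (ψ₀ l') = ℰ * GSQC.gapValue M n ℰ l' := by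
    intro l'
    rw [GSQC.startOccupation_eq hM hn2 hℰ l'.2 (hψ₀ l' l'.2), GSQC.gapValue]
    field_simp
  obtain ⟨l', hl', g, hg, hle⟩ := GSQC.exists_isGap_H hM hn2 hℰ U hl
  refine ⟨g, hg, le_trans ?_ hle⟩
  simp only [hval]
  have hbdd : BddBelow (Set.range fun l' : Set.Icc (0 : ℝ) 1 => ℰ * GSQC.gapValue M n ℰ l') := by
    refine ⟨0, ?_⟩
    rintro _ ⟨x, rfl⟩
    exact (mul_pos hℰ (GSQC.gapValue_pos hM hn_pos hℰ x.2)).le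
  -- The gap exceeds the smaller of two values under the infimum, at λ' = 1 and at the later
  -- parameter, and the infimum is below both.
  rw [mul_min_of_nonneg _ _ hℰ.le]
  exact le_min (ciInf_le hbdd ⟨1, GSQC.one_mem_Icc⟩) (ciInf_le hbdd ⟨l', hl'⟩)
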